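/- Let $k$ be an algebraically closed field with $\operatorname{char} k \neq 2, 3$, let $P = k[x_1,\dots,x_n]$, and let $S = k[[\alpha_1,\dots,\alpha_n]]$ act on $P$ by contraction, $\alpha^{\mathbf b}\lrcorner x^{\mathbf a} = x^{\mathbf a-\mathbf b}$ if $\mathbf b \le \mathbf a$ componentwise and $0$ otherwise. For a polynomial $f$, $\operatorname{Apolar}(f)$ is the quotient of the dual power series ring by the annihilator of $f$. For $d \geq 2$ and $\partial$ in the maximal ideal of $S$, the $d$-th ray sum of $f$ with respect to $\partial$ is $f + y^d\,(\partial\lrcorner f) + y^{2d}\,(\partial^2\lrcorner f) + \cdots \in P[y]$. A finite $k$-algebra $A$ with $\operatorname{Spec} A \subseteq \mathbb{A}^N \subseteq \mathbb{P}^N$ is unobstructed if it is smoothable (the special fibre of a finite flat family over an irreducible base whose general fibre is smooth) and the tangent space to the Hilbert scheme of points of $\mathbb{P}^N$ at $[\operatorname{Spec} A]$ has dimension $N\cdot\dim_k A$. Let $d, m \geq 2$ be integers with $\operatorname{char} k = 0$ or $d \le \operatorname{char} k$. Let $f \in P$ and $\partial \in S$ be such that $\operatorname{Apolar}(f)$ and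 $\operatorname{Apolar}(\partial\lrcorner f)$ are complete intersections, $\partial^2\lrcorner f = 0$, and $\deg(\partial\lrcorner f) > 0$. Let $g \in P[y]$ be the $d$-th ray sum of $f$ with respect to $\partial$, so that $g = f + y^d\,(\partial\lrcorner f)$. There exists $\sigma \in S$ with $\sigma\lrcorner(\partial\lrcorner f) = 1$; for any such $\sigma$ put $\varphi = \sigma\beta \in S[[\beta]]$, where $\beta$ is the variable dual to $y$, and let $h \in P[y,z]$ be the $m$-th ray sum of $g$ with respect to $\varphi$. Then $$h = f + y^d\,(\partial\lrcorner f) + z^m y^{d-1},$$ and $\operatorname{Apolar}(h)$, embedded in $\mathbb{A}^{n+2}$ by its dual variables, is unobstructed. -/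

import Mathlib

noncomputable section

/-! ### Contraction and apolar algebras -/

open Classical in
/-- The contraction `s ⌟ p` of a polynomial `p` by a power series `s` in the dual variables:
`α ^ b ⌟ x ^ a = x ^ (a - b)` if `b ≤ a` and `0` otherwise, extended linearly in `p` and countably
linearly in `s`. (The pairs in the antidiagonal of `a` are the `(b, a - b)` with `b ≤ a`.) -/
def contract {ι k : Type*} [CommSemiring k] (s : MvPowerSeries ι k) (p : MvPolynomial ι k) :
    MvPolynomial ι k :=
  ∑ a ∈ p.support, ∑ u ∈ Finset.HasAntidiagonal.antidiagonal a,
    MvPolynomial.monomial u.2 (MvPowerSeries.coeff u.1 s * MvPolynomial.coeff a p)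

section ContractLemmas

variable {ι k : Type*}

open Classical in
theorem contract_eq_sum [CommSemiring k] (s : MvPowerSeries ι k) (p : MvPolynomial ι k)
    (A : Finset (ι →₀ ℕ)) (hA : p.support ⊆ A) :
    contract s p = ∑ a ∈ A, ∑ u ∈ Finset.HasAntidiagonal.antidiagonal a,
      MvPolynomial.monomial u.2 (MvPowerSeries.coeff u.1 s * MvPolynomial.coeff a p) := by
  unfold contract
  refine Finset.sum_subset hA fun a _ ha => ?_
  rw [MvPolynomial.notMem_support_iff] at ha
  simp [ha]

theorem contract_add_right [CommSemiring k] (s : MvPowerSeries ι k) (p q : MvPolynomial ι k) :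
    contract s (p + q) = contract s p + contract s q := by
  classical
  rw [contract_eq_sum s (p + q) (p.support ∪ q.support) MvPolynomial.support_add,
    contract_eq_sum s p (p.support ∪ q.support) Finset.subset_union_left,
    contract_eq_sum s q (p.support ∪ q.support) Finset.subset_union_right,
    ← Finset.sum_add_distrib]
  refine Finset.sum_congr rfl fun a _ => ?_
  rw [← Finset.sum_add_distrib]
  refine Finset.sum_congr rfl fun u _ => ?_
  rw [MvPolynomial.coeff_add, mul_add, map_add]

theorem contract_add_left [CommSemiring k] (s t : MvPowerSeries ι k) (p : MvPolynomial ι k) :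
    contract (s + t) p = contract s p + contract t p := by
  simp only [contract, map_add, add_mul, Finset.sum_add_distrib]

theorem contract_zero_left [CommSemiring k] (p : MvPolynomial ι k) :
    contract (0 : MvPowerSeries ι k) p = 0 := by
  simp [contract]

theorem contract_zero_right [CommSemiring k] (s : MvPowerSeries ι k) :
    contract s (0 : MvPolynomial ι k) = 0 := by
  simp [contract]

theorem contract_sum_right [CommSemiring k] {κ : Type*} (s : MvPowerSeries ι k) (A : Finset κ)
    (p : κ → MvPolynomial ι k) : contract s (∑ j ∈ A, p j) = ∑ j ∈ A, contract s (p j) := by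
  classical
  induction A using Finset.induction_on with
  | empty => simp [contract_zero_right]
  | insert j A hj ih => rw [Finset.sum_insert hj, Finset.sum_insert hj, contract_add_right, ih]

open Classical in
theorem contract_monomial [CommSemiring k] (s : MvPowerSeries ι k) (a : ι →₀ ℕ) (r : k) :
    contract s (MvPolynomial.monomial a r) = ∑ u ∈ Finset.HasAntidiagonal.antidiagonal a,
      MvPolynomial.monomial u.2 (MvPowerSeries.coeff u.1 s * r) := by
  rw [contract_eq_sum s _ {a} MvPolynomial.support_monomial_subset]
  simp

theorem contract_mul [CommSemiring k] (t s : MvPowerSeries ι k) (p : MvPolynomial ι k) :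
    contract (t * s) p = contract t (contract s p) := by
  classical
  induction p using MvPolynomial.induction_on' with
  | add p q hp hq => simp only [contract_add_right, hp, hq]
  | monomial a r =>
    rw [contract_monomial, contract_monomial, contract_sum_right]
    simp only [contract_monomial, MvPowerSeries.coeff_mul, Finset.sum_mul, map_sum]
    rw [Finset.sum_sigma', Finset.sum_sigma']
    refine Finset.sum_bij' (fun x _ => ⟨(x.2.2, x.2.1 + x.1.2), (x.2.1, x.1.2)⟩)
      (fun y _ => ⟨(y.2.1 + y.1.1, y.2.2), (y.2.1, y.1.1)⟩) ?_ ?_ ?_ ?_ ?_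
    · rintro ⟨⟨u, g⟩, ⟨e, b⟩⟩ h
      simp only [Finset.mem_sigma, Finset.HasAntidiagonal.mem_antidiagonal] at h ⊢
      obtain ⟨h1, h2⟩ := h
      refine ⟨?_, trivial⟩
      rw [← h1, ← h2]; abel
    · rintro ⟨⟨b, c⟩, ⟨e, g⟩⟩ h
      simp only [Finset.mem_sigma, Finset.HasAntidiagonal.mem_antidiagonal] at h ⊢
      obtain ⟨h1, h2⟩ := h
      refine ⟨?_, trivial⟩
      rw [← h1, ← h2]; abel
    · rintro ⟨⟨u, g⟩, ⟨e, b⟩⟩ h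
      simp only [Finset.mem_sigma, Finset.HasAntidiagonal.mem_antidiagonal] at h
      obtain ⟨h1, rfl⟩ := h
      rfl
    · rintro ⟨⟨b, c⟩, ⟨e, g⟩⟩ h
      simp only [Finset.mem_sigma, Finset.HasAntidiagonal.mem_antidiagonal] at h
      obtain ⟨h1, rfl⟩ := h
      rfl
    · rintro ⟨⟨u, g⟩, ⟨e, b⟩⟩ h
      simp only
      rw [mul_assoc]

end ContractLemmas

/-- The apolar ideal `Ann(f)` in the power series ring, i.e. all `s` with `s ⌟ f = 0`. -/
def apolarIdeal {ι k : Type*} [CommRing k] (f : MvPolynomial ι k) :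
    Ideal (MvPowerSeries ι k) where
  carrier := {s | contract s f = 0}
  add_mem' := by
    intro s t hs ht
    change contract s f = 0 at hs
    change contract t f = 0 at ht
    change contract (s + t) f = 0
    rw [contract_add_left, hs, ht, add_zero]
  zero_mem' := contract_zero_left f
  smul_mem' := by
    intro t s hs
    change contract s f = 0 at hs
    change contract (t • s) f = 0
    rw [smul_eq_mul, contract_mul, hs, contract_zero_right]

/-- The apolar algebra `Apolar(f)`, the power series ring modulo `Ann(f)`. -/
abbrev Apolar {ι k : Type*} [CommRing k] (f : MvPolynomial ι k) : Type _ :=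
  MvPowerSeries ι k ⧸ apolarIdeal f

/-- The presentation of `Apolar(f)` as a quotient of the polynomial ring in the dual variables,
i.e. the embedding of `Spec Apolar(f)` into affine space. -/
def apolarPresentation {ι k : Type*} [CommRing k] (f : MvPolynomial ι k) :
    MvPolynomial ι k →ₐ[k] Apolar f :=
  (Ideal.Quotient.mkₐ k (apolarIdeal f)).comp (MvPolynomial.coeToMvPowerSeries.algHom k)

/-- `S ⧸ I` is a complete intersection, for an ideal `I` of a regular local ring `S`:
`I` is generated by a regular sequence. -/
def IsCompleteIntersection {S : Type*} [CommRing S] (I : Ideal S) : Prop :=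
  ∃ rs : List S, RingTheory.Sequence.IsRegular S rs ∧ Ideal.ofList rs = I

/-! ### Ray sums -/

/-- The `d`-th ray sum `f + y ^ d (D ⌟ f) + y ^ (2 d) (D ^ 2 ⌟ f) + ⋯` of `f` with respect to an
element `D` of the maximal ideal; the new variable `y` is `X none`. All terms with `i > deg f`
vanish when `D` has no constant term. -/
def raySum {ι k : Type*} [CommRing k] (d : ℕ) (f : MvPolynomial ι k) (D : MvPowerSeries ι k) :
    MvPolynomial (Option ι) k :=
  ∑ i ∈ Finset.range (f.totalDegree + 1),
    MvPolynomial.X none ^ (i * d) * MvPolynomial.rename some (contract (D ^ i) f)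

/-! ### Smoothability -/

/-- A finite `k`-algebra `A` (`k` algebraically closed) is smoothable: there are an irreducible
base `Spec R` of finite type over `k` and a finite flat `R`-algebra `B` whose fibre over some closed
point is isomorphic to `A`, and whose fibres over all closed points of some nonempty open subset
`D(r)` are smooth over `k`. -/
def IsSmoothable.{u} (k : Type u) [Field k] (A : Type u) [CommRing A] [Algebra k A] : Prop :=
  ∃ (R : Type u) (_ : CommRing R) (_ : IsDomain R) (_ : Algebra k R) (_ : Algebra.FiniteType k R)
    (B : Type u) (_ : CommRing B) (_ : Algebra k B) (_ : Algebra R B) (_ : IsScalarTower k R B),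
    Module.Finite R B ∧ Module.Flat R B ∧
    (∃ p : Ideal R, p.IsMaximal ∧ Nonempty ((B ⧸ p.map (algebraMap R B)) ≃ₐ[k] A)) ∧
    ∃ r : R, r ≠ 0 ∧ ∀ q : Ideal R, q.IsMaximal → r ∉ q →
      Algebra.Smooth k (B ⧸ q.map (algebraMap R B))

/-! ### The tangent space to the Hilbert scheme -/

/-- `J` is a point of the Hilbert functor of affine space `𝔸 ^ ι` over the base `k ⊕ V`, where `V`
is an ideal of square zero, lying over the point `[I]`: the closed subscheme defined by `J` is flat
over `k ⊕ V` and its restriction to the closed point is the one defined by `I`. (If the latter is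
finite of length `d`, the former is then automatically finite and free of rank `d`.) -/
def IsFirstOrderFamily {ι k : Type*} [Field k] (I : Ideal (MvPolynomial ι k))
    (V : Type*) [AddCommGroup V] [Module k V] [Module kᵐᵒᵖ V] [IsCentralScalar k V]
    (J : Ideal (MvPolynomial ι (TrivSqZeroExt k V))) : Prop :=
  Module.Flat (TrivSqZeroExt k V) (MvPolynomial ι (TrivSqZeroExt k V) ⧸ J) ∧
    J.map (MvPolynomial.map (TrivSqZeroExt.fstHom k k V).toRingHom) = I

/-- The tangent space at `[I]`: the points of the Hilbert functor over the dual numbers that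
restrict to `[I]`. -/
abbrev HilbTangent {ι k : Type*} [Field k] (I : Ideal (MvPolynomial ι k)) : Type _ :=
  {J : Ideal (MvPolynomial ι (TrivSqZeroExt k k)) // IsFirstOrderFamily I k J}

/-- Base change of a family along `k ⊕ V → k ⊕ W` induced by a linear map `V → W`. -/
def pushFamily {ι k : Type*} [Field k] {V W : Type*}
    [AddCommGroup V] [Module k V] [Module kᵐᵒᵖ V] [IsCentralScalar k V]
    [AddCommGroup W] [Module k W] [Module kᵐᵒᵖ W] [IsCentralScalar k W]
    (l : V →ₗ[k] W) (J : Ideal (MvPolynomial ι (TrivSqZeroExt k V))) :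
    Ideal (MvPolynomial ι (TrivSqZeroExt k W)) :=
  J.map (MvPolynomial.map (TrivSqZeroExt.map l).toRingHom)

/-- The tangent space at `[I]` has dimension `r`: it is in bijection with `k ^ r`, linearly for its
usual vector space structure. In that structure, the linear combination `a J₁ + b J₂` of two
tangent vectors is computed by gluing them to a family `J` over `k ⊕ k²`, which restricts to `J₁`
and `J₂` along the two projections, and by base change of `J` along
`k² → k`, `(v, w) ↦ a v + b w`. -/
def HasTangentDim {ι k : Type*} [Field k] (I : Ideal (MvPolynomial ι k)) (r : ℕ) : Prop :=
  ∃ e : HilbTangent I ≃ (Fin r → k),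
    ∀ (a b : k) (J : Ideal (MvPolynomial ι (TrivSqZeroExt k (k × k)))),
      IsFirstOrderFamily I (k × k) J →
      ∀ J₁ J₂ J₃ : HilbTangent I,
        pushFamily (LinearMap.fst k k k) J = J₁.1 →
        pushFamily (LinearMap.snd k k k) J = J₂.1 →
        pushFamily (a • LinearMap.fst k k k + b • LinearMap.snd k k k) J = J₃.1 →
        e J₃ = a • e J₁ + b • e J₂

/-- The finite algebra `A`, embedded in affine space `𝔸 ^ ι` by the surjection `φ`, is
unobstructed: it is smoothable and the tangent space to the Hilbert scheme at `[Spec A]` has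
dimension `n * length A`, where `n` is the dimension of the ambient space. (Affine space is open in
projective space, so the tangent space is that of the Hilbert scheme of projective space.) -/
def IsUnobstructed.{u} {ι : Type} [Fintype ι] {k : Type u} [Field k] {A : Type u} [CommRing A]
    [Algebra k A] (φ : MvPolynomial ι k →ₐ[k] A) : Prop :=
  Function.Surjective φ ∧ Module.Finite k A ∧ IsSmoothable k A ∧
    HasTangentDim (RingHom.ker φ) (Fintype.card ι * Module.finrank k A)

end

/-!
The coordinate ring of `Spec (Apolar h)` is written as `P / J`, where `P` is a polynomial ring and
`J = polyAnn h` is the ideal of polynomials annihilating `h`; power series only matter through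
their truncations (`contract_truncTotal`). If `D ^ 2 ⌟ f = 0`, the annihilator of the ray sum
`f + y ^ d (D ⌟ f)` is the *ray ideal* generated by `I = Ann f`, by `K X` with
`K = Ann (D ⌟ f)`, and by `X ^ d - D` (`map_polyAnn_raySum`). Hence `J` is a ray ideal over a ray
ideal (`map_polyAnn_raySum_raySum`). Two facts about `P / J` have to be shown.

*The tangent space has dimension `(n + 2) dim (P / J)`.* It is `Hom (J, P / J)`
(`hilbTangentEquiv`). Since `P / J` is Gorenstein, this is dual to `J / J ^ 2`, so that its
dimension is `dim (P / J ^ 2) - dim (P / J)` (`hasTangentDim_polyAnn`). Membership in the square of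
a ray ideal is read off from the expansion to the base `X ^ d - D` (`mem_rayIdeal_mul_self_iff`),
which expresses the length of `P / J ^ 2` through lengths of quotients by products of `I` and `K`.
As the annihilators `I` and `K` of complete intersections have free conormal modules
(`IsCompleteIntersection.isFreeConormal`), those lengths are known, and
`dim (P / J ^ 2) = (n + 3) dim (P / J)` (`finrank_quotient_polyAnn_mul_self`).

*`P / J` is smoothable.* A finite algebra is called a limit of split algebras if its structure
constants satisfy every polynomial relation which holds for the structure constants of all
algebras `k ^ κ` in all bases (`IsLimitOfSplit`). Such an algebra is the special fibre of a flat
family over an integral base with smooth generic fibre: the base is generated by the structure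
constants of a split algebra in a generic basis (`IsLimitOfSplit.isSmoothable`). So it suffices
that `P / J` is a limit.

* Complete intersections are limits (`isLimitOfSplit_quotient_of_le_span_sup`). Adding large powers
  of the variables to the equations does not change the local factor at the origin, and gives
  equations with prescribed leading forms, whose quotient has the monomials of a box as a basis for
  all values of the lower coefficients. It deforms to the functions on a grid, so the discriminant
  of the deformation is not zero and its general member is split. The local factor itself is a
  limit because the idempotent cutting it out lifts along a deformation over power series.
* Quotients by ray ideals are limits if those by `I` and `K` are
  (`IsLimitOfSplit.quotient_rayIdeal`). With distinct nonzero `c_j`, replace `X ^ d - D` by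
  `X ∏ (X - t c_j) - D`, the product having `d - 1` factors. The dimension does not change, and for
  `t ≠ 0` the quotient becomes a product of one copy of the quotient by `I` and `d - 1` copies of
  the quotient by `K`.
-/


noncomputable section

open Polynomial

/-! ### Ray ideals in a polynomial ring -/

section RayIdeal

variable {S : Type*} [CommRing S]

/-- The ideal `I + X K + (q)` of `S[X]`. For `q = X ^ d - D` with `I = Ann f` and
`K = Ann (D ⌟ f)` it is the annihilator of the `d`-th ray sum of `f` with respect to `D`. -/
def rayIdeal (I K : Ideal S) (q : S[X]) : Ideal S[X] :=
  I.map C ⊔ Ideal.span {X} * K.map C ⊔ Ideal.span {q}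

theorem C_mem_rayIdeal {I K : Ideal S} {q : S[X]} {a : S} (ha : a ∈ I) :
    C a ∈ rayIdeal I K q :=
  Ideal.mem_sup_left (Ideal.mem_sup_left (Ideal.mem_map_of_mem C ha))

theorem X_mul_C_mem_rayIdeal {I K : Ideal S} {q : S[X]} {a : S} (ha : a ∈ K) :
    X * C a ∈ rayIdeal I K q :=
  Ideal.mem_sup_left (Ideal.mem_sup_right
    (Ideal.mul_mem_mul (Ideal.mem_span_singleton_self X) (Ideal.mem_map_of_mem C ha)))

theorem self_mem_rayIdeal {I K : Ideal S} {q : S[X]} : q ∈ rayIdeal I K q :=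
  Ideal.mem_sup_right (Ideal.mem_span_singleton_self q)

theorem rayIdeal_le {I K : Ideal S} {q : S[X]} {J : Ideal S[X]} (hI : ∀ a ∈ I, C a ∈ J)
    (hK : ∀ a ∈ K, X * C a ∈ J) (hq : q ∈ J) : rayIdeal I K q ≤ J := by
  refine sup_le (sup_le (Ideal.map_le_iff_le_comap.2 hI) ?_) ((Ideal.span_singleton_le_iff_mem _).2 hq)
  rw [Ideal.span_singleton_mul_le_iff]
  intro z hz
  have : K.map C ≤ Submodule.comap (LinearMap.mulLeft S[X] (X : S[X])) J :=
    Ideal.map_le_iff_le_comap.2 fun a ha => hK a ha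
  exact this hz

/-- A set of polynomials closed under addition and under multiplication by constants and by `X`
is closed under multiplication by all polynomials. -/
theorem Polynomial.mul_mem_of_C_mul_mem_of_X_mul_mem {s : Set S[X]}
    (hadd : ∀ p ∈ s, ∀ r ∈ s, p + r ∈ s) (hC : ∀ a, ∀ p ∈ s, C a * p ∈ s)
    (hX : ∀ p ∈ s, X * p ∈ s) (r : S[X]) : ∀ p ∈ s, r * p ∈ s := by
  induction r using Polynomial.induction_on' with
  | add p q hp hq => intro t ht; rw [add_mul]; exact hadd _ (hp t ht) _ (hq t ht)
  | monomial n a =>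
    intro t ht
    rw [← C_mul_X_pow_eq_monomial, mul_assoc]
    refine hC _ _ ?_
    induction n with
    | zero => simpa using ht
    | succ n ih => rw [pow_succ', mul_assoc]; exact hX _ ih

/-- Division of `X * p` by a monic polynomial in terms of division of `p`. -/
theorem Polynomial.X_mul_div_modByMonic {q : S[X]} (hq : q.Monic) (hd : 1 ≤ q.natDegree)
    (p : S[X]) :
    (X * p) /ₘ q = X * (p /ₘ q) + C ((p %ₘ q).coeff (q.natDegree - 1)) ∧
    (X * p) %ₘ q = X * (p %ₘ q) - C ((p %ₘ q).coeff (q.natDegree - 1)) * q := by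
  nontriviality S
  refine div_modByMonic_unique _ _ hq ⟨?_, ?_⟩
  · conv_rhs => rw [← modByMonic_add_div p q]
    ring
  · rw [degree_eq_natDegree hq.ne_zero, degree_lt_iff_coeff_zero]
    intro m hm
    obtain ⟨m, rfl⟩ : ∃ m', m = m' + 1 := ⟨m - 1, by omega⟩
    rw [coeff_sub, coeff_X_mul, coeff_C_mul]
    rcases hm.eq_or_lt with h | h
    · have h1 : q.natDegree - 1 = m := by omega
      have h2 : q.coeff (m + 1) = 1 := by rw [← h]; exact hq
      rw [h1, h2, mul_one, sub_self]
    · have h1 : (p %ₘ q).coeff m = 0 := by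
        apply coeff_eq_zero_of_degree_lt
        refine (degree_modByMonic_lt p hq).trans_le ?_
        rw [degree_eq_natDegree hq.ne_zero]
        exact_mod_cast (by omega : q.natDegree ≤ m)
      rw [h1, coeff_eq_zero_of_natDegree_lt h, mul_zero, sub_zero]

theorem Polynomial.coeff_X_mul_modByMonic_zero {q : S[X]} (hq : q.Monic) (hd : 1 ≤ q.natDegree)
    (p : S[X]) :
    ((X * p) %ₘ q).coeff 0 = -((p %ₘ q).coeff (q.natDegree - 1) * q.coeff 0) := by
  rw [(X_mul_div_modByMonic hq hd p).2]
  simp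

theorem Polynomial.coeff_X_mul_modByMonic_succ {q : S[X]} (hq : q.Monic) (hd : 1 ≤ q.natDegree)
    (p : S[X]) (j : ℕ) :
    ((X * p) %ₘ q).coeff (j + 1) =
      (p %ₘ q).coeff j - (p %ₘ q).coeff (q.natDegree - 1) * q.coeff (j + 1) := by
  rw [(X_mul_div_modByMonic hq hd p).2]
  simp

theorem Polynomial.C_mul_modByMonic {q : S[X]} (a : S) (p : S[X]) :
    (C a * p) %ₘ q = C a * (p %ₘ q) := by
  rw [← smul_eq_C_mul, ← smul_eq_C_mul, smul_modByMonic]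

theorem Polynomial.C_mul_divByMonic {q : S[X]} (hq : q.Monic) (a : S) (p : S[X]) :
    (C a * p) /ₘ q = C a * (p /ₘ q) := by
  nontriviality S
  refine (div_modByMonic_unique _ (C a * (p %ₘ q)) hq ⟨?_, ?_⟩).1
  · conv_rhs => rw [← modByMonic_add_div p q]
    ring
  · rw [← smul_eq_C_mul]
    exact (degree_smul_le _ _).trans_lt (degree_modByMonic_lt p hq)

theorem Polynomial.C_modByMonic {q : S[X]} (hq : q.Monic) (hd : 1 ≤ q.natDegree) (a : S) :
    C a %ₘ q = C a := by
  nontriviality S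
  rw [modByMonic_eq_self_iff hq]
  refine degree_C_le.trans_lt ?_
  rw [degree_eq_natDegree hq.ne_zero]
  exact_mod_cast hd

/-- Membership in a ray ideal is read off from the remainder modulo `q`: the constant
coefficient has to be in `I`, the other ones in `K`. -/
theorem mem_rayIdeal_iff {I K : Ideal S} {q : S[X]} (hq : q.Monic) (hd : 1 ≤ q.natDegree)
    (hIK : I ≤ K) (hK : ∀ κ ∈ K, κ * q.coeff 0 ∈ I) {p : S[X]} :
    p ∈ rayIdeal I K q ↔ (p %ₘ q).coeff 0 ∈ I ∧ ∀ j, (p %ₘ q).coeff (j + 1) ∈ K := by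
  constructor
  · let s : Set S[X] := {p | (p %ₘ q).coeff 0 ∈ I ∧ ∀ j, (p %ₘ q).coeff (j + 1) ∈ K}
    have hsadd : ∀ p ∈ s, ∀ r ∈ s, p + r ∈ s := by
      rintro p ⟨hp0, hp⟩ r ⟨hr0, hr⟩
      refine ⟨?_, fun j => ?_⟩
      · rw [add_modByMonic, coeff_add]; exact add_mem hp0 hr0
      · rw [add_modByMonic, coeff_add]; exact add_mem (hp j) (hr j)
    have hsK : ∀ p ∈ s, ∀ j, (p %ₘ q).coeff j ∈ K := by
      rintro p ⟨h0, h⟩ (_ | j)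
      exacts [hIK h0, h j]
    have hsX : ∀ p ∈ s, X * p ∈ s := by
      intro p hp
      refine ⟨?_, fun j => ?_⟩
      · rw [coeff_X_mul_modByMonic_zero hq hd]
        exact neg_mem (hK _ (hsK p hp _))
      · rw [coeff_X_mul_modByMonic_succ hq hd]
        exact sub_mem (hsK p hp _) (Ideal.mul_mem_right _ _ (hsK p hp _))
    have hsC : ∀ a, ∀ p ∈ s, C a * p ∈ s := by
      rintro a p ⟨h0, h⟩
      refine ⟨?_, fun j => ?_⟩
      · rw [C_mul_modByMonic, coeff_C_mul]; exact Ideal.mul_mem_left _ _ h0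
      · rw [C_mul_modByMonic, coeff_C_mul]; exact Ideal.mul_mem_left _ _ (h j)
    let J : Ideal S[X] :=
      { carrier := s
        add_mem' := fun {a b} ha hb => hsadd a ha b hb
        zero_mem' := by simp [s]
        smul_mem' := fun r p hp => Polynomial.mul_mem_of_C_mul_mem_of_X_mul_mem hsadd hsC hsX r p hp }
    suffices h : rayIdeal I K q ≤ J from fun hp => h hp
    have hCs : ∀ a, (C a %ₘ q).coeff 0 = a ∧ ∀ j, (C a %ₘ q).coeff (j + 1) = 0 := by
      intro a
      rw [C_modByMonic hq hd]
      simp [coeff_C_succ]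
    refine rayIdeal_le (fun a ha => ?_) (fun a ha => ?_) ?_
    · refine ⟨by rwa [(hCs a).1], fun j => by rw [(hCs a).2]; exact K.zero_mem⟩
    · have hc : ∀ j, (C a %ₘ q).coeff j ∈ K := by
        rintro (_ | j)
        · rwa [(hCs a).1]
        · rw [(hCs a).2]; exact K.zero_mem
      refine ⟨?_, fun j => ?_⟩
      · rw [coeff_X_mul_modByMonic_zero hq hd]
        exact neg_mem (hK _ (hc _))
      · rw [coeff_X_mul_modByMonic_succ hq hd]
        exact sub_mem (hc _) (Ideal.mul_mem_right _ _ (hc _))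
    · have : q %ₘ q = 0 := by rw [modByMonic_eq_zero_iff_dvd hq]
      refine ⟨?_, fun j => ?_⟩ <;> rw [this] <;> simp
  · rintro ⟨h0, h⟩
    rw [← modByMonic_add_div p q]
    refine add_mem ?_ (Ideal.mul_mem_right _ _ self_mem_rayIdeal)
    rw [as_sum_range_C_mul_X_pow (p %ₘ q)]
    refine sum_mem fun j _ => ?_
    rcases j with _ | j
    · rw [pow_zero, mul_one]; exact C_mem_rayIdeal h0
    · rw [pow_succ', mul_left_comm, mul_comm (C _), ← mul_assoc, mul_comm X, mul_assoc]
      exact Ideal.mul_mem_left _ _ (X_mul_C_mem_rayIdeal (h j))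

/-- The polynomial `X ^ d - D`. -/
def rayPoly (d : ℕ) (D : S) : S[X] := X ^ d - C D

theorem rayPoly_monic {d : ℕ} (hd : 1 ≤ d) (D : S) : (rayPoly d D).Monic :=
  monic_X_pow_sub_C D (by omega)

theorem natDegree_rayPoly [Nontrivial S] (d : ℕ) (D : S) : (rayPoly d D).natDegree = d :=
  natDegree_X_pow_sub_C

theorem coeff_rayPoly_zero {d : ℕ} (hd : 1 ≤ d) (D : S) : (rayPoly d D).coeff 0 = -D := by
  rw [rayPoly, coeff_sub, coeff_X_pow, if_neg (by omega), coeff_C_zero, zero_sub]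

/-- The condition for membership in the square of the ray ideal of `X ^ d - D`, in terms of the
digits `x`, `y` of the expansion `p = x + y q + ⋯` to the base `q = X ^ d - D`. -/
def RaySq (I K : Ideal S) (D : S) (x y : S[X]) : Prop :=
  (∃ κ ∈ K * K, x.coeff 0 - κ * D ∈ I * I ∧ y.coeff 0 - κ ∈ I) ∧ x.coeff 1 ∈ I * K ∧
    (∀ j, x.coeff (j + 2) ∈ K * K) ∧ ∀ j, y.coeff (j + 1) ∈ K

theorem X_mul_raySq [Nontrivial S] {I K : Ideal S} {d : ℕ} (hd : 2 ≤ d) {D : S} (hIK : I ≤ K)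
    (hK : ∀ κ ∈ K, κ * D ∈ I) {p : S[X]}
    (h : RaySq I K D (p %ₘ rayPoly d D) ((p /ₘ rayPoly d D) %ₘ rayPoly d D)) :
    RaySq I K D ((X * p) %ₘ rayPoly d D) (((X * p) /ₘ rayPoly d D) %ₘ rayPoly d D) := by
  have hq := rayPoly_monic (by omega : 1 ≤ d) D
  have hdeg : 1 ≤ (rayPoly d D).natDegree := by rw [natDegree_rayPoly]; omega
  set q := rayPoly d D with hqdef
  set x := p %ₘ q
  have hx1 := coeff_X_mul_modByMonic_zero hq hdeg p
  have hx2 := coeff_X_mul_modByMonic_succ hq hdeg p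
  have hy1 := coeff_X_mul_modByMonic_zero hq hdeg (p /ₘ q)
  have hy2 := coeff_X_mul_modByMonic_succ hq hdeg (p /ₘ q)
  rw [(X_mul_div_modByMonic hq hdeg p).1, add_modByMonic, C_modByMonic hq hdeg]
  set y := (p /ₘ q) %ₘ q
  rw [hqdef, natDegree_rayPoly, ← hqdef, hqdef, coeff_rayPoly_zero (by omega), ← hqdef] at hx1 hy1
  rw [hqdef, natDegree_rayPoly, ← hqdef] at hx2 hy2 ⊢
  -- the inner coefficients of `q` vanish, its leading one is seen by the top coefficient only
  have hxd : ∀ j, d - 1 < j + 1 → x.coeff (j + 1) = 0 := fun j hj => by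
    apply coeff_eq_zero_of_degree_lt
    refine (degree_modByMonic_lt p hq).trans_le ?_
    rw [degree_eq_natDegree hq.ne_zero, hqdef, natDegree_rayPoly]
    exact_mod_cast (by omega : d ≤ j + 1)
  have hqj : ∀ j, j + 1 < d → q.coeff (j + 1) = 0 := fun j hj => by
    rw [hqdef, rayPoly, coeff_sub, coeff_X_pow, if_neg (by omega), coeff_C_succ, sub_zero]
  obtain ⟨⟨κ, hκ, h0, hy0⟩, h1, h2, hy⟩ := h
  have hII : I * I ≤ I * K := Ideal.mul_mono_right hIK
  have hIKK : I * K ≤ K * K := Ideal.mul_mono_left hIK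
  have hκK : κ ∈ K := Ideal.mul_le_left hκ
  have hDKK : ∀ t ∈ K * K, t * D ∈ I * K := fun t ht => by
    refine Submodule.mul_induction_on ht (fun a ha b hb => ?_) (fun a b ha hb => ?_)
    · have := Ideal.mul_mem_mul (hK a ha) hb
      rwa [show a * D * b = a * b * D by ring] at this
    · rw [add_mul]; exact add_mem ha hb
  have hx0IK : x.coeff 0 ∈ I * K := by
    have := add_mem (hII h0) (hDKK κ hκ)
    rwa [sub_add_cancel] at this
  have hy0K : y.coeff 0 ∈ K := by
    have := add_mem (hIK hy0) hκK
    rwa [sub_add_cancel] at this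
  have hyK : ∀ j, y.coeff j ∈ K := by rintro (_ | j); exacts [hy0K, hy j]
  have hxKK : ∀ j, x.coeff j ∈ K * K := by
    rintro (_ | _ | j); exacts [hIKK hx0IK, hIKK h1, h2 j]
  have htop : ∀ j, x.coeff j - x.coeff (d - 1) * q.coeff (j + 1) = x.coeff j ∨
      x.coeff j - x.coeff (d - 1) * q.coeff (j + 1) = 0 := by
    intro j
    rcases lt_trichotomy (j + 1) d with h | h | h
    · left; rw [hqj j h]; ring
    · right
      have : q.coeff (j + 1) = 1 := by
        have := hq.coeff_natDegree; rwa [hqdef, natDegree_rayPoly, ← hqdef, ← h] at this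
      rw [this, show d - 1 = j by omega]; ring
    · right
      have : q.coeff (j + 1) = 0 := by
        apply coeff_eq_zero_of_natDegree_lt; rw [hqdef, natDegree_rayPoly]; exact h
      obtain ⟨i, rfl⟩ : ∃ i, j = i + 1 := ⟨j - 1, by omega⟩
      rw [this, hxd i (by omega)]; ring
  refine ⟨⟨x.coeff (d - 1), hxKK _, ?_, ?_⟩, ?_, fun j => ?_, fun j => ?_⟩
  · rw [hx1]
    convert (I * I).zero_mem using 1
    ring
  · rw [coeff_add, hy1, coeff_C_zero]
    convert hK _ (hyK (d - 1)) using 1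
    ring
  · rw [hx2]
    rcases htop 0 with h | h <;> rw [h]
    exacts [hx0IK, (I * K).zero_mem]
  · rw [hx2]
    rcases htop (j + 1) with h | h <;> rw [h]
    exacts [hxKK _, (K * K).zero_mem]
  · rw [coeff_add, hy2, coeff_C_succ, add_zero]
    exact sub_mem (hyK _) (Ideal.mul_mem_right _ _ (hyK _))

end RayIdeal

end

noncomputable section

open Polynomial

section RayIdealSq

variable {S : Type*} [CommRing S]

theorem rayIdeal_mul_self_le {I K : Ideal S} {q : S[X]} {N : Ideal S[X]}
    (hII : ∀ a ∈ I, ∀ b ∈ I, C a * C b ∈ N) (hIK : ∀ a ∈ I, ∀ b ∈ K, C a * (X * C b) ∈ N)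
    (hKK : ∀ a ∈ K, ∀ b ∈ K, X * C a * (X * C b) ∈ N) (hqI : ∀ a ∈ I, q * C a ∈ N)
    (hqK : ∀ a ∈ K, q * (X * C a) ∈ N) (hqq : q * q ∈ N) :
    rayIdeal I K q * rayIdeal I K q ≤ N := by
  have key : ∀ s : S[X], (∀ a ∈ I, C a * s ∈ N) → (∀ a ∈ K, X * C a * s ∈ N) → q * s ∈ N →
      ∀ r ∈ rayIdeal I K q, r * s ∈ N := by
    intro s h1 h2 h3
    have : rayIdeal I K q ≤ Submodule.comap (LinearMap.mulRight S[X] s) N :=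
      rayIdeal_le h1 h2 h3
    exact fun r hr => this hr
  refine Ideal.mul_le.2 fun r hr s hs => ?_
  rw [mul_comm]
  refine key r (fun a ha => ?_) (fun a ha => ?_) ?_ s hs
  · rw [mul_comm]
    refine key _ (fun b hb => hII b hb a ha) (fun b hb => ?_) (hqI a ha) r hr
    rw [mul_comm]; exact hIK a ha b hb
  · rw [mul_comm]
    exact key _ (fun b hb => hIK b hb a ha) (fun b hb => hKK b hb a ha) (hqK a ha) r hr
  · rw [mul_comm]
    refine key _ (fun b hb => ?_) (fun b hb => ?_) hqq r hr
    · rw [mul_comm]; exact hqI b hb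
    · rw [mul_comm]; exact hqK b hb

/-- The square of the ray ideal of `X ^ d - D`, described by the first two digits to the base
`X ^ d - D`. -/
theorem mem_rayIdeal_mul_self_iff [Nontrivial S] {I K : Ideal S} {d : ℕ} (hd : 2 ≤ d) {D : S}
    (hIK : I ≤ K) (hK : ∀ κ ∈ K, κ * D ∈ I) {p : S[X]} :
    p ∈ rayIdeal I K (rayPoly d D) * rayIdeal I K (rayPoly d D) ↔
      RaySq I K D (p %ₘ rayPoly d D) ((p /ₘ rayPoly d D) %ₘ rayPoly d D) := by
  have hq := rayPoly_monic (by omega : 1 ≤ d) D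
  have hdeg : 1 ≤ (rayPoly d D).natDegree := by rw [natDegree_rayPoly]; omega
  have hX : ∀ a b : S, (X * C a + C b) %ₘ rayPoly d D = X * C a + C b ∧
      (X * C a + C b) /ₘ rayPoly d D = 0 := by
    intro a b
    have : (X * C a + C b).degree < (rayPoly d D).degree := by
      rw [degree_eq_natDegree hq.ne_zero, natDegree_rayPoly]
      refine lt_of_le_of_lt (b := 1) ?_ (by exact_mod_cast hd)
      rw [mul_comm]; exact degree_linear_le
    exact ⟨(modByMonic_eq_self_iff hq).2 this, (divByMonic_eq_zero_iff hq).2 this⟩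
  constructor
  · set q := rayPoly d D with hqdef
    let s : Set S[X] := {p | RaySq I K D (p %ₘ q) ((p /ₘ q) %ₘ q)}
    have hadd : ∀ p ∈ s, ∀ r ∈ s, p + r ∈ s := by
      rintro p ⟨⟨κ, hκ, h0, hy0⟩, h1, h2, hy⟩ r ⟨⟨κ', hκ', h0', hy0'⟩, h1', h2', hy'⟩
      have hdiv : (p + r) /ₘ q = p /ₘ q + r /ₘ q :=
        (div_modByMonic_unique _ (p %ₘ q + r %ₘ q) hq ⟨by
          conv_rhs => rw [← modByMonic_add_div p q, ← modByMonic_add_div r q]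
          ring, by
          refine (degree_add_le _ _).trans_lt (max_lt ?_ ?_)
          exacts [degree_modByMonic_lt p hq, degree_modByMonic_lt r hq]⟩).1
      simp only [s, Set.mem_ofPred_eq, hdiv, add_modByMonic]
      refine ⟨⟨κ + κ', add_mem hκ hκ', ?_, ?_⟩, ?_, fun j => ?_, fun j => ?_⟩
      · convert add_mem h0 h0' using 1; rw [coeff_add]; ring
      · convert add_mem hy0 hy0' using 1; rw [coeff_add]; ring
      · rw [coeff_add]; exact add_mem h1 h1'
      · rw [coeff_add]; exact add_mem (h2 j) (h2' j)
      · rw [coeff_add]; exact add_mem (hy j) (hy' j)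
    let N : Ideal S[X] :=
      { carrier := s
        add_mem' := fun {p r} hp hr => hadd p hp r hr
        zero_mem' := by
          simp only [s, Set.mem_ofPred_eq, zero_modByMonic, zero_divByMonic]
          exact ⟨⟨0, zero_mem _, by simp, by simp⟩, by simp, by simp, by simp⟩
        smul_mem' := by
          refine fun r p hp => Polynomial.mul_mem_of_C_mul_mem_of_X_mul_mem
            (s := s) ?_ ?_ ?_ r p hp
          · exact hadd
          · rintro a p ⟨⟨κ, hκ, h0, hy0⟩, h1, h2, hy⟩
            simp only [s, Set.mem_ofPred_eq, C_mul_modByMonic, C_mul_divByMonic hq]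
            refine ⟨⟨a * κ, Ideal.mul_mem_left _ _ hκ, ?_, ?_⟩, ?_, fun j => ?_, fun j => ?_⟩
            · convert Ideal.mul_mem_left _ a h0 using 1; rw [coeff_C_mul]; ring
            · convert Ideal.mul_mem_left _ a hy0 using 1; rw [coeff_C_mul]; ring
            · rw [coeff_C_mul]; exact Ideal.mul_mem_left _ _ h1
            · rw [coeff_C_mul]; exact Ideal.mul_mem_left _ _ (h2 j)
            · rw [coeff_C_mul]; exact Ideal.mul_mem_left _ _ (hy j)
          · exact fun p hp => X_mul_raySq hd hIK hK hp }
    suffices h : rayIdeal I K q * rayIdeal I K q ≤ N from fun hp => h hp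
    have hN : ∀ p, p ∈ N ↔ RaySq I K D (p %ₘ q) ((p /ₘ q) %ₘ q) := fun p => Iff.rfl
    have hqN : ∀ p, q * p ∈ N ↔ RaySq I K D 0 (p %ₘ q) := fun p => by
      rw [hN, mul_divByMonic_cancel_left p hq, (modByMonic_eq_zero_iff_dvd hq).2 (dvd_mul_right q p)]
    refine rayIdeal_mul_self_le (fun a ha b hb => ?_) (fun a ha b hb => ?_) (fun a ha b hb => ?_)
      (fun a ha => ?_) (fun a ha => ?_) ?_
    · have h := hX 0 (a * b)
      rw [map_zero, mul_zero, zero_add] at h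
      rw [← C_mul, hN, h.1, h.2, zero_modByMonic]
      refine ⟨⟨0, zero_mem _, ?_, by simp⟩, ?_, fun j => ?_, by simp⟩
      · simpa using Ideal.mul_mem_mul ha hb
      · rw [coeff_C_succ]; exact zero_mem _
      · rw [coeff_C_succ]; exact zero_mem _
    · have h := hX (a * b) 0
      rw [map_zero, add_zero] at h
      rw [mul_left_comm, ← C_mul, hN, h.1, h.2, zero_modByMonic]
      refine ⟨⟨0, zero_mem _, by simp, by simp⟩, ?_, fun j => ?_, by simp⟩
      · rw [coeff_X_mul, coeff_C_zero]; exact Ideal.mul_mem_mul ha hb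
      · rw [coeff_X_mul, coeff_C_succ]; exact zero_mem _
    · have h := hX (a * b) 0
      rw [map_zero, add_zero] at h
      have hab := Ideal.mul_mem_mul ha hb
      have hc : ∀ j, (X * C (a * b) : S[X]).coeff j ∈ K * K := by
        rintro (_ | _ | j)
        · simp
        · rw [coeff_X_mul, coeff_C_zero]; exact hab
        · rw [coeff_X_mul, coeff_C_succ]; exact zero_mem _
      rw [show X * C a * (X * C b) = X * (X * C (a * b)) by rw [C_mul]; ring, hN]
      have hx1 := coeff_X_mul_modByMonic_zero hq hdeg (X * C (a * b))
      have hx2 := coeff_X_mul_modByMonic_succ hq hdeg (X * C (a * b))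
      rw [(X_mul_div_modByMonic hq hdeg _).1, h.2, mul_zero, zero_add, C_modByMonic hq hdeg]
      rw [h.1] at hx1 hx2 ⊢
      refine ⟨⟨(X * C (a * b)).coeff (q.natDegree - 1), hc _, ?_, ?_⟩, ?_, fun j => ?_, fun j => ?_⟩
      · rw [hx1, hqdef, coeff_rayPoly_zero (by omega)]
        convert (I * I).zero_mem using 1
        ring
      · rw [coeff_C_zero, sub_self]; exact zero_mem _
      · rw [hx2, hqdef, rayPoly, coeff_sub, coeff_X_pow, if_neg (by omega), coeff_C_succ]
        simp
      · rw [hx2]; exact sub_mem (hc _) (Ideal.mul_mem_right _ _ (hc _))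
      · rw [coeff_C_succ]; exact zero_mem _
    · rw [hqN, C_modByMonic hq hdeg]
      refine ⟨⟨0, zero_mem _, by simp, by simpa⟩, by simp, by simp, fun j => ?_⟩
      rw [coeff_C_succ]; exact zero_mem _
    · have h := hX a 0
      rw [map_zero, add_zero] at h
      rw [hqN, h.1]
      refine ⟨⟨0, zero_mem _, by simp, by simp⟩, by simp, by simp, fun j => ?_⟩
      rw [coeff_X_mul]
      rcases j with _ | j
      · rwa [coeff_C_zero]
      · rw [coeff_C_succ]; exact zero_mem _
    · rw [hqN, (modByMonic_eq_zero_iff_dvd hq).2 dvd_rfl]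
      exact ⟨⟨0, zero_mem _, by simp, by simp⟩, by simp, by simp, by simp⟩
  · set q := rayPoly d D with hqdef
    set J := rayIdeal I K q with hJ
    set x := p %ₘ q with hx
    set y := (p /ₘ q) %ₘ q with hy
    rintro ⟨⟨κ, hκ, h0, hy0⟩, h1, h2, hy'⟩
    have hqJ : q ∈ J := self_mem_rayIdeal
    have hIJ : I.map C ≤ J := Ideal.map_le_iff_le_comap.2 fun a ha => C_mem_rayIdeal ha
    have hKJ : K.map C ≤ Submodule.comap (LinearMap.mulLeft S[X] (X : S[X])) J :=
      Ideal.map_le_iff_le_comap.2 fun a ha => X_mul_C_mem_rayIdeal ha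
    have hII : ∀ a ∈ I * I, C a ∈ J * J := fun a ha => by
      have := Ideal.mem_map_of_mem C ha
      rw [Ideal.map_mul] at this
      exact Ideal.mul_mono hIJ hIJ this
    have hIKJ : ∀ a ∈ I * K, C a * X ∈ J * J := fun a ha => by
      have := Ideal.mem_map_of_mem C ha
      rw [Ideal.map_mul] at this
      refine Submodule.mul_induction_on this (fun u hu v hv => ?_) fun u v hu hv => ?_
      · rw [mul_assoc, mul_comm v]; exact Ideal.mul_mem_mul (hIJ hu) (hKJ hv)
      · rw [add_mul]; exact add_mem hu hv
    have hKKJ : ∀ a ∈ K * K, C a * X ^ 2 ∈ J * J := fun a ha => by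
      have := Ideal.mem_map_of_mem C ha
      rw [Ideal.map_mul] at this
      refine Submodule.mul_induction_on this (fun u hu v hv => ?_) fun u v hu hv => ?_
      · rw [show u * v * X ^ 2 = (X * u) * (X * v) by ring]
        exact Ideal.mul_mem_mul (hKJ hu) (hKJ hv)
      · rw [add_mul]; exact add_mem hu hv
    have hxr : x = C (x.coeff 0 - κ * D) + C (κ * D) +
        (C (x.coeff 1) * X + (x.divX.divX) * X ^ 2) := by
      have e1 := divX_mul_X_add x
      have e2 := divX_mul_X_add x.divX
      rw [coeff_divX] at e2
      conv_lhs => rw [← e1, ← e2]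
      rw [C_sub]; ring
    have hyr : y = y.divX * X + (C (y.coeff 0 - κ) + C κ) := by
      conv_lhs => rw [← divX_mul_X_add y]
      rw [C_sub]; ring
    have hp : p = q * q * ((p /ₘ q) /ₘ q) + q * y + x := by
      conv_lhs => rw [← modByMonic_add_div p q, ← modByMonic_add_div (p /ₘ q) q]
      ring
    have e : q * C κ + C (κ * D) = C κ * X ^ 2 * X ^ (d - 2) := by
      rw [mul_assoc, ← pow_add, show 2 + (d - 2) = d by omega, hqdef, rayPoly, C_mul]; ring
    rw [hp]
    have t1 : q * q * ((p /ₘ q) /ₘ q) ∈ J * J := Ideal.mul_mem_right _ _ (Ideal.mul_mem_mul hqJ hqJ)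
    have t2 : q * (y.divX * X) ∈ J * J := by
      refine Ideal.mul_mem_mul hqJ ?_
      rw [as_sum_range_C_mul_X_pow y.divX, Finset.sum_mul]
      refine sum_mem fun j _ => ?_
      rw [show C (y.divX.coeff j) * X ^ j * X = X ^ j * (X * C (y.divX.coeff j)) by ring, coeff_divX]
      exact Ideal.mul_mem_left _ _ (X_mul_C_mem_rayIdeal (hy' j))
    have t3 : q * C (y.coeff 0 - κ) ∈ J * J := Ideal.mul_mem_mul hqJ (C_mem_rayIdeal hy0)
    have t4 : x.divX.divX * X ^ 2 ∈ J * J := by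
      rw [as_sum_range_C_mul_X_pow x.divX.divX, Finset.sum_mul]
      refine sum_mem fun j _ => ?_
      rw [mul_right_comm, coeff_divX, coeff_divX]
      exact Ideal.mul_mem_right _ _ (hKKJ _ (h2 j))
    have t5 := Ideal.mul_mem_right (X ^ (d - 2)) _ (hKKJ κ hκ)
    rw [← e] at t5
    have := add_mem (add_mem (add_mem (add_mem (add_mem (add_mem t1 t2) t3) t4) t5) (hII _ h0))
      (hIKJ _ h1)
    convert this using 1
    conv_lhs => rw [hxr, hyr]
    ring

end RayIdealSq

end

noncomputable section

open Polynomial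

section RayLength

variable {k S : Type*} [Field k] [CommRing S] [Algebra k S]

/-- The quotient map `S → S ⧸ I` as a linear map over `k`. -/
def mkLin (k : Type*) {S : Type*} [Field k] [CommRing S] [Algebra k S] (I : Ideal S) :
    S →ₗ[k] S ⧸ I :=
  (Ideal.Quotient.mkₐ k I).toLinearMap

theorem mkLin_eq_zero {I : Ideal S} {a : S} : mkLin k I a = 0 ↔ a ∈ I :=
  Ideal.Quotient.eq_zero_iff_mem

theorem exists_mkLin (I : Ideal S) (x : S ⧸ I) : ∃ a, mkLin k I a = x :=
  Ideal.Quotient.mk_surjective x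

/-- The linear isomorphism `T ⧸ J ≃ M` induced by a surjective linear map `T → M` with
kernel `J`. -/
def quotientLinearEquivOfSurjective {M : Type*} [AddCommGroup M] [Module k M] (J : Ideal S)
    (φ : S →ₗ[k] M) (hφ : Function.Surjective φ) (hJ : ∀ p, φ p = 0 ↔ p ∈ J) : (S ⧸ J) ≃ₗ[k] M :=
  ((mkLin k J).quotKerEquivOfSurjective Ideal.Quotient.mk_surjective).symm.trans
    ((Submodule.quotEquivOfEq _ _ (by
      ext p; rw [LinearMap.mem_ker, LinearMap.mem_ker, mkLin_eq_zero, hJ])).trans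
      (φ.quotKerEquivOfSurjective hφ))

theorem quotientLinearEquivOfSurjective_mk {M : Type*} [AddCommGroup M] [Module k M] (J : Ideal S)
    (φ : S →ₗ[k] M) (hφ : Function.Surjective φ) (hJ : ∀ p, φ p = 0 ↔ p ∈ J) (p : S) :
    quotientLinearEquivOfSurjective J φ hφ hJ (Ideal.Quotient.mk J p) = φ p := by
  have : ((mkLin k J).quotKerEquivOfSurjective Ideal.Quotient.mk_surjective).symm
      (Ideal.Quotient.mk J p) = Submodule.Quotient.mk p := by
    rw [LinearEquiv.symm_apply_eq]; rfl
  rw [quotientLinearEquivOfSurjective, LinearEquiv.trans_apply, this]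
  rfl

theorem finrank_range_eq_of_ker_eq {V W W' : Type*} [AddCommGroup V] [Module k V]
    [AddCommGroup W] [Module k W] [AddCommGroup W'] [Module k W'] (f : V →ₗ[k] W) (g : V →ₗ[k] W')
    (h : LinearMap.ker f = LinearMap.ker g) :
    Module.finrank k (LinearMap.range f) = Module.finrank k (LinearMap.range g) :=
  ((LinearMap.quotKerEquivRange f).symm.trans
    ((Submodule.quotEquivOfEq _ _ h).trans (LinearMap.quotKerEquivRange g))).finrank_eq

theorem Polynomial.add_divByMonic {q : S[X]} (hq : q.Monic) (p r : S[X]) :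
    (p + r) /ₘ q = p /ₘ q + r /ₘ q := by
  nontriviality S
  refine (div_modByMonic_unique _ (p %ₘ q + r %ₘ q) hq ⟨?_, ?_⟩).1
  · conv_rhs => rw [← modByMonic_add_div p q, ← modByMonic_add_div r q]
    ring
  · refine (degree_add_le _ _).trans_lt (max_lt ?_ ?_)
    exacts [degree_modByMonic_lt p hq, degree_modByMonic_lt r hq]

/-- The `j`-th coefficient of the remainder modulo `q`, as a linear map. -/
def modCoeff (k : Type*) {S : Type*} [Field k] [CommRing S] [Algebra k S] (q : S[X]) (j : ℕ) :
    S[X] →ₗ[k] S :=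
  ((lcoeff S j).comp (modByMonicHom q)).restrictScalars k

/-- Division by a monic polynomial `q`, as a linear map. -/
def divHom (k : Type*) {S : Type*} [Field k] [CommRing S] [Algebra k S] {q : S[X]}
    (hq : q.Monic) : S[X] →ₗ[k] S[X] where
  toFun p := p /ₘ q
  map_add' := Polynomial.add_divByMonic hq
  map_smul' a p := by
    rw [RingHom.id_apply, ← algebraMap_smul S a p, ← algebraMap_smul S a (p /ₘ q), smul_eq_C_mul,
      smul_eq_C_mul, C_mul_divByMonic hq]

/-- The coordinates of a polynomial modulo a ray ideal. -/
def rayCoord (k : Type*) {S : Type*} [Field k] [CommRing S] [Algebra k S] (I K : Ideal S)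
    (q : S[X]) (d : ℕ) : S[X] →ₗ[k] (S ⧸ I) × (Fin (d - 1) → S ⧸ K) :=
  LinearMap.prod (mkLin k I ∘ₗ modCoeff k q 0)
    (LinearMap.pi fun j => mkLin k K ∘ₗ modCoeff k q (j + 1))

theorem rayCoord_apply (I K : Ideal S) (q : S[X]) (d : ℕ) (p : S[X]) :
    rayCoord k I K q d p = (Ideal.Quotient.mk I ((p %ₘ q).coeff 0),
      fun j : Fin (d - 1) => Ideal.Quotient.mk K ((p %ₘ q).coeff (j + 1))) := rfl

/-- The polynomial with given coefficients in degrees less than `d`. -/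
def polyOfCoeff (d : ℕ) (c : ℕ → S) : S[X] := ∑ j ∈ Finset.range d, C (c j) * X ^ j

theorem coeff_polyOfCoeff {d : ℕ} (c : ℕ → S) {j : ℕ} (hj : j < d) :
    (polyOfCoeff d c).coeff j = c j := by
  simp [polyOfCoeff, coeff_C_mul, coeff_X_pow, hj]

theorem polyOfCoeff_modByMonic {q : S[X]} (hq : q.Monic) (c : ℕ → S) :
    polyOfCoeff q.natDegree c %ₘ q = polyOfCoeff q.natDegree c ∧
      polyOfCoeff q.natDegree c /ₘ q = 0 := by
  nontriviality S
  have : (polyOfCoeff q.natDegree c).degree < q.degree := by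
    rw [degree_eq_natDegree hq.ne_zero, degree_lt_iff_coeff_zero]
    intro m hm
    simp [polyOfCoeff, coeff_C_mul, coeff_X_pow]
    omega
  exact ⟨(modByMonic_eq_self_iff hq).2 this, (divByMonic_eq_zero_iff hq).2 this⟩

/-- There is a polynomial with given coordinates, independent of the modulus. -/
theorem exists_forall_rayCoord_eq (I K : Ideal S) {d : ℕ} (hd : 1 ≤ d)
    (x : (S ⧸ I) × (Fin (d - 1) → S ⧸ K)) :
    ∃ p : S[X], ∀ q : S[X], q.Monic → q.natDegree = d → rayCoord k I K q d p = x := by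
  obtain ⟨a, b⟩ := x
  obtain ⟨a, rfl⟩ := Ideal.Quotient.mk_surjective a
  choose b' hb' using fun j => Ideal.Quotient.mk_surjective (b j)
  let c : ℕ → S := fun j => if j = 0 then a else if h : j - 1 < d - 1 then b' ⟨j - 1, h⟩ else 0
  refine ⟨polyOfCoeff d c, fun q hq hqd => ?_⟩
  subst hqd
  rw [rayCoord_apply, (polyOfCoeff_modByMonic hq c).1, coeff_polyOfCoeff _ (by omega)]
  refine Prod.ext rfl (funext fun j => ?_)
  simp only
  rw [coeff_polyOfCoeff _ (by omega), ← hb']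
  simp [c]

theorem rayCoord_surjective {I K : Ideal S} {q : S[X]} (hq : q.Monic) {d : ℕ}
    (hqd : q.natDegree = d) (hd : 1 ≤ d) : Function.Surjective (rayCoord k I K q d) := fun x =>
  (exists_forall_rayCoord_eq I K hd x).imp fun _ h => h q hq hqd

/-- As a vector space, the quotient by the ray ideal of a polynomial of degree `d` is
`S ⧸ I ⊕ (S ⧸ K) ^ (d - 1)`. -/
def rayQuotEquiv (k : Type*) {S : Type*} [Field k] [CommRing S] [Algebra k S] {I K : Ideal S}
    {q : S[X]} (hq : q.Monic) {d : ℕ} (hqd : q.natDegree = d) (hd : 1 ≤ d) (hIK : I ≤ K)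
    (hK : ∀ κ ∈ K, κ * q.coeff 0 ∈ I) :
    (S[X] ⧸ rayIdeal I K q) ≃ₗ[k] (S ⧸ I) × (Fin (d - 1) → S ⧸ K) :=
  quotientLinearEquivOfSurjective _ (rayCoord k I K q d) (rayCoord_surjective hq hqd hd)
    fun p => by
      rw [mem_rayIdeal_iff hq (hqd ▸ hd) hIK hK, rayCoord_apply, Prod.mk_eq_zero,
        Ideal.Quotient.eq_zero_iff_mem, funext_iff]
      simp only [Pi.zero_apply, Ideal.Quotient.eq_zero_iff_mem]
      refine and_congr_right fun _ => ⟨fun h j => ?_, fun h j => h j⟩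
      by_cases hj : j < d - 1
      · exact h ⟨j, hj⟩
      · rw [coeff_eq_zero_of_degree_lt]
        · exact K.zero_mem
        · nontriviality S
          refine (degree_modByMonic_lt p hq).trans_le ?_
          rw [degree_eq_natDegree hq.ne_zero, hqd]
          exact_mod_cast (by omega : d ≤ j + 1)

theorem finrank_quotient_rayIdeal {I K : Ideal S} [Module.Finite k (S ⧸ I)]
    [Module.Finite k (S ⧸ K)] {q : S[X]} (hq : q.Monic) {d : ℕ} (hqd : q.natDegree = d)
    (hd : 1 ≤ d) (hIK : I ≤ K) (hK : ∀ κ ∈ K, κ * q.coeff 0 ∈ I) :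
    Module.finrank k (S[X] ⧸ rayIdeal I K q) =
      Module.finrank k (S ⧸ I) + (d - 1) * Module.finrank k (S ⧸ K) := by
  rw [(rayQuotEquiv k hq hqd hd hIK hK).finrank_eq, Module.finrank_prod, Module.finrank_pi_fintype]
  simp

theorem finite_quotient_rayIdeal {I K : Ideal S} [Module.Finite k (S ⧸ I)]
    [Module.Finite k (S ⧸ K)] {q : S[X]} (hq : q.Monic) {d : ℕ} (hqd : q.natDegree = d)
    (hd : 1 ≤ d) (hIK : I ≤ K) (hK : ∀ κ ∈ K, κ * q.coeff 0 ∈ I) :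
    Module.Finite k (S[X] ⧸ rayIdeal I K q) :=
  Module.Finite.equiv (rayQuotEquiv k hq hqd hd hIK hK).symm

theorem finite_quotient_of_le {I J : Ideal S} (h : I ≤ J) [Module.Finite k (S ⧸ I)] :
    Module.Finite k (S ⧸ J) :=
  Module.Finite.of_surjective (Ideal.Quotient.factorₐ k h).toLinearMap
    (Ideal.Quotient.factor_surjective h)

/-- The map `κ ↦ (κ D, κ)` whose range measures the failure of the square of a ray ideal to be
the direct sum of its obvious pieces. -/
def sqRelation (k : Type*) {S : Type*} [Field k] [CommRing S] [Algebra k S] (I K : Ideal S)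
    (D : S) : (K * K).restrictScalars k →ₗ[k] (S ⧸ I * I) × (S ⧸ I) :=
  (LinearMap.prod (mkLin k (I * I) ∘ₗ LinearMap.mulRight k D) (mkLin k I)) ∘ₗ
    Submodule.subtype _

/-- If `K² ∩ I ∩ (I² : D) ⊆ I K`, the range of the relation map has the dimension of
`K² ⧸ I K`. -/
theorem finrank_range_sqRelation {I K : Ideal S} {D : S} [Module.Finite k (S ⧸ I * I)]
    (hIK : I ≤ K) (hK : ∀ κ ∈ K, κ * D ∈ I)
    (hE : ∀ a ∈ K * K, a ∈ I → a * D ∈ I * I → a ∈ I * K) :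
    Module.finrank k (LinearMap.range (sqRelation k I K D)) + Module.finrank k (S ⧸ K * K) =
      Module.finrank k (S ⧸ I * K) := by
  have hII : I * I ≤ I * K := Ideal.mul_mono_right hIK
  have hIKK : I * K ≤ K * K := Ideal.mul_mono_left hIK
  have hDIK : ∀ t ∈ I * K, t * D ∈ I * I := fun t ht => by
    refine Submodule.mul_induction_on ht (fun a ha b hb => ?_) (fun a b ha hb => ?_)
    · have := Ideal.mul_mem_mul ha (hK b hb)
      rwa [← mul_assoc] at this
    · rw [add_mul]; exact add_mem ha hb
  have hIKI : I * K ≤ I := Ideal.mul_le_left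
  have : Module.Finite k (S ⧸ I * K) := finite_quotient_of_le hII
  let g : (K * K).restrictScalars k →ₗ[k] S ⧸ I * K := mkLin k (I * K) ∘ₗ Submodule.subtype _
  have hker : LinearMap.ker (sqRelation k I K D) = LinearMap.ker g := by
    ext ⟨a, ha⟩
    have h1 : (⟨a, ha⟩ : (K * K).restrictScalars k) ∈ LinearMap.ker (sqRelation k I K D) ↔
        a * D ∈ I * I ∧ a ∈ I := by
      rw [LinearMap.mem_ker]
      change (mkLin k (I * I) (a * D), mkLin k I a) = 0 ↔ _
      rw [Prod.mk_eq_zero, mkLin_eq_zero, mkLin_eq_zero]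
    have h2 : (⟨a, ha⟩ : (K * K).restrictScalars k) ∈ LinearMap.ker g ↔ a ∈ I * K := by
      rw [LinearMap.mem_ker]
      change mkLin k (I * K) a = 0 ↔ _
      rw [mkLin_eq_zero]
    rw [h1, h2]
    exact ⟨fun h => hE a ha h.2 h.1, fun h => ⟨hDIK a h, hIKI h⟩⟩
  have e := finrank_range_eq_of_ker_eq (sqRelation k I K D) g hker
  let φ : (S ⧸ I * K) →ₗ[k] S ⧸ K * K := (Ideal.Quotient.factorₐ k hIKK).toLinearMap
  have hφ : LinearMap.range φ = ⊤ :=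
    LinearMap.range_eq_top.2 (Ideal.Quotient.factor_surjective hIKK)
  have hφg : LinearMap.ker φ = LinearMap.range g := by
    ext x
    obtain ⟨a, rfl⟩ := Ideal.Quotient.mk_surjective x
    rw [LinearMap.mem_ker]
    change Ideal.Quotient.mk (K * K) a = 0 ↔ _
    rw [Ideal.Quotient.eq_zero_iff_mem]
    constructor
    · exact fun h => ⟨⟨a, h⟩, rfl⟩
    · rintro ⟨⟨b, hb⟩, hba⟩
      have : b - a ∈ I * K := Ideal.Quotient.eq.1 hba
      have := sub_mem hb (hIKK this)
      rwa [sub_sub_cancel] at this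
  have := LinearMap.finrank_range_add_finrank_ker φ
  rw [hφ, finrank_top, hφg] at this
  rw [e, ← this, add_comm]

/-- The length of the quotient by the square of the ray ideal of `X ^ d - D`. -/
theorem finrank_quotient_rayIdeal_mul_self [Nontrivial S] {I K : Ideal S} {d : ℕ} (hd : 2 ≤ d)
    {D : S} [Module.Finite k (S ⧸ I * I)] (hIK : I ≤ K) (hK : ∀ κ ∈ K, κ * D ∈ I)
    (hE : ∀ a ∈ K * K, a ∈ I → a * D ∈ I * I → a ∈ I * K) :
    Module.finrank k (S[X] ⧸ rayIdeal I K (rayPoly d D) * rayIdeal I K (rayPoly d D)) =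
      Module.finrank k (S ⧸ I * I) + Module.finrank k (S ⧸ I) +
        (d - 1) * (Module.finrank k (S ⧸ K * K) + Module.finrank k (S ⧸ K)) ∧
    Module.Finite k (S[X] ⧸ rayIdeal I K (rayPoly d D) * rayIdeal I K (rayPoly d D)) := by
  have hq := rayPoly_monic (by omega : 1 ≤ d) D
  have hqd := natDegree_rayPoly d D
  set q := rayPoly d D with hqdef
  have hII : I * I ≤ I * K := Ideal.mul_mono_right hIK
  have hIKK : I * K ≤ K * K := Ideal.mul_mono_left hIK
  have : Module.Finite k (S ⧸ I) := finite_quotient_of_le (I := I * I) Ideal.mul_le_right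
  have : Module.Finite k (S ⧸ K) := finite_quotient_of_le hIK
  have : Module.Finite k (S ⧸ I * K) := finite_quotient_of_le hII
  have : Module.Finite k (S ⧸ K * K) := finite_quotient_of_le (hII.trans hIKK)
  set R := LinearMap.range (sqRelation k I K D) with hR
  let φ : S[X] →ₗ[k] (((S ⧸ I * I) × (S ⧸ I)) ⧸ R) × (S ⧸ I * K) ×
      (Fin (d - 2) → S ⧸ K * K) × (Fin (d - 1) → S ⧸ K) :=
    LinearMap.prod
      (R.mkQ ∘ₗ LinearMap.prod (mkLin k (I * I) ∘ₗ modCoeff k q 0)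
        (mkLin k I ∘ₗ modCoeff k q 0 ∘ₗ divHom k hq))
      (LinearMap.prod (mkLin k (I * K) ∘ₗ modCoeff k q 1)
        (LinearMap.prod (LinearMap.pi fun j => mkLin k (K * K) ∘ₗ modCoeff k q (j + 2))
          (LinearMap.pi fun j => mkLin k K ∘ₗ modCoeff k q (j + 1) ∘ₗ divHom k hq)))
  have hzero : ∀ (p : S[X]) (j : ℕ), d ≤ j → (p %ₘ q).coeff j = 0 := fun p j hj => by
    apply coeff_eq_zero_of_degree_lt
    refine (degree_modByMonic_lt p hq).trans_le ?_
    rw [degree_eq_natDegree hq.ne_zero, hqd]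
    exact_mod_cast hj
  have hφ : Function.Surjective φ := by
    rintro ⟨z, b, c, e⟩
    obtain ⟨⟨a, a'⟩, rfl⟩ := R.mkQ_surjective z
    obtain ⟨a, rfl⟩ := exists_mkLin (k := k) _ a
    obtain ⟨a', rfl⟩ := exists_mkLin (k := k) _ a'
    obtain ⟨b, rfl⟩ := exists_mkLin (k := k) _ b
    choose c' hc' using fun j => exists_mkLin (k := k) _ (c j)
    choose e' he' using fun j => exists_mkLin (k := k) _ (e j)
    let u : ℕ → S := fun j => if j = 0 then a else if j = 1 then b else
      if h : j - 2 < d - 2 then c' ⟨j - 2, h⟩ else 0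
    let v : ℕ → S := fun j => if j = 0 then a' else if h : j - 1 < d - 1 then e' ⟨j - 1, h⟩ else 0
    have hu := polyOfCoeff_modByMonic hq u
    have hv := polyOfCoeff_modByMonic hq v
    rw [hqd] at hu hv
    set U := polyOfCoeff d u
    set V := polyOfCoeff d v
    have h1 : (U + q * V) %ₘ q = U := by
      rw [add_modByMonic, hu.1, (modByMonic_eq_zero_iff_dvd hq).2 (dvd_mul_right q V), add_zero]
    have h2 : ((U + q * V) /ₘ q) %ₘ q = V := by
      rw [Polynomial.add_divByMonic hq, hu.2, mul_divByMonic_cancel_left V hq, zero_add, hv.1]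
    refine ⟨U + q * V, ?_⟩
    change (R.mkQ (mkLin k (I * I) (((U + q * V) %ₘ q).coeff 0),
      mkLin k I ((((U + q * V) /ₘ q) %ₘ q).coeff 0)), mkLin k (I * K) (((U + q * V) %ₘ q).coeff 1),
      (fun j : Fin (d - 2) => mkLin k (K * K) (((U + q * V) %ₘ q).coeff (j + 2))),
      (fun j : Fin (d - 1) => mkLin k K ((((U + q * V) /ₘ q) %ₘ q).coeff (j + 1)))) = _
    rw [h1, h2, coeff_polyOfCoeff _ (by omega), coeff_polyOfCoeff _ (by omega),
      coeff_polyOfCoeff _ (by omega)]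
    refine Prod.ext rfl (Prod.ext rfl (Prod.ext (funext fun j => ?_) (funext fun j => ?_)))
    · simp only
      rw [coeff_polyOfCoeff _ (by omega), ← hc']
      simp [u]
    · simp only
      rw [coeff_polyOfCoeff _ (by omega), ← he']
      simp [v]
  have hker : ∀ p, φ p = 0 ↔ p ∈ rayIdeal I K q * rayIdeal I K q := by
    intro p
    rw [mem_rayIdeal_mul_self_iff hd hIK hK, ← hqdef]
    change (R.mkQ (mkLin k (I * I) ((p %ₘ q).coeff 0),
      mkLin k I (((p /ₘ q) %ₘ q).coeff 0)), mkLin k (I * K) ((p %ₘ q).coeff 1),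
      (fun j : Fin (d - 2) => mkLin k (K * K) ((p %ₘ q).coeff (j + 2))),
      (fun j : Fin (d - 1) => mkLin k K (((p /ₘ q) %ₘ q).coeff (j + 1)))) = 0 ↔ _
    rw [Prod.mk_eq_zero, Prod.mk_eq_zero, Prod.mk_eq_zero, mkLin_eq_zero, funext_iff, funext_iff,
      Submodule.mkQ_apply, Submodule.Quotient.mk_eq_zero]
    simp only [Pi.zero_apply, mkLin_eq_zero]
    refine and_congr ?_ (and_congr_right fun _ => and_congr ?_ ?_)
    · rw [hR, LinearMap.mem_range]
      constructor
      · rintro ⟨⟨κ, hκ⟩, h⟩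
        change (mkLin k (I * I) (κ * D), mkLin k I κ) = _ at h
        rw [Prod.mk.injEq] at h
        exact ⟨κ, hκ, Ideal.Quotient.eq.1 h.1.symm, Ideal.Quotient.eq.1 h.2.symm⟩
      · rintro ⟨κ, hκ, h1, h2⟩
        exact ⟨⟨κ, hκ⟩, Prod.ext (Ideal.Quotient.eq.2 h1).symm (Ideal.Quotient.eq.2 h2).symm⟩
    · refine ⟨fun h j => ?_, fun h j => h j⟩
      by_cases hj : j < d - 2
      · exact h ⟨j, hj⟩
      · rw [hzero _ _ (by omega)]; exact zero_mem _
    · refine ⟨fun h j => ?_, fun h j => h j⟩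
      by_cases hj : j < d - 1
      · exact h ⟨j, hj⟩
      · rw [hzero _ _ (by omega)]; exact zero_mem _
  have e := quotientLinearEquivOfSurjective _ φ hφ hker
  refine ⟨?_, Module.Finite.equiv e.symm⟩
  have h1 := finrank_range_sqRelation (k := k) hIK hK hE
  have h2 := Submodule.finrank_quotient_add_finrank R
  rw [← hR] at h1
  rw [Module.finrank_prod] at h2
  rw [e.finrank_eq, Module.finrank_prod, Module.finrank_prod, Module.finrank_prod,
    Module.finrank_pi_fintype, Module.finrank_pi_fintype]
  simp only [Finset.sum_const, Finset.card_univ, Fintype.card_fin, smul_eq_mul]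
  obtain ⟨d, rfl⟩ : ∃ d', d = d' + 2 := ⟨d - 2, by omega⟩
  simp only [Nat.add_sub_cancel, show d + 2 - 1 = d + 1 by omega] at *
  linarith

end RayLength

end

noncomputable section

open Polynomial

/-! ### Free conormal modules and the length of the square of a ray ideal -/

section FreeConormal

variable {k S : Type*} [Field k] [CommRing S] [Algebra k S]

/-- `I ⧸ I²` is a free `S ⧸ I`-module of rank `n`, expressed by a basis. -/
def IsFreeConormal (I : Ideal S) (n : ℕ) : Prop :=
  ∃ i : Fin n → S, (∀ b, i b ∈ I) ∧ (∀ x ∈ I, ∃ r : Fin n → S, x - ∑ b, r b * i b ∈ I * I) ∧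
    ∀ r : Fin n → S, ∑ b, r b * i b ∈ I * I → ∀ b, r b ∈ I

theorem IsFreeConormal.finrank_quotient_mul_self {I : Ideal S} {n : ℕ} (h : IsFreeConormal I n)
    [Module.Finite k (S ⧸ I * I)] :
    Module.finrank k (S ⧸ I * I) = (n + 1) * Module.finrank k (S ⧸ I) := by
  obtain ⟨i, hi, hgen, hfree⟩ := h
  have hII : I * I ≤ I := Ideal.mul_le_left
  have : Module.Finite k (S ⧸ I) := finite_quotient_of_le hII
  let φ : (S ⧸ I * I) →ₗ[k] S ⧸ I := (Ideal.Quotient.factorₐ k hII).toLinearMap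
  have hφ : LinearMap.range φ = ⊤ :=
    LinearMap.range_eq_top.2 (Ideal.Quotient.factor_surjective hII)
  let f : (Fin n → S) →ₗ[k] S ⧸ I * I :=
    mkLin k (I * I) ∘ₗ ∑ b, LinearMap.mulRight k (i b) ∘ₗ LinearMap.proj b
  have hf : ∀ r, f r = mkLin k (I * I) (∑ b, r b * i b) := fun r => by simp [f]
  let g : (Fin n → S) →ₗ[k] Fin n → S ⧸ I := LinearMap.pi fun b => mkLin k I ∘ₗ LinearMap.proj b
  have hg : LinearMap.range g = ⊤ := by
    rw [LinearMap.range_eq_top]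
    intro c
    choose c' hc' using fun j => exists_mkLin (k := k) _ (c j)
    exact ⟨c', funext hc'⟩
  have hker : LinearMap.ker f = LinearMap.ker g := by
    ext r
    rw [LinearMap.mem_ker, LinearMap.mem_ker, hf, mkLin_eq_zero, funext_iff]
    refine ⟨fun h b => (mkLin_eq_zero (k := k)).2 (hfree r h b), fun h => ?_⟩
    exact sum_mem fun b _ => Ideal.mul_mem_mul ((mkLin_eq_zero (k := k)).1 (h b)) (hi b)
  have hrange : LinearMap.ker φ = LinearMap.range f := by
    ext x
    obtain ⟨a, rfl⟩ := Ideal.Quotient.mk_surjective x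
    rw [LinearMap.mem_ker]
    change Ideal.Quotient.mk I a = 0 ↔ _
    rw [Ideal.Quotient.eq_zero_iff_mem, LinearMap.mem_range]
    constructor
    · intro ha
      obtain ⟨r, hr⟩ := hgen a ha
      exact ⟨r, by rw [hf]; exact (Ideal.Quotient.eq.2 hr).symm⟩
    · rintro ⟨r, hr⟩
      rw [hf] at hr
      have : (∑ b, r b * i b) - a ∈ I * I := Ideal.Quotient.eq.1 hr
      have hsum : ∑ b, r b * i b ∈ I := sum_mem fun b _ => Ideal.mul_mem_left I (r b) (hi b)
      have := sub_mem hsum (hII this)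
      rwa [sub_sub_cancel] at this
  have h1 := LinearMap.finrank_range_add_finrank_ker φ
  have h2 := finrank_range_eq_of_ker_eq f g hker
  rw [hφ, finrank_top, hrange, h2, hg, finrank_top, Module.finrank_pi_fintype] at h1
  simp only [Finset.sum_const, Finset.card_univ, Fintype.card_fin, smul_eq_mul] at h1
  rw [← h1]; ring

theorem exists_of_mem_mul {I K : Ideal S} {n : ℕ} {i : Fin n → S}
    (hgen : ∀ x ∈ I, ∃ r : Fin n → S, x - ∑ b, r b * i b ∈ I * I) {x : S} (hx : x ∈ I * K) :
    ∃ s : Fin n → S, (∀ b, s b ∈ K) ∧ x - ∑ b, s b * i b ∈ I * I := by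
  refine Submodule.mul_induction_on hx (fun a ha c hc => ?_) ?_
  · obtain ⟨r, hr⟩ := hgen a ha
    refine ⟨fun b => c * r b, fun b => Ideal.mul_mem_right _ _ hc, ?_⟩
    convert Ideal.mul_mem_left _ c hr using 1
    rw [mul_sub, Finset.mul_sum, mul_comm a c]
    simp only [mul_assoc]
  · rintro x y ⟨s, hs, hx⟩ ⟨t, ht, hy⟩
    refine ⟨fun b => s b + t b, fun b => add_mem (hs b) (ht b), ?_⟩
    convert add_mem hx hy using 1
    simp only [add_mul, Finset.sum_add_distrib]; ring

/-- If `I ⧸ I²` is free and `K = (I : D)`, then `I ∩ (I² : D) ⊆ I K`. -/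
theorem IsFreeConormal.mem_mul_of_mul_mem {I K : Ideal S} {n : ℕ} (h : IsFreeConormal I n) {D : S}
    (hIK : I ≤ K) (hK : ∀ s, s * D ∈ I → s ∈ K) {a : S} (ha : a ∈ I) (haD : a * D ∈ I * I) :
    a ∈ I * K := by
  obtain ⟨i, hi, hgen, hfree⟩ := h
  obtain ⟨r, hr⟩ := hgen a ha
  have h1 : ∑ b, (r b * D) * i b ∈ I * I := by
    have := sub_mem haD (Ideal.mul_mem_right D _ hr)
    convert this using 1
    rw [sub_mul, sub_sub_cancel, Finset.sum_mul]
    exact Finset.sum_congr rfl fun b _ => by ring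
  have h2 : ∑ b, r b * i b ∈ I * K := sum_mem fun b _ => by
    rw [mul_comm (r b)]; exact Ideal.mul_mem_mul (hi b) (hK _ (hfree _ h1 b))
  have := add_mem (Ideal.mul_mono_right hIK hr : _ ∈ I * K) h2
  rwa [sub_add_cancel] at this

/-- If `I ⧸ I²` is free and `M = (K : σ)` contains `I`, then `I ∩ (I K : σ) ⊆ M I`. -/
theorem IsFreeConormal.mem_mul_of_mul_mem_mul {I K M : Ideal S} {n : ℕ} (h : IsFreeConormal I n)
    {σ : S} (hIK : I ≤ K) (hIM : I ≤ M) (hM : ∀ s, s * σ ∈ K → s ∈ M) {a : S} (ha : a ∈ I)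
    (haσ : a * σ ∈ I * K) : a ∈ I * M := by
  obtain ⟨i, hi, hgen, hfree⟩ := h
  obtain ⟨r, hr⟩ := hgen a ha
  obtain ⟨s, hs, hs'⟩ := exists_of_mem_mul hgen haσ
  have h1 : ∑ b, (r b * σ - s b) * i b ∈ I * I := by
    have := sub_mem hs' (Ideal.mul_mem_right σ _ hr)
    convert this using 1
    simp only [sub_mul, Finset.sum_sub_distrib, Finset.sum_mul]
    rw [sub_sub_sub_cancel_left]
    congr 1
    exact Finset.sum_congr rfl fun b _ => by ring
  have h2 : ∑ b, r b * i b ∈ I * M := sum_mem fun b _ => by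
    rw [mul_comm (r b)]
    refine Ideal.mul_mem_mul (hi b) (hM _ ?_)
    have := add_mem (hIK (hfree _ h1 b)) (hs b)
    rwa [sub_add_cancel] at this
  have := add_mem (Ideal.mul_mono_right hIM hr : _ ∈ I * M) h2
  rwa [sub_add_cancel] at this

end FreeConormal

theorem rayIdeal_mono {S : Type*} [CommRing S] {I K I' K' : Ideal S} {q : S[X]} (hI : I ≤ I') (hK : K ≤ K') :
    rayIdeal I K q ≤ rayIdeal I' K' q :=
  rayIdeal_le (fun _ ha => C_mem_rayIdeal (hI ha)) (fun _ ha => X_mul_C_mem_rayIdeal (hK ha))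
    self_mem_rayIdeal

theorem mul_mem_rayIdeal_of_mem {S : Type*} [CommRing S] {I K M : Ideal S} {D σ : S} {d : ℕ}
    (hσ : ∀ s ∈ M, s * σ ∈ K) {p : S[X]} (hp : p ∈ rayIdeal M M (rayPoly d D)) :
    p * (C σ * X) ∈ rayIdeal I K (rayPoly d D) := by
  have : rayIdeal M M (rayPoly d D) ≤
      Submodule.comap (LinearMap.mulRight S[X] (C σ * X : S[X])) (rayIdeal I K (rayPoly d D)) := by
    refine rayIdeal_le (fun a ha => ?_) (fun a ha => ?_) ?_
    · change C a * (C σ * X) ∈ rayIdeal I K (rayPoly d D)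
      rw [show C a * (C σ * X) = X * C (a * σ) by rw [C_mul]; ring]
      exact X_mul_C_mem_rayIdeal (hσ a ha)
    · change X * C a * (C σ * X) ∈ rayIdeal I K (rayPoly d D)
      rw [show X * C a * (C σ * X) = X * (X * C (a * σ)) by rw [C_mul]; ring]
      exact Ideal.mul_mem_left _ _ (X_mul_C_mem_rayIdeal (hσ a ha))
    · exact Ideal.mul_mem_right _ _ self_mem_rayIdeal
  exact this hp

section IteratedRay

variable {k S : Type*} [Field k] [CommRing S] [Nontrivial S] [Algebra k S]

/-- The analogue of `IsFreeConormal.mem_mul_of_mul_mem` for the ray ideal `J` of `I`, which need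
not have a free conormal module. Here `M` is the ideal of the closed point, `L = (J : φ)` with
`φ = σ X`, and `σ` is a socle generator modulo `K`. -/
theorem mem_rayIdeal_mul_of_mul_mem {I K M : Ideal S} {D σ : S} {d n : ℕ} (hd : 2 ≤ d)
    (hI : IsFreeConormal I n) (hK : IsFreeConormal K n) (hIK : I ≤ K) (hKM : K ≤ M) (hKD : ∀ s, s * D ∈ I ↔ s ∈ K) (hσ : ∀ s, s * σ ∈ K ↔ s ∈ M) {p : S[X]}
    (hpL : p ∈ rayIdeal M M (rayPoly d D) * rayIdeal M M (rayPoly d D))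
    (hpJ : p ∈ rayIdeal I K (rayPoly d D))
    (hp : p * (C σ * X) ∈ rayIdeal I K (rayPoly d D) * rayIdeal I K (rayPoly d D)) :
    p ∈ rayIdeal I K (rayPoly d D) * rayIdeal M M (rayPoly d D) := by
  have hq := rayPoly_monic (by omega : 1 ≤ d) D
  have hqd := natDegree_rayPoly d D
  have hdeg : 1 ≤ (rayPoly d D).natDegree := by omega
  have hκI : ∀ κ ∈ K, κ * D ∈ I := fun κ h => (hKD κ).2 h
  have hq0 := coeff_rayPoly_zero (by omega : 1 ≤ d) D
  have hIM := hIK.trans hKM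
  rw [mem_rayIdeal_mul_self_iff hd le_rfl fun κ h => Ideal.mul_mem_right _ _ h] at hpL
  rw [mem_rayIdeal_iff hq hdeg hIK fun κ h => by
    rw [hq0, mul_neg]; exact neg_mem (hκI κ h)] at hpJ
  rw [show p * (C σ * X) = X * (C σ * p) by ring, mem_rayIdeal_mul_self_iff hd hIK hκI] at hp
  have hx1 := coeff_X_mul_modByMonic_zero hq hdeg (C σ * p)
  have hx2 := coeff_X_mul_modByMonic_succ hq hdeg (C σ * p)
  have hy1 := coeff_X_mul_modByMonic_zero hq hdeg (C σ * p /ₘ rayPoly d D)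
  rw [(X_mul_div_modByMonic hq hdeg _).1, add_modByMonic, C_modByMonic hq hdeg] at hp
  set q := rayPoly d D with hqdef
  rw [C_mul_modByMonic, hqd, hq0, coeff_C_mul] at hx1
  rw [C_mul_divByMonic hq, C_mul_modByMonic, hqd, hq0, coeff_C_mul] at hy1
  simp only [C_mul_modByMonic, hqd, coeff_C_mul] at hx2
  rw [C_mul_divByMonic hq, C_mul_modByMonic, hqd, coeff_C_mul] at hp
  obtain ⟨⟨κ, hκ, h0, hy0⟩, h1, h2, -⟩ := hp
  obtain ⟨⟨μ, hμ, -, hyμ⟩, -, -, hyM⟩ := hpL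
  obtain ⟨hxI, hxK⟩ := hpJ
  rw [coeff_add, hy1, coeff_C_zero] at hy0
  rw [hx1] at h0
  set x := p %ₘ q with hx
  set y := (p /ₘ q) %ₘ q with hy
  have hyM' : ∀ j, y.coeff j ∈ M := by
    rintro (_ | j)
    · have := add_mem hyμ (Ideal.mul_le_left hμ)
      rwa [sub_add_cancel] at this
    · exact hyM j
  have hqj : ∀ j, j + 1 < d → q.coeff (j + 1) = 0 := fun j hj => by
    rw [hqdef, rayPoly, coeff_sub, coeff_X_pow, if_neg (by omega), coeff_C_succ, sub_zero]
  have hxd : ∀ j, d ≤ j → x.coeff j = 0 := fun j hj => by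
    apply coeff_eq_zero_of_degree_lt
    refine (degree_modByMonic_lt p hq).trans_le ?_
    rw [degree_eq_natDegree hq.ne_zero, hqd]
    exact_mod_cast hj
  -- the constant coefficient
  have c0 : x.coeff 0 ∈ I * M := by
    rw [hx2, hqj 0 (by omega), mul_zero, sub_zero] at h1
    exact hI.mem_mul_of_mul_mem_mul hIK hIM (fun s => (hσ s).1) hxI (by rwa [mul_comm _ σ])
  -- the top coefficient
  have ctop : σ * x.coeff (d - 1) ∈ K * K := by
    have hw : σ * x.coeff (d - 1) - κ ∈ I := by
      have hyD : σ * y.coeff (d - 1) * D ∈ I :=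
        (hKD _).2 (by rw [mul_comm]; exact (hσ _).2 (hyM' _))
      convert sub_mem hy0 hyD using 1
      ring
    have hw2 : (σ * x.coeff (d - 1) - κ) * D ∈ I * I := by
      convert h0 using 1; ring
    have := hI.mem_mul_of_mul_mem hIK (fun s => (hKD s).1) hw hw2
    have := add_mem (Ideal.mul_mono_left hIK this) hκ
    rwa [sub_add_cancel] at this
  have cK : ∀ j, x.coeff (j + 1) ∈ K * M := by
    intro j
    have hmem : σ * x.coeff (j + 1) ∈ K * K := by
      rcases lt_trichotomy (j + 2) d with h | h | h
      · have := h2 j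
        rwa [hx2, hqj (j + 1) h, mul_zero, sub_zero] at this
      · rwa [show j + 1 = d - 1 by omega]
      · rw [hxd _ (by omega), mul_zero]; exact zero_mem _
    exact hK.mem_mul_of_mul_mem_mul le_rfl hKM (fun s => (hσ s).1) (hxK j) (by rwa [mul_comm _ σ])
  have hML : M.map C ≤ rayIdeal M M q :=
    Ideal.map_le_iff_le_comap.2 fun a ha => C_mem_rayIdeal ha
  have hIJ : I.map C ≤ rayIdeal I K q :=
    Ideal.map_le_iff_le_comap.2 fun a ha => C_mem_rayIdeal ha
  have hKJ : K.map C ≤ Submodule.comap (LinearMap.mulLeft S[X] (X : S[X])) (rayIdeal I K q) :=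
    Ideal.map_le_iff_le_comap.2 fun a ha => X_mul_C_mem_rayIdeal ha
  have hpe : p = q * q * ((p /ₘ q) /ₘ q) + q * y + x := by
    conv_lhs => rw [← modByMonic_add_div p q, ← modByMonic_add_div (p /ₘ q) q]
    ring
  have hqL : q ∈ rayIdeal M M q := self_mem_rayIdeal
  have hqJ : q ∈ rayIdeal I K q := self_mem_rayIdeal
  rw [hpe]
  refine add_mem (add_mem (Ideal.mul_mem_right _ _ (Ideal.mul_mem_mul hqJ hqL))
    (Ideal.mul_mem_mul hqJ ?_)) ?_
  · rw [as_sum_range_C_mul_X_pow y]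
    exact sum_mem fun j _ => Ideal.mul_mem_right _ _ (C_mem_rayIdeal (hyM' j))
  · rw [as_sum_range_C_mul_X_pow x]
    refine sum_mem fun j _ => ?_
    rcases j with _ | j
    · rw [pow_zero, mul_one]
      have := Ideal.mem_map_of_mem C c0
      rw [Ideal.map_mul] at this
      exact Ideal.mul_mono hIJ hML this
    · have := Ideal.mem_map_of_mem C (cK j)
      rw [Ideal.map_mul] at this
      rw [pow_succ', ← mul_assoc]
      refine Ideal.mul_mem_right _ _ ?_
      refine Submodule.mul_induction_on this (fun u hu v hv => ?_) fun u v hu hv => ?_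
      · rw [show u * v * X = (X * u) * v by ring]
        exact Ideal.mul_mem_mul (hKJ hu) (hML hv)
      · rw [add_mul]; exact add_mem hu hv

/-- The conormal module of the iterated ray ideal has the length of a free module of rank
`n + 2`. -/
theorem finrank_quotient_iterated_rayIdeal {I K M : Ideal S} {D σ : S} {d m n : ℕ} (hd : 2 ≤ d)
    (hm : 2 ≤ m) (hI : IsFreeConormal I n) (hK : IsFreeConormal K n) (hM : IsFreeConormal M n)
    (hIK : I ≤ K) (hKM : K ≤ M) (hKD : ∀ s, s * D ∈ I ↔ s ∈ K)
    (hσ : ∀ s, s * σ ∈ K ↔ s ∈ M) [Module.Finite k (S ⧸ I * I)] :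
    let J := rayIdeal (rayIdeal I K (rayPoly d D)) (rayIdeal M M (rayPoly d D))
      (rayPoly m (C σ * X))
    Module.Finite k (S[X][X] ⧸ J * J) ∧
      Module.finrank k (S[X][X] ⧸ J * J) = (n + 3) * Module.finrank k (S[X][X] ⧸ J) := by
  intro J
  have hq := rayPoly_monic (by omega : 1 ≤ d) D
  have hqd := natDegree_rayPoly d D
  have hq0 := coeff_rayPoly_zero (by omega : 1 ≤ d) D
  have hr := rayPoly_monic (by omega : 1 ≤ m) (C σ * X)
  have hrd := natDegree_rayPoly m (C σ * X)
  have hr0 := coeff_rayPoly_zero (by omega : 1 ≤ m) (C σ * X)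
  have hκI : ∀ κ ∈ K, κ * D ∈ I := fun κ h => (hKD κ).2 h
  have hIM := hIK.trans hKM
  have hMD : ∀ κ ∈ M, κ * D ∈ M := fun κ h => Ideal.mul_mem_right _ _ h
  have : Module.Finite k (S ⧸ I) := finite_quotient_of_le (I := I * I) Ideal.mul_le_left
  have : Module.Finite k (S ⧸ K) := finite_quotient_of_le hIK
  have : Module.Finite k (S ⧸ M) := finite_quotient_of_le hKM
  have : Module.Finite k (S ⧸ K * K) := finite_quotient_of_le (Ideal.mul_mono hIK hIK)
  have : Module.Finite k (S ⧸ M * M) := finite_quotient_of_le (Ideal.mul_mono hIM hIM)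
  obtain ⟨e1, f1⟩ := finrank_quotient_rayIdeal_mul_self (k := k) hd hIK hκI
    fun a _ ha haD => hI.mem_mul_of_mul_mem hIK (fun s => (hKD s).1) ha haD
  obtain ⟨e2, f2⟩ := finrank_quotient_rayIdeal_mul_self (k := k) hd le_rfl hMD
    fun a ha _ _ => ha
  have e3 := finrank_quotient_rayIdeal (k := k) hq hqd (by omega) hIK
    fun κ h => by rw [hq0, mul_neg]; exact neg_mem (hκI κ h)
  have e4 := finrank_quotient_rayIdeal (k := k) hq hqd (by omega) (le_refl M)
    fun κ h => by rw [hq0, mul_neg]; exact neg_mem (hMD κ h)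
  have f3 := finite_quotient_rayIdeal (k := k) hq hqd (by omega) hIK
    fun κ h => by rw [hq0, mul_neg]; exact neg_mem (hκI κ h)
  have f4 := finite_quotient_rayIdeal (k := k) hq hqd (by omega) (le_refl M)
    fun κ h => by rw [hq0, mul_neg]; exact neg_mem (hMD κ h)
  have hJL : rayIdeal I K (rayPoly d D) ≤ rayIdeal M M (rayPoly d D) := rayIdeal_mono hIM hKM
  have hLφ : ∀ p ∈ rayIdeal M M (rayPoly d D), p * (C σ * X) ∈ rayIdeal I K (rayPoly d D) :=
    fun p hp => mul_mem_rayIdeal_of_mem (fun s hs => (hσ s).2 hs) hp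
  obtain ⟨e5, f5⟩ := finrank_quotient_rayIdeal_mul_self (k := k) hm hJL hLφ
    fun a haL haJ hap =>
      mem_rayIdeal_mul_of_mul_mem hd hI hK hIK hKM hKD hσ haL haJ hap
  have e6 := finrank_quotient_rayIdeal (k := k) hr hrd (by omega) hJL
    fun κ h => by rw [hr0, mul_neg]; exact neg_mem (hLφ κ h)
  refine ⟨f5, ?_⟩
  rw [e5, e6, e1, e2, e3, e4, hI.finrank_quotient_mul_self (k := k),
    hK.finrank_quotient_mul_self (k := k), hM.finrank_quotient_mul_self (k := k)]
  ring

end IteratedRay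

end

noncomputable section

/-! ### Contraction -/

section Contraction

variable {ι k : Type*}

open MvPolynomial in
theorem coeff_contract_monomial [CommSemiring k] (s : MvPowerSeries ι k) (a c : ι →₀ ℕ) (r : k)
    [Decidable (c ≤ a)] : MvPolynomial.coeff c (contract s (monomial a r)) =
      if c ≤ a then MvPowerSeries.coeff (a - c) s * r else 0 := by
  classical
  rw [contract_monomial, coeff_sum]
  simp only [coeff_monomial]
  split_ifs with h
  · rw [Finset.sum_eq_single (a - c, c)]
    · simp
    · rintro ⟨u, v⟩ hu huv
      rw [Finset.HasAntidiagonal.mem_antidiagonal] at hu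
      simp only
      rw [if_neg]
      rintro rfl
      exact huv (Prod.ext (by rw [← hu]; simp) rfl)
    · intro hn
      exact absurd (Finset.HasAntidiagonal.mem_antidiagonal.2 (tsub_add_cancel_of_le h)) hn
  · refine Finset.sum_eq_zero fun u hu => if_neg ?_
    rintro rfl
    rw [Finset.HasAntidiagonal.mem_antidiagonal] at hu
    exact h (hu ▸ le_add_self)

open MvPolynomial in
theorem contract_monomial_monomial [CommSemiring k] (b a : ι →₀ ℕ) (t r : k) [Decidable (b ≤ a)] :
    contract (MvPowerSeries.monomial b t) (monomial a r) =
      if b ≤ a then monomial (a - b) (t * r) else 0 := by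
  classical
  ext c
  rw [coeff_contract_monomial, MvPowerSeries.coeff_monomial]
  by_cases hb : b ≤ a
  · rw [if_pos hb, coeff_monomial]
    by_cases hc : c ≤ a
    · rw [if_pos hc]
      have : a - c = b ↔ a - b = c := by
        constructor
        · rintro rfl; exact tsub_tsub_cancel_of_le hc
        · rintro rfl; exact tsub_tsub_cancel_of_le hb
      simp only [this, ite_mul, zero_mul]
    · rw [if_neg hc, if_neg]
      rintro rfl
      exact hc tsub_le_self
  · rw [if_neg hb, coeff_zero]
    split_ifs with h1 h2
    · exact absurd (h2 ▸ tsub_le_self) hb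
    · rw [zero_mul]
    · rfl

theorem contract_monomial' [CommSemiring k] [DecidableEq ι] (s : MvPowerSeries ι k) (a : ι →₀ ℕ)
    (r : k) :
    contract s (MvPolynomial.monomial a r) = ∑ u ∈ Finset.HasAntidiagonal.antidiagonal a,
      MvPolynomial.monomial u.2 (MvPowerSeries.coeff u.1 s * r) := by
  convert contract_monomial s a r

theorem contract_one [CommSemiring k] (p : MvPolynomial ι k) :
    contract (1 : MvPowerSeries ι k) p = p := by
  classical
  induction p using MvPolynomial.induction_on' with
  | add p q hp hq => rw [contract_add_right, hp, hq]
  | monomial a r =>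
    rw [← MvPowerSeries.monomial_zero_one, contract_monomial_monomial, if_pos (zero_le), tsub_zero,
      one_mul]

/-- The contraction `s ⌟ p` only involves the coefficients of `s` in degrees at most that
of `p`. -/
theorem contract_congr [CommSemiring k] {s t : MvPowerSeries ι k} {p : MvPolynomial ι k}
    (h : ∀ b : ι →₀ ℕ, b.degree ≤ p.totalDegree →
      MvPowerSeries.coeff b s = MvPowerSeries.coeff b t) : contract s p = contract t p := by
  classical
  unfold contract
  refine Finset.sum_congr rfl fun a ha => Finset.sum_congr rfl fun u hu => ?_
  rw [h u.1]
  rw [Finset.HasAntidiagonal.mem_antidiagonal] at hu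
  refine le_trans ?_ (MvPolynomial.le_totalDegree ha)
  rw [← hu]
  change _ ≤ (u.1 + u.2).degree
  rw [map_add]
  exact Nat.le_add_right _ _

theorem contract_truncTotal [Finite ι] [CommSemiring k] (s : MvPowerSeries ι k)
    {p : MvPolynomial ι k} {N : ℕ} (hN : p.totalDegree < N) :
    contract (MvPowerSeries.truncTotal N s : MvPowerSeries ι k) p = contract s p :=
  contract_congr fun b hb => by
    rw [MvPolynomial.coeff_coe, MvPowerSeries.coeff_truncTotal _ (hb.trans_lt hN)]

theorem contract_eq_zero_of_coeff_eq_zero [CommSemiring k] {s : MvPowerSeries ι k}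
    {p : MvPolynomial ι k}
    (h : ∀ b : ι →₀ ℕ, b.degree ≤ p.totalDegree → MvPowerSeries.coeff b s = 0) :
    contract s p = 0 := by
  rw [contract_congr (t := 0), contract_zero_left]
  simpa using h

theorem contract_C [CommSemiring k] (c : k) (p : MvPolynomial ι k) :
    contract (MvPowerSeries.C c : MvPowerSeries ι k) p = MvPolynomial.C c * p := by
  classical
  induction p using MvPolynomial.induction_on' with
  | add p q hp hq => rw [contract_add_right, hp, hq, mul_add]
  | monomial a r =>
    rw [← MvPowerSeries.monomial_zero_eq_C_apply, contract_monomial_monomial, if_pos (zero_le),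
      tsub_zero, MvPolynomial.C_mul_monomial]

theorem contract_sub_left [CommRing k] (s t : MvPowerSeries ι k) (p : MvPolynomial ι k) :
    contract (s - t) p = contract s p - contract t p := by
  rw [eq_sub_iff_add_eq, ← contract_add_left, sub_add_cancel]

theorem contract_comm [CommSemiring k] (s t : MvPowerSeries ι k) (p : MvPolynomial ι k) :
    contract s (contract t p) = contract t (contract s p) := by
  rw [← contract_mul, mul_comm, contract_mul]

/-- The constant coefficient of `s ⌟ 1` is that of `s`. -/
theorem contract_apply_one [CommSemiring k] (s : MvPowerSeries ι k) :
    contract s (1 : MvPolynomial ι k) = MvPolynomial.C (MvPowerSeries.constantCoeff s) := by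
  classical
  ext c
  have : (1 : MvPolynomial ι k) = MvPolynomial.monomial 0 1 := rfl
  rw [this, coeff_contract_monomial, MvPolynomial.coeff_C]
  by_cases hc : c = 0
  · subst hc; simp
  · rw [if_neg (fun h => hc (le_antisymm h (zero_le))), if_neg (Ne.symm hc)]

section Option

variable [CommSemiring k]

theorem X_none_pow_mul_rename_monomial (j : ℕ) (a : ι →₀ ℕ) (r : k) :
    MvPolynomial.X none ^ j * MvPolynomial.rename some (MvPolynomial.monomial a r) =
      MvPolynomial.monomial (Finsupp.single none j + a.mapDomain some) r := by
  rw [MvPolynomial.rename_monomial, MvPolynomial.X_pow_eq_monomial, MvPolynomial.monomial_mul,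
    one_mul]

theorem single_none_add_mapDomain_apply_none (j : ℕ) (a : ι →₀ ℕ) :
    (Finsupp.single none j + a.mapDomain some : Option ι →₀ ℕ) none = j := by
  rw [Finsupp.add_apply, Finsupp.single_eq_same, Finsupp.mapDomain_of_notMem_range, add_zero]
  simp

theorem single_none_add_mapDomain_apply_some (j : ℕ) (a : ι →₀ ℕ) (i : ι) :
    (Finsupp.single none j + a.mapDomain some : Option ι →₀ ℕ) (some i) = a i := by
  rw [Finsupp.add_apply, Finsupp.mapDomain_apply (Option.some_injective ι)]
  simp

theorem exists_eq_single_none_add_mapDomain (c : Option ι →₀ ℕ) :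
    c = Finsupp.single none (c none) + c.some.mapDomain some := by
  ext (_ | i)
  · rw [single_none_add_mapDomain_apply_none]
  · rw [single_none_add_mapDomain_apply_some, Finsupp.some_apply]

/-- Contraction by a power of the new dual variable. -/
theorem contract_X_none_pow (i j : ℕ) (p : MvPolynomial ι k) :
    contract (MvPowerSeries.X none ^ i) (MvPolynomial.X none ^ j * MvPolynomial.rename some p) =
      if i ≤ j then MvPolynomial.X none ^ (j - i) * MvPolynomial.rename some p else 0 := by
  classical
  induction p using MvPolynomial.induction_on' with
  | add p q hp hq =>
    rw [map_add, mul_add, contract_add_right, hp, hq]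
    split_ifs
    · rw [mul_add]
    · rw [add_zero]
  | monomial a r =>
    rw [X_none_pow_mul_rename_monomial, X_none_pow_mul_rename_monomial, MvPowerSeries.X_pow_eq,
      contract_monomial_monomial, one_mul]
    have : Finsupp.single none i ≤ (Finsupp.single none j + a.mapDomain some : Option ι →₀ ℕ) ↔
        i ≤ j := by
      rw [Finsupp.single_le_iff, single_none_add_mapDomain_apply_none]
    simp only [this]
    split_ifs with h
    · congr 2
      ext (_ | i)
      · rw [Finsupp.tsub_apply, single_none_add_mapDomain_apply_none,
          single_none_add_mapDomain_apply_none, Finsupp.single_eq_same]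
      · rw [Finsupp.tsub_apply, single_none_add_mapDomain_apply_some,
          single_none_add_mapDomain_apply_some]
        simp
    · rfl

/-- Contraction by a power series in the old dual variables. -/
theorem contract_rename_some [Finite ι] (s : MvPowerSeries ι k) (j : ℕ) (p : MvPolynomial ι k) :
    contract (MvPowerSeries.rename some s)
      (MvPolynomial.X none ^ j * MvPolynomial.rename some p) =
      MvPolynomial.X none ^ j * MvPolynomial.rename some (contract s p) := by
  classical
  induction p using MvPolynomial.induction_on' with
  | add p q hp hq => simp only [map_add, mul_add, contract_add_right, hp, hq]
  | monomial a r =>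
    rw [X_none_pow_mul_rename_monomial, contract_monomial', contract_monomial', map_sum,
      Finset.mul_sum]
    simp only [X_none_pow_mul_rename_monomial]
    symm
    refine Finset.sum_of_injOn
      (fun u => (u.1.mapDomain some, Finsupp.single none j + u.2.mapDomain some)) ?_ ?_ ?_ ?_
    · rintro ⟨u, v⟩ - ⟨u', v'⟩ - h
      rw [Prod.mk.injEq] at h
      have hinj := Finsupp.mapDomain_injective (M := ℕ) (Option.some_injective ι)
      exact Prod.ext (hinj h.1) (hinj (add_left_cancel h.2))
    · rintro ⟨u, v⟩ h
      rw [Finset.mem_coe, Finset.HasAntidiagonal.mem_antidiagonal] at h ⊢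
      simp only at h ⊢
      rw [← h, Finsupp.mapDomain_add, add_left_comm]
    · rintro ⟨u, v⟩ h hn
      rw [MvPowerSeries.coeff_rename_eq_zero, zero_mul, map_zero]
      rintro ⟨w, hw⟩
      simp only at hw
      subst hw
      refine hn ⟨(w, v.some), ?_, ?_⟩
      · rw [Finset.HasAntidiagonal.mem_antidiagonal] at h
        rw [Finset.mem_coe, Finset.HasAntidiagonal.mem_antidiagonal]
        ext i
        have := DFunLike.congr_fun h (some i)
        simp only [Finsupp.add_apply] at this
        rw [Finsupp.mapDomain_apply (Option.some_injective ι)] at this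
        simpa [Finsupp.mapDomain_apply (Option.some_injective ι)] using this
      · have := DFunLike.congr_fun (Finset.HasAntidiagonal.mem_antidiagonal.1 h) none
        simp only at this
        rw [single_none_add_mapDomain_apply_none, Finsupp.add_apply,
          Finsupp.mapDomain_of_notMem_range _ _ (by simp), zero_add] at this
        refine Prod.ext rfl ?_
        simp only
        conv_rhs => rw [exists_eq_single_none_add_mapDomain v]
        rw [this]
    · rintro ⟨u, v⟩ -
      have := MvPowerSeries.coeff_embDomain_rename Function.Embedding.some s u
      rw [Finsupp.embDomain_eq_mapDomain] at this
      simp only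
      rw [← this]
      rfl

theorem contract_rename_some_mul_X_none_pow [Finite ι] (s : MvPowerSeries ι k) (i j : ℕ)
    (p : MvPolynomial ι k) :
    contract (MvPowerSeries.rename some s * MvPowerSeries.X none ^ i)
      (MvPolynomial.X none ^ j * MvPolynomial.rename some p) =
      if i ≤ j then MvPolynomial.X none ^ (j - i) * MvPolynomial.rename some (contract s p)
      else 0 := by
  rw [contract_mul, contract_X_none_pow]
  split_ifs
  · rw [contract_rename_some]
  · rw [contract_zero_right]

end Option

end Contraction

/-! ### Ray sums with vanishing square -/

section RaySum

variable {ι k : Type*} [CommRing k]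

theorem raySum_eq_of_sq {d : ℕ} {f : MvPolynomial ι k} {D : MvPowerSeries ι k}
    (hf : 0 < f.totalDegree) (hD2 : contract (D ^ 2) f = 0) :
    raySum d f D = MvPolynomial.rename some f +
      MvPolynomial.X none ^ d * MvPolynomial.rename some (contract D f) := by
  obtain ⟨N, hN⟩ : ∃ N, f.totalDegree + 1 = N + 2 := ⟨f.totalDegree - 1, by omega⟩
  rw [raySum, hN, Finset.sum_range_succ', Finset.sum_range_succ', Finset.sum_eq_zero]
  · simp only [zero_add, zero_mul, pow_zero, one_mul, pow_one, contract_one]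
    rw [add_comm]
  · intro i _
    rw [show i + 1 + 1 = i + 2 by rfl, pow_add, contract_mul, hD2, contract_zero_right, map_zero,
      mul_zero]

theorem totalDegree_contract_le (s : MvPowerSeries ι k) (p : MvPolynomial ι k) :
    (contract s p).totalDegree ≤ p.totalDegree := by
  classical
  refine MvPolynomial.totalDegree_finsetSum_le fun a ha => MvPolynomial.totalDegree_finsetSum_le
    fun u hu => (MvPolynomial.totalDegree_monomial_le _ _).trans ?_
  refine le_trans ?_ (MvPolynomial.le_totalDegree ha)
  rw [Finset.HasAntidiagonal.mem_antidiagonal] at hu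
  rw [← hu]
  change u.2.degree ≤ (u.1 + u.2).degree
  rw [map_add]
  exact Nat.le_add_left _ _

end RaySum

/-- A nonzero polynomial over a field can be contracted to `1`. -/
theorem exists_contract_eq_one {ι k : Type*} [Field k] {F : MvPolynomial ι k} (hF : F ≠ 0) :
    ∃ s : MvPowerSeries ι k, contract s F = 1 := by
  classical
  obtain ⟨a, ha, hmax⟩ := Finset.exists_max_image F.support (fun a => a.degree)
    (MvPolynomial.support_nonempty.2 hF)
  have hc := MvPolynomial.mem_support_iff.1 ha
  refine ⟨MvPowerSeries.monomial a (MvPolynomial.coeff a F)⁻¹, ?_⟩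
  have e := congrArg (contract (MvPowerSeries.monomial a (MvPolynomial.coeff a F)⁻¹)) F.as_sum
  rw [e, contract_sum_right, Finset.sum_eq_single a]
  · rw [contract_monomial_monomial, if_pos le_rfl, tsub_self, inv_mul_cancel₀ hc]
    rfl
  · intro b hb hba
    rw [contract_monomial_monomial, if_neg]
    intro hab
    obtain ⟨c, rfl⟩ := exists_add_of_le hab
    have := hmax _ hb
    simp only [map_add] at this
    have : c = 0 := (Finsupp.degree_eq_zero_iff c).1 (by omega)
    exact hba (by rw [this, add_zero])
  · exact fun h => absurd ha h

end

noncomputable section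

open Polynomial

/-! ### Polynomial annihilators of ray sums -/

section PolyAnn

variable {ι k : Type*}

/-- The annihilator of `f` in the polynomial ring, under contraction. -/
def polyAnn [CommRing k] (f : MvPolynomial ι k) : Ideal (MvPolynomial ι k) :=
  (apolarIdeal f).comap MvPolynomial.coeToMvPowerSeries.ringHom

theorem mem_polyAnn [CommRing k] {f p : MvPolynomial ι k} :
    p ∈ polyAnn f ↔ contract (p : MvPowerSeries ι k) f = 0 :=
  Iff.rfl

theorem ker_apolarPresentation [CommRing k] (f : MvPolynomial ι k) :
    RingHom.ker (apolarPresentation f) = polyAnn f := by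
  ext p
  rw [RingHom.mem_ker]
  exact Ideal.Quotient.eq_zero_iff_mem

theorem apolarPresentation_surjective [Finite ι] [CommRing k] (f : MvPolynomial ι k) :
    Function.Surjective (apolarPresentation f) := by
  intro x
  obtain ⟨s, rfl⟩ := Ideal.Quotient.mk_surjective x
  refine ⟨MvPowerSeries.truncTotal (f.totalDegree + 1) s, ?_⟩
  refine Ideal.Quotient.eq.2 ?_
  change contract (_ - _) f = 0
  rw [contract_sub_left, sub_eq_zero]
  exact contract_truncTotal s (Nat.lt_succ_self _)

theorem optionEquivLeft_rename_some [CommRing k] (a : MvPolynomial ι k) :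
    MvPolynomial.optionEquivLeft k ι (MvPolynomial.rename some a) = C a := by
  induction a using MvPolynomial.induction_on with
  | C r => rw [MvPolynomial.rename_C, MvPolynomial.optionEquivLeft_C]
  | add p q hp hq => rw [map_add, map_add, hp, hq, map_add]
  | mul_X p i hp =>
    rw [map_mul, map_mul, hp, MvPolynomial.rename_X, MvPolynomial.optionEquivLeft_X_some, map_mul]

/-- The coefficient of `Y ^ j` in a polynomial acts through contraction of the old variables and
lowering of the power of `Y`. -/
theorem contract_optionEquivLeft_symm [Finite ι] [CommRing k] (P : (MvPolynomial ι k)[X]) (j : ℕ)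
    (q : MvPolynomial ι k) :
    contract ((MvPolynomial.optionEquivLeft k ι).symm P : MvPowerSeries (Option ι) k)
      (MvPolynomial.X none ^ j * MvPolynomial.rename some q) =
    ∑ i ∈ Finset.range (j + 1), MvPolynomial.X none ^ (j - i) *
      MvPolynomial.rename some (contract (P.coeff i : MvPowerSeries ι k) q) := by
  induction P using Polynomial.induction_on' with
  | add P Q hP hQ =>
    simp only [map_add, MvPolynomial.coe_add, contract_add_left, hP, hQ, coeff_add, mul_add,
      Finset.sum_add_distrib]
  | monomial i a =>
    have hC : (MvPolynomial.optionEquivLeft k ι).symm (C a) = MvPolynomial.rename some a := by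
      rw [AlgEquiv.symm_apply_eq, optionEquivLeft_rename_some]
    rw [← C_mul_X_pow_eq_monomial, map_mul, map_pow, MvPolynomial.optionEquivLeft_symm_X, hC,
      MvPolynomial.coe_mul, MvPolynomial.coe_pow, MvPolynomial.coe_X, ← MvPowerSeries.rename_coe,
      contract_rename_some_mul_X_none_pow]
    have : ∀ l, (C a * X ^ i).coeff l = if l = i then a else 0 := fun l => by
      rw [coeff_C_mul, coeff_X_pow, mul_ite, mul_one, mul_zero]
    simp only [this]
    split_ifs with h
    · rw [Finset.sum_eq_single i]
      · rw [if_pos rfl]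
      · intro l _ hl
        rw [if_neg hl, MvPolynomial.coe_zero, contract_zero_left, map_zero, mul_zero]
      · intro hi
        exact absurd (Finset.mem_range.2 (Nat.lt_succ_of_le h)) hi
    · refine (Finset.sum_eq_zero fun l hl => ?_).symm
      rw [if_neg, MvPolynomial.coe_zero, contract_zero_left, map_zero, mul_zero]
      rintro rfl
      exact h (Nat.lt_succ_iff.1 (Finset.mem_range.1 hl))

theorem sum_X_none_pow_mul_rename_eq_zero_iff [CommRing k] {A : Finset ℕ}
    {c : ℕ → MvPolynomial ι k} :
    ∑ j ∈ A, MvPolynomial.X none ^ j * MvPolynomial.rename some (c j) = 0 ↔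
      ∀ j ∈ A, c j = 0 := by
  refine ⟨fun h j hj => ?_, fun h => Finset.sum_eq_zero fun j hj => by rw [h j hj]; simp⟩
  have := congrArg (fun p => (MvPolynomial.optionEquivLeft k ι p).coeff j) h
  simp only [map_sum, map_mul, map_pow, MvPolynomial.optionEquivLeft_X_none,
    optionEquivLeft_rename_some, finsetSum_coeff, mul_comm (X ^ _), coeff_C_mul, coeff_X_pow, map_zero, coeff_zero] at this
  rwa [Finset.sum_eq_single j (fun b _ hb => by rw [if_neg (Ne.symm hb), mul_zero])
    (fun hn => absurd hj hn), if_pos rfl, mul_one] at this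

/-- An ideal containing a monic polynomial `q` and determined by the coefficients of remainders
modulo `q` in the manner of a ray ideal is that ray ideal. -/
theorem eq_rayIdeal_of_forall {S : Type*} [CommRing S] {I K : Ideal S} {q : S[X]} {J : Ideal S[X]}
    (hq : q.Monic) (hd : 1 ≤ q.natDegree) (hIK : I ≤ K) (hK : ∀ κ ∈ K, κ * q.coeff 0 ∈ I)
    (hqJ : q ∈ J)
    (hJ : ∀ p : S[X], p.natDegree < q.natDegree →
      (p ∈ J ↔ p.coeff 0 ∈ I ∧ ∀ j, p.coeff (j + 1) ∈ K)) : J = rayIdeal I K q := by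
  ext p
  rw [mem_rayIdeal_iff hq hd hIK hK,
    ← hJ _ (natDegree_modByMonic_lt p hq fun h => by rw [h, natDegree_one] at hd; omega)]
  conv_lhs => rw [← modByMonic_add_div p q]
  exact Ideal.add_mem_iff_left _ (J.mul_mem_right _ hqJ)

variable [Field k]

theorem polyAnn_le_polyAnn_contract (f : MvPolynomial ι k) (D : MvPowerSeries ι k) :
    polyAnn f ≤ polyAnn (contract D f) := fun p hp => by
  rw [mem_polyAnn] at hp ⊢
  rw [contract_comm, hp, contract_zero_right]

theorem mul_mem_polyAnn_iff {f p D : MvPolynomial ι k} :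
    p * D ∈ polyAnn f ↔ p ∈ polyAnn (contract (D : MvPowerSeries ι k) f) := by
  rw [mem_polyAnn, mem_polyAnn, MvPolynomial.coe_mul, contract_mul]

variable [Finite ι]

/-- The annihilator of a ray sum with two terms is a ray ideal. -/
theorem map_polyAnn_raySum {f D : MvPolynomial ι k} {d : ℕ} (hd : 2 ≤ d)
    (hD2 : contract (D : MvPowerSeries ι k) (contract (D : MvPowerSeries ι k) f) = 0) :
    (polyAnn (MvPolynomial.rename some f + MvPolynomial.X none ^ d *
      MvPolynomial.rename some (contract (D : MvPowerSeries ι k) f))).map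
        (MvPolynomial.optionEquivLeft k ι : _ →+* _) =
      rayIdeal (polyAnn f) (polyAnn (contract (D : MvPowerSeries ι k) f)) (rayPoly d D) := by
  set F := contract (D : MvPowerSeries ι k) f with hF
  have hmem : ∀ P : (MvPolynomial ι k)[X], P ∈ (polyAnn (MvPolynomial.rename some f +
      MvPolynomial.X none ^ d * MvPolynomial.rename some F)).map
        (MvPolynomial.optionEquivLeft k ι : _ →+* _) ↔
      contract ((MvPolynomial.optionEquivLeft k ι).symm P : MvPowerSeries (Option ι) k)
        (MvPolynomial.X none ^ 0 * MvPolynomial.rename some f) +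
      contract ((MvPolynomial.optionEquivLeft k ι).symm P : MvPowerSeries (Option ι) k)
        (MvPolynomial.X none ^ d * MvPolynomial.rename some F) = 0 := by
    intro P
    rw [← contract_add_right, pow_zero, one_mul, ← mem_polyAnn]
    exact Ideal.mem_map_of_equiv (MvPolynomial.optionEquivLeft k ι) P |>.trans
      ⟨by rintro ⟨x, hx, rfl⟩; simpa using hx, fun h => ⟨_, h, by simp⟩⟩
  have hcomp : ∀ κ ∈ polyAnn F, κ * (rayPoly d D).coeff 0 ∈ polyAnn f := by
    intro κ hκ
    rw [coeff_rayPoly_zero (by omega), mul_neg, neg_mem_iff]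
    exact mul_mem_polyAnn_iff.2 hκ
  refine eq_rayIdeal_of_forall (rayPoly_monic (by omega) D)
    (by rw [natDegree_rayPoly]; omega) (polyAnn_le_polyAnn_contract f _) hcomp ?_ ?_
  · rw [hmem, contract_optionEquivLeft_symm, contract_optionEquivLeft_symm,
      Finset.sum_range_one, Finset.sum_eq_add_of_mem 0 d (by simp) (by simp) (by omega)]
    · rw [coeff_rayPoly_zero (by omega), rayPoly, coeff_sub, coeff_X_pow_self, coeff_C_of_ne_zero
        (by omega), sub_zero, MvPolynomial.coe_one, _root_.contract_one]
      have : ((0 - D : MvPolynomial ι k) : MvPowerSeries ι k) = 0 - (D : MvPowerSeries ι k) :=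
        map_sub MvPolynomial.coeToMvPowerSeries.ringHom 0 D
      rw [← zero_sub, this, contract_sub_left, contract_sub_left, hD2, ← hF]
      simp [contract_zero_left]
    · intro c _ hc
      rw [rayPoly, coeff_sub, coeff_X_pow, if_neg hc.2, coeff_C_of_ne_zero hc.1, sub_zero,
        MvPolynomial.coe_zero, contract_zero_left, map_zero, mul_zero]
  · intro P hP
    rw [natDegree_rayPoly] at hP
    rw [hmem, contract_optionEquivLeft_symm, contract_optionEquivLeft_symm,
      Finset.sum_range_one, Finset.sum_range_succ, coeff_eq_zero_of_natDegree_lt hP,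
      MvPolynomial.coe_zero, contract_zero_left, map_zero, mul_zero, add_zero,
      ← Finset.sum_range_reflect]
    have e : ∀ j ∈ Finset.range d, (MvPolynomial.X none : MvPolynomial (Option ι) k) ^
        (d - (d - 1 - j)) * MvPolynomial.rename some
          (contract (P.coeff (d - 1 - j) : MvPowerSeries ι k) F) =
        MvPolynomial.X none ^ (j + 1) * MvPolynomial.rename some
          (contract (P.coeff (d - (j + 1)) : MvPowerSeries ι k) F) := by
      intro j hj
      rw [Finset.mem_range] at hj
      rw [show d - (d - 1 - j) = j + 1 by omega, show d - 1 - j = d - (j + 1) by omega]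
    rw [Finset.sum_congr rfl e]
    have e2 := Finset.sum_range_succ' (fun j => (MvPolynomial.X none : MvPolynomial (Option ι) k) ^ j
      * MvPolynomial.rename some (if j = 0 then contract (P.coeff 0 : MvPowerSeries ι k) f
        else contract (P.coeff (d - j) : MvPowerSeries ι k) F)) d
    simp only [Nat.succ_ne_zero, if_false, if_true] at e2
    rw [Nat.sub_zero, add_comm, ← e2, sum_X_none_pow_mul_rename_eq_zero_iff]
    constructor
    · intro h
      refine ⟨mem_polyAnn.2 (by simpa using h 0 (by simp)), fun j => ?_⟩
      by_cases hj : j + 1 < d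
      · have := h (d - (j + 1)) (by simp)
        rwa [if_neg (by omega), show d - (d - (j + 1)) = j + 1 by omega] at this
      · rw [coeff_eq_zero_of_natDegree_lt (by omega)]
        exact zero_mem _
    · rintro ⟨h0, h1⟩ j -
      split_ifs with hj
      · exact h0
      · by_cases hjd : d - j = 0
        · rw [hjd]
          exact polyAnn_le_polyAnn_contract f _ h0
        · obtain ⟨l, hl⟩ := Nat.exists_eq_succ_of_ne_zero hjd
          rw [hl]
          exact h1 l

/-- The annihilator of the power `Y ^ (d - 1)`, described through a polynomial `X ^ d - D` in it. -/
theorem map_polyAnn_X_none_pow {D : MvPolynomial ι k} {d : ℕ} (hd : 2 ≤ d)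
    (hD : D ∈ polyAnn (1 : MvPolynomial ι k)) :
    (polyAnn (MvPolynomial.X none ^ (d - 1) : MvPolynomial (Option ι) k)).map
        (MvPolynomial.optionEquivLeft k ι : _ →+* _) =
      rayIdeal (polyAnn 1) (polyAnn 1) (rayPoly d D) := by
  have hmem : ∀ P : (MvPolynomial ι k)[X],
      P ∈ (polyAnn (MvPolynomial.X none ^ (d - 1) : MvPolynomial (Option ι) k)).map
        (MvPolynomial.optionEquivLeft k ι : _ →+* _) ↔
      ∀ j < d, P.coeff j ∈ polyAnn (1 : MvPolynomial ι k) := by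
    intro P
    have h1 : P ∈ (polyAnn (MvPolynomial.X none ^ (d - 1) : MvPolynomial (Option ι) k)).map
        (MvPolynomial.optionEquivLeft k ι : _ →+* _) ↔
        (MvPolynomial.optionEquivLeft k ι).symm P ∈
          polyAnn (MvPolynomial.X none ^ (d - 1) : MvPolynomial (Option ι) k) :=
      Ideal.mem_map_of_equiv (MvPolynomial.optionEquivLeft k ι) P |>.trans
        ⟨by rintro ⟨x, hx, rfl⟩; simpa using hx, fun h => ⟨_, h, by simp⟩⟩
    have h2 := contract_optionEquivLeft_symm P (d - 1) (1 : MvPolynomial ι k)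
    rw [map_one, mul_one, show d - 1 + 1 = d by omega, ← Finset.sum_range_reflect] at h2
    have e : ∀ j ∈ Finset.range d, (MvPolynomial.X none : MvPolynomial (Option ι) k) ^
        (d - 1 - (d - 1 - j)) * MvPolynomial.rename some
          (contract (P.coeff (d - 1 - j) : MvPowerSeries ι k) 1) =
        MvPolynomial.X none ^ j * MvPolynomial.rename some
          (contract (P.coeff (d - 1 - j) : MvPowerSeries ι k) 1) := by
      intro j hj
      rw [Finset.mem_range] at hj
      rw [show d - 1 - (d - 1 - j) = j by omega]
    rw [Finset.sum_congr rfl e] at h2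
    rw [h1, mem_polyAnn, h2, sum_X_none_pow_mul_rename_eq_zero_iff]
    constructor
    · intro h j hj
      have := h (d - 1 - j) (by simp; omega)
      rwa [show d - 1 - (d - 1 - j) = j by omega] at this
    · intro h j hj
      exact h _ (by omega)
  refine eq_rayIdeal_of_forall (rayPoly_monic (by omega) D)
    (by rw [natDegree_rayPoly]; omega) le_rfl (fun κ hκ => Ideal.mul_mem_right _ _ hκ) ?_ ?_
  · rw [hmem]
    intro j hj
    rw [rayPoly, coeff_sub, coeff_X_pow, if_neg (by omega), zero_sub, neg_mem_iff, coeff_C]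
    split_ifs
    · exact hD
    · exact zero_mem _
  · intro P hP
    rw [natDegree_rayPoly] at hP
    rw [hmem]
    constructor
    · intro h
      refine ⟨h 0 (by omega), fun j => ?_⟩
      by_cases hj : j + 1 < d
      · exact h _ hj
      · rw [coeff_eq_zero_of_natDegree_lt (by omega)]
        exact zero_mem _
    · rintro ⟨h0, h1⟩ (_ | j) -
      · exact h0
      · exact h1 j

end PolyAnn

theorem map_rayIdeal {S T : Type*} [CommRing S] [CommRing T] (φ : S →+* T) (I K : Ideal S)
    (q : S[X]) : (rayIdeal I K q).map (mapRingHom φ) =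
      rayIdeal (I.map φ) (K.map φ) (q.map φ) := by
  have hC : ∀ L : Ideal S, (L.map (C : S →+* S[X])).map (mapRingHom φ) = (L.map φ).map C := by
    intro L
    rw [Ideal.map_map, Ideal.map_map, mapRingHom_comp_C]
  rw [rayIdeal, rayIdeal, Ideal.map_sup, Ideal.map_sup, Ideal.map_mul, hC, hC, Ideal.map_span,
    Ideal.map_span, Set.image_singleton, Set.image_singleton, coe_mapRingHom, map_X]


end

noncomputable section

/-! ### Regular sequences and free conormal modules -/

section Syzygies

variable {R : Type*} [CommRing R]

theorem Ideal.sub_mem_iff_left (I : Ideal R) {a b : R} (hb : b ∈ I) : a - b ∈ I ↔ a ∈ I := by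
  rw [sub_eq_add_neg]
  exact I.add_mem_iff_left (neg_mem hb)

theorem Ideal.sub_mem_iff_right (I : Ideal R) {a b : R} (ha : a ∈ I) : a - b ∈ I ↔ b ∈ I := by
  rw [sub_eq_add_neg, I.add_mem_iff_right ha, neg_mem_iff]

theorem span_image_Iio (i : ℕ → R) (l : ℕ) :
    Ideal.span (i '' Set.Iio l) = Ideal.span (Set.range fun b : Fin l => i b) := by
  congr 1
  ext x
  constructor
  · rintro ⟨a, ha, rfl⟩; exact ⟨⟨a, ha⟩, rfl⟩
  · rintro ⟨a, rfl⟩; exact ⟨a, a.2, rfl⟩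

/-- The coefficients of a relation between the members of a weakly regular sequence lie in the
ideal the sequence generates. -/
theorem mem_span_of_sum_mul_eq_zero {i : ℕ → R} {l : ℕ}
    (h : ∀ j < l, ∀ x, x * i j ∈ Ideal.span (i '' Set.Iio j) → x ∈ Ideal.span (i '' Set.Iio j))
    {r : ℕ → R} (hr : ∑ b ∈ Finset.range l, r b * i b = 0) :
    ∀ b < l, r b ∈ Ideal.span (i '' Set.Iio l) := by
  induction l generalizing r with
  | zero => intro b hb; omega
  | succ l ih =>
    have hmono : Ideal.span (i '' Set.Iio l) ≤ Ideal.span (i '' Set.Iio (l + 1)) :=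
      Ideal.span_mono (Set.image_mono (Set.Iio_subset_Iio (Nat.le_succ l)))
    rw [Finset.sum_range_succ] at hr
    have h1 : r l * i l ∈ Ideal.span (i '' Set.Iio l) := by
      rw [eq_neg_of_add_eq_zero_right hr, neg_mem_iff]
      exact sum_mem fun b hb => Ideal.mul_mem_left _ _
        (Ideal.subset_span ⟨b, Finset.mem_range.1 hb, rfl⟩)
    have h2 := h l (Nat.lt_succ_self l) _ h1
    have h3 : ∃ c : ℕ → R, r l = ∑ b ∈ Finset.range l, c b * i b := by
      rw [span_image_Iio] at h2
      obtain ⟨c, hc⟩ := Ideal.mem_span_range_iff_exists_fun.1 h2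
      refine ⟨fun j => if hj : j < l then c ⟨j, hj⟩ else 0, ?_⟩
      rw [← hc, Finset.sum_range]
      simp
    obtain ⟨c, hc⟩ := h3
    have h4 := ih (fun j hj => h j (hj.trans (Nat.lt_succ_self l)))
      (r := fun b => r b + c b * i l) (by
        rw [← hr, hc, Finset.sum_mul, ← Finset.sum_add_distrib]
        exact Finset.sum_congr rfl fun b _ => by ring)
    intro b hb
    rcases Nat.lt_succ_iff_lt_or_eq.1 hb with hb | rfl
    · have h5 := hmono (h4 b hb)
      have h6 : i l ∈ Ideal.span (i '' Set.Iio (l + 1)) :=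
        Ideal.subset_span ⟨l, Nat.lt_succ_self l, rfl⟩
      exact (Ideal.add_mem_iff_left _ (Ideal.mul_mem_left _ (c b) h6)).1 h5
    · exact hmono h2

open RingTheory.Sequence in
theorem isFreeConormal_of_isWeaklyRegular {rs : List R} (h : IsWeaklyRegular R rs) :
    IsFreeConormal (Ideal.ofList rs) rs.length := by
  set i : ℕ → R := fun j => rs.getD j 0 with hi
  have htake : ∀ j ≤ rs.length, Ideal.ofList (rs.take j) = Ideal.span (i '' Set.Iio j) := by
    intro j hj
    rw [Ideal.ofList]
    congr 1
    ext x
    simp only [Set.mem_image, Set.mem_Iio, Set.mem_ofPred_eq, List.mem_take_iff_getElem]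
    constructor
    · rintro ⟨a, ha, rfl⟩
      exact ⟨a, by omega, by simp [hi, List.getElem?_eq_getElem (show a < rs.length by omega)]⟩
    · rintro ⟨a, ha, rfl⟩
      exact ⟨a, by omega, by simp [hi, List.getElem?_eq_getElem (show a < rs.length by omega)]⟩
  have hall : Ideal.ofList rs = Ideal.span (i '' Set.Iio rs.length) := by
    rw [← htake _ le_rfl, List.take_length]
  have hreg : ∀ j < rs.length, ∀ x, x * i j ∈ Ideal.span (i '' Set.Iio j) →
      x ∈ Ideal.span (i '' Set.Iio j) := by
    intro j hj x hx
    have h1 := h.regular_mod_prev j hj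
    rw [smul_eq_mul, Ideal.mul_top, htake j hj.le] at h1
    have h2 : i j = rs[j] := by simp [hi, List.getElem?_eq_getElem hj]
    rw [← Ideal.Quotient.eq_zero_iff_mem] at hx ⊢
    refine h1.right_eq_zero_of_smul ?_
    rw [← hx, ← h2, mul_comm]
    rfl
  have hspan : Ideal.ofList rs = Ideal.span (Set.range fun b : Fin rs.length => i b) := by
    rw [hall, span_image_Iio]
  have hgen : ∀ x ∈ Ideal.ofList rs, ∃ r : Fin rs.length → R, ∑ b, r b * i b = x := by
    intro x hx
    rw [hspan] at hx
    exact Ideal.mem_span_range_iff_exists_fun.1 hx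
  refine ⟨fun b => i b, fun b => ?_, fun x hx => ?_, fun r hr b => ?_⟩
  · rw [hspan]
    exact Ideal.subset_span ⟨b, rfl⟩
  · obtain ⟨r, hr⟩ := hgen x hx
    exact ⟨r, by rw [hr, sub_self]; exact zero_mem _⟩
  · have hr' : ∑ b, r b * i b ∈ Ideal.ofList rs • Ideal.span (Set.range fun b : Fin rs.length => i b) := by
      rwa [← hspan]
    obtain ⟨s, hs, hs'⟩ := (Submodule.mem_ideal_smul_span_iff_exists_sum _ _ _).1 hr'
    rw [Finsupp.sum_fintype _ _ (by simp)] at hs'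
    have h0 : ∑ j ∈ Finset.range rs.length,
        (if hj : j < rs.length then r ⟨j, hj⟩ - s ⟨j, hj⟩ else 0) * i j = 0 := by
      rw [Finset.sum_range]
      simp only [Fin.is_lt, dite_true, Fin.eta, sub_mul, Finset.sum_sub_distrib]
      rw [sub_eq_zero, ← hs']
      rfl
    have h1 := mem_span_of_sum_mul_eq_zero hreg h0 b b.2
    rw [← hall, dif_pos b.2] at h1
    exact (Ideal.sub_mem_iff_left _ (hs b)).1 h1

end Syzygies

end

noncomputable section

/-! ### Power series of large order -/

theorem MvPolynomial.coe_sub {ι k : Type*} [CommRing k] (p q : MvPolynomial ι k) :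
    ((p - q : MvPolynomial ι k) : MvPowerSeries ι k) = p - q :=
  MvPowerSeries.ext fun b => by simp

theorem MvPolynomial.coe_finsetSum {ι k κ : Type*} [CommSemiring k] (A : Finset κ)
    (p : κ → MvPolynomial ι k) :
    ((∑ j ∈ A, p j : MvPolynomial ι k) : MvPowerSeries ι k) = ∑ j ∈ A, (p j : MvPowerSeries ι k) :=
  MvPowerSeries.ext fun b => by simp [MvPolynomial.coeff_sum]

section Order

variable {ι k : Type*}

/-- The ideal of power series with no terms of degree less than `N`. -/
def orderIdeal (ι k : Type*) [CommRing k] (N : ℕ) : Ideal (MvPowerSeries ι k) where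
  carrier := {s | (N : ℕ∞) ≤ s.order}
  zero_mem' := by simp
  add_mem' hs ht := (le_min hs ht).trans MvPowerSeries.min_order_le_add
  smul_mem' c s hs := by
    change (N : ℕ∞) ≤ (c * s).order
    exact le_trans (le_trans hs (le_add_self)) MvPowerSeries.le_order_mul

variable [CommRing k]

theorem mem_orderIdeal {N : ℕ} {s : MvPowerSeries ι k} :
    s ∈ orderIdeal ι k N ↔ ∀ b : ι →₀ ℕ, b.degree < N → MvPowerSeries.coeff b s = 0 :=
  ⟨fun h _ hb => MvPowerSeries.coeff_of_lt_order (lt_of_lt_of_le (by exact_mod_cast hb) h),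
    fun h => MvPowerSeries.nat_le_order h⟩

/-- A power series of order at least `A + B` is a combination of monomials of degree `A`, with
coefficients of order at least `B`. -/
theorem orderIdeal_add_le [Finite ι] (A B : ℕ) : orderIdeal ι k (A + B) ≤
    Ideal.span ((fun a : ι →₀ ℕ => MvPowerSeries.monomial a (1 : k)) '' {a | a.degree = A}) *
      orderIdeal ι k B := by
  classical
  intro s hs
  have hex : ∀ e : ι →₀ ℕ, ∃ a : ι →₀ ℕ, a ≤ e ∧ (A ≤ e.degree → a.degree = A) := by
    intro e
    by_cases he : A ≤ e.degree
    · obtain ⟨a, ha, h⟩ := Finsupp.exists_le_degree_eq e A he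
      exact ⟨a, ha, fun _ => h⟩
    · exact ⟨0, zero_le, fun h => absurd h he⟩
  choose c hc hcA using hex
  have hfin : {a : ι →₀ ℕ | a.degree = A}.Finite := Finsupp.finite_of_degree_eq A
  let t : (ι →₀ ℕ) → MvPowerSeries ι k := fun a e =>
    if c (e + a) = a then MvPowerSeries.coeff (e + a) s else 0
  have hsum : s = ∑ a ∈ hfin.toFinset, MvPowerSeries.monomial a (1 : k) * t a := by
    ext e
    rw [map_sum]
    simp only [MvPowerSeries.coeff_monomial_mul, one_mul]
    by_cases he : A ≤ e.degree
    · rw [Finset.sum_eq_single (c e)]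
      · rw [if_pos (hc e)]
        change _ = if _ then _ else _
        rw [tsub_add_cancel_of_le (hc e), if_pos rfl]
      · intro a _ ha
        split_ifs with h
        · change (if _ then _ else _) = _
          rw [tsub_add_cancel_of_le h, if_neg ha.symm]
        · rfl
      · intro h
        exact absurd (hfin.mem_toFinset.2 (hcA e he)) h
    · rw [mem_orderIdeal.1 hs e (by omega), Finset.sum_eq_zero]
      intro a ha
      have ha' : a.degree = A := hfin.mem_toFinset.1 ha
      rw [if_neg]
      intro h
      exact he (ha' ▸ Finsupp.degree_mono h)
  rw [hsum]
  refine sum_mem fun a ha => Ideal.mul_mem_mul (Ideal.subset_span ⟨a, hfin.mem_toFinset.1 ha, rfl⟩)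
    (mem_orderIdeal.2 fun e he => ?_)
  have ha' : a.degree = A := hfin.mem_toFinset.1 ha
  change (if _ then _ else _) = _
  split_ifs
  · exact mem_orderIdeal.1 hs _ (by rw [map_add]; omega)
  · rfl

theorem span_monomial_le_orderIdeal (A : ℕ) :
    Ideal.span ((fun a : ι →₀ ℕ => MvPowerSeries.monomial a (1 : k)) '' {a | a.degree = A}) ≤
      orderIdeal ι k A := by
  classical
  rw [Ideal.span_le]
  rintro _ ⟨a, ha, rfl⟩
  refine mem_orderIdeal.2 fun b hb => ?_
  rw [MvPowerSeries.coeff_monomial, if_neg]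
  rintro rfl
  exact absurd ha hb.ne

theorem orderIdeal_one_eq_span [Finite ι] :
    orderIdeal ι k 1 = Ideal.span (Set.range (MvPowerSeries.X : ι → MvPowerSeries ι k)) := by
  have : (fun a : ι →₀ ℕ => MvPowerSeries.monomial a (1 : k)) '' {a | a.degree = 1} =
      Set.range (MvPowerSeries.X : ι → MvPowerSeries ι k) := by
    ext x
    constructor
    · rintro ⟨a, ha, rfl⟩
      obtain ⟨i, rfl⟩ := (Finsupp.sum_eq_one_iff a).1 ha
      exact ⟨i, rfl⟩
    · rintro ⟨i, rfl⟩
      exact ⟨Finsupp.single i 1, by simp, rfl⟩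
  rw [← this]
  exact le_antisymm ((orderIdeal_add_le 1 0).trans Ideal.mul_le_left)
    (span_monomial_le_orderIdeal 1)

theorem orderIdeal_le_apolarIdeal (f : MvPolynomial ι k) {N : ℕ} (hN : f.totalDegree < N) :
    orderIdeal ι k N ≤ apolarIdeal f := fun _ hs =>
  contract_eq_zero_of_coeff_eq_zero fun b hb => mem_orderIdeal.1 hs b (hb.trans_lt hN)

theorem orderIdeal_le_apolarIdeal_mul_self [Finite ι] (f : MvPolynomial ι k) {N : ℕ}
    (hN : f.totalDegree < N) : orderIdeal ι k (N + N) ≤ apolarIdeal f * apolarIdeal f :=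
  (orderIdeal_add_le N N).trans (Ideal.mul_mono
    ((span_monomial_le_orderIdeal N).trans (orderIdeal_le_apolarIdeal f hN))
    (orderIdeal_le_apolarIdeal f hN))

theorem truncTotal_sub_mem_orderIdeal [Finite ι] (N : ℕ) (s : MvPowerSeries ι k) :
    (MvPowerSeries.truncTotal N s : MvPowerSeries ι k) - s ∈ orderIdeal ι k N :=
  mem_orderIdeal.2 fun b hb => by
    rw [map_sub, MvPolynomial.coeff_coe, MvPowerSeries.coeff_truncTotal _ hb, sub_self]

end Order

/-! ### Annihilators in the polynomial ring -/

section Transfer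

variable {ι k : Type*} [CommRing k]

theorem idealOfVars_pow_le_polyAnn (f : MvPolynomial ι k) {N : ℕ} (hN : f.totalDegree < N) :
    MvPolynomial.idealOfVars ι k ^ N ≤ polyAnn f := fun p hp =>
  orderIdeal_le_apolarIdeal f hN (mem_orderIdeal.2 fun b hb =>
    (MvPolynomial.coeff_coe p b).trans ((MvPolynomial.mem_pow_idealOfVars_iff' N p).1 hp b hb))

variable [Finite ι]

theorem coe_mem_apolarIdeal_mul_self_iff {f p : MvPolynomial ι k} :
    (p : MvPowerSeries ι k) ∈ apolarIdeal f * apolarIdeal f ↔ p ∈ polyAnn f * polyAnn f := by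
  constructor
  · intro hp
    set N := f.totalDegree + 1
    set τ : MvPowerSeries ι k → MvPolynomial ι k := fun s => MvPowerSeries.truncTotal (N + N) s
    have hτ : ∀ s : MvPowerSeries ι k, (τ s : MvPowerSeries ι k) - s ∈ orderIdeal ι k (N + N) :=
      fun s => truncTotal_sub_mem_orderIdeal _ s
    have hle : orderIdeal ι k (N + N) ≤ apolarIdeal f :=
      orderIdeal_le_apolarIdeal f (by omega)
    have key : ∀ s ∈ apolarIdeal f * apolarIdeal f, ∃ q ∈ polyAnn f * polyAnn f,
        (q : MvPowerSeries ι k) - s ∈ orderIdeal ι k (N + N) := by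
      intro s hs
      refine Submodule.mul_induction_on hs (fun a ha b hb => ?_) ?_
      · refine ⟨τ a * τ b, Ideal.mul_mem_mul ?_ ?_, ?_⟩
        · exact (Ideal.sub_mem_iff_left _ ha).1 (hle (hτ a))
        · exact (Ideal.sub_mem_iff_left _ hb).1 (hle (hτ b))
        · have := add_mem (Ideal.mul_mem_right (τ b : MvPowerSeries ι k) _ (hτ a))
            (Ideal.mul_mem_left _ a (hτ b))
          convert this using 1
          rw [MvPolynomial.coe_mul]
          ring
      · rintro a b ⟨q, hq, hqa⟩ ⟨q', hq', hqb⟩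
        refine ⟨q + q', add_mem hq hq', ?_⟩
        convert add_mem hqa hqb using 1
        rw [MvPolynomial.coe_add]
        ring
    obtain ⟨q, hq, hqp⟩ := key _ hp
    have h1 : q - p ∈ MvPolynomial.idealOfVars ι k ^ (N + N) := by
      refine (MvPolynomial.mem_pow_idealOfVars_iff' _ _).2 fun b hb => ?_
      have := mem_orderIdeal.1 hqp b hb
      rwa [map_sub, MvPolynomial.coeff_coe, MvPolynomial.coeff_coe, ← MvPolynomial.coeff_sub]
        at this
    have h2 : q - p ∈ polyAnn f * polyAnn f := by
      rw [pow_add] at h1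
      have hN := idealOfVars_pow_le_polyAnn f (Nat.lt_succ_self f.totalDegree)
      exact Ideal.mul_mono hN hN h1
    exact (Ideal.sub_mem_iff_right _ hq).1 h2
  · intro hp
    have := Ideal.mem_map_of_mem MvPolynomial.coeToMvPowerSeries.ringHom hp
    rw [Ideal.map_mul] at this
    exact Ideal.mul_mono Ideal.map_comap_le Ideal.map_comap_le this

theorem IsFreeConormal.polyAnn {f : MvPolynomial ι k} {n : ℕ}
    (h : IsFreeConormal (apolarIdeal f) n) : IsFreeConormal (polyAnn f) n := by
  obtain ⟨i, hi, hgen, hfree⟩ := h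
  set N := f.totalDegree + 1
  set τ : MvPowerSeries ι k → MvPolynomial ι k := fun s => MvPowerSeries.truncTotal (N + N) s
  have hτ : ∀ s : MvPowerSeries ι k, (τ s : MvPowerSeries ι k) - s ∈
      apolarIdeal f * apolarIdeal f := fun s =>
    orderIdeal_le_apolarIdeal_mul_self f (Nat.lt_succ_self _) (truncTotal_sub_mem_orderIdeal _ s)
  have hsum : ∀ r : Fin n → MvPolynomial ι k, ∀ s : Fin n → MvPowerSeries ι k,
      (∀ b, (r b : MvPowerSeries ι k) - s b ∈ apolarIdeal f) →
      ((∑ b, r b * τ (i b) : MvPolynomial ι k) : MvPowerSeries ι k) - ∑ b, s b * i b ∈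
        apolarIdeal f * apolarIdeal f := by
    intro r s hrs
    have : ((∑ b, r b * τ (i b) : MvPolynomial ι k) : MvPowerSeries ι k) =
        ∑ b, (r b : MvPowerSeries ι k) * τ (i b) := by
      rw [MvPolynomial.coe_finsetSum]
      simp only [MvPolynomial.coe_mul]
    rw [this, ← Finset.sum_sub_distrib]
    refine sum_mem fun b _ => ?_
    convert add_mem (Ideal.mul_mem_left _ (r b : MvPowerSeries ι k) (hτ (i b)))
      (Ideal.mul_mem_mul (hrs b) (hi b)) using 1
    ring
  refine ⟨fun b => τ (i b), fun b => ?_, fun x hx => ?_, fun r hr b => ?_⟩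
  · exact (Ideal.sub_mem_iff_left _ (hi b)).1 (Ideal.mul_le_left (hτ (i b)))
  · obtain ⟨r, hr⟩ := hgen x hx
    refine ⟨fun b => τ (r b), coe_mem_apolarIdeal_mul_self_iff.1 ?_⟩
    have h1 := hsum (fun b => τ (r b)) r (fun b => Ideal.mul_le_left (hτ (r b)))
    have h2 := sub_mem hr h1
    rw [MvPolynomial.coe_sub]
    convert h2 using 1
    ring
  · have h1 := hsum r (fun b => r b) (fun b => by rw [sub_self]; exact zero_mem _)
    exact hfree (fun b => r b)
      ((Ideal.sub_mem_iff_right _ (coe_mem_apolarIdeal_mul_self_iff.2 hr)).1 h1) b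

end Transfer

end

noncomputable section

/-! ### Complete intersections of dimension zero -/

section Krull

variable (k : Type*) [Field k]

theorem natCast_le_ringKrullDim_mvPowerSeries (n : ℕ) :
    (n : WithBot ℕ∞) ≤ ringKrullDim (MvPowerSeries (Fin n) k) := by
  induction n with
  | zero => exact_mod_cast ringKrullDim_nonneg_of_nontrivial
  | succ n ih =>
    rw [ringKrullDim_eq_of_ringEquiv (MvPowerSeries.finSuccEquiv k n).toRingEquiv]
    refine le_trans ?_ ringKrullDim_succ_le_ringKrullDim_powerseries
    push_cast
    gcongr

theorem orderIdeal_one_isMaximal (ι : Type*) : (orderIdeal ι k 1).IsMaximal := by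
  have : orderIdeal ι k 1 = RingHom.ker (MvPowerSeries.constantCoeff (σ := ι) (R := k)) := by
    ext s
    rw [mem_orderIdeal, RingHom.mem_ker]
    refine ⟨fun h => h 0 (by simp), fun h b hb => ?_⟩
    rw [(Finsupp.degree_eq_zero_iff b).1 (by omega)]
    exact h
  rw [this]
  exact RingHom.ker_isMaximal_of_surjective _ fun c => ⟨MvPowerSeries.C c, by simp⟩

theorem ringKrullDim_mvPowerSeries (n : ℕ) : ringKrullDim (MvPowerSeries (Fin n) k) = n := by
  refine le_antisymm ?_ (natCast_le_ringKrullDim_mvPowerSeries k n)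
  have hmax := orderIdeal_one_isMaximal k (Fin n)
  have h := ringKrullDim_le_ringKrullDim_quotient_add_spanFinrank (orderIdeal (Fin n) k 1)
    (by
      rw [IsLocalRing.ringJacobson_eq_maximalIdeal]
      exact IsLocalRing.le_maximalIdeal hmax.ne_top)
  rw [ringKrullDim_eq_zero_of_isField
    ((Ideal.Quotient.maximal_ideal_iff_isField_quotient _).1 hmax), zero_add] at h
  refine h.trans ?_
  rw [orderIdeal_one_eq_span]
  have h1 := Submodule.spanFinrank_span_le_encard (R := MvPowerSeries (Fin n) k)
    (Set.range (MvPowerSeries.X : Fin n → MvPowerSeries (Fin n) k))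
  have h2 : (Set.range (MvPowerSeries.X : Fin n → MvPowerSeries (Fin n) k)).encard ≤ n := by
    rw [← Set.image_univ]
    refine (Set.encard_image_le _ _).trans ?_
    simp
  exact_mod_cast h1.trans h2

theorem finite_quotient_idealOfVars_pow (ι : Type*) [Finite ι] (N : ℕ) :
    Module.Finite k (MvPolynomial ι k ⧸ MvPolynomial.idealOfVars ι k ^ N) := by
  have hfin : {b : ι →₀ ℕ | b.degree < N}.Finite :=
    (Finsupp.finite_of_degree_le N).subset fun b hb => le_of_lt (show b.degree < N from hb)
  have := hfin.to_subtype
  let φ : MvPolynomial ι k →ₗ[k] ({b : ι →₀ ℕ | b.degree < N} → k) :=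
    LinearMap.pi fun b => MvPolynomial.lcoeff k b.1
  refine Module.Finite.equiv (quotientLinearEquivOfSurjective _ φ.rangeRestrict
    φ.surjective_rangeRestrict fun p => ?_).symm
  rw [MvPolynomial.mem_pow_idealOfVars_iff', ← LinearMap.mem_ker, LinearMap.ker_rangeRestrict]
  exact ⟨fun h b hb => congrFun h ⟨b, hb⟩, fun h => funext fun b => h b.1 b.2⟩

end Krull

section

variable {k : Type*} [Field k]

theorem finite_quotient_polyAnn {ι : Type*} [Finite ι] (f : MvPolynomial ι k) :
    Module.Finite k (MvPolynomial ι k ⧸ polyAnn f) := by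
  have := finite_quotient_idealOfVars_pow k ι (f.totalDegree + 1)
  exact finite_quotient_of_le (idealOfVars_pow_le_polyAnn f (Nat.lt_succ_self _))

theorem finite_quotient_polyAnn_mul_self {ι : Type*} [Finite ι] (f : MvPolynomial ι k) :
    Module.Finite k (MvPolynomial ι k ⧸ polyAnn f * polyAnn f) := by
  have := finite_quotient_idealOfVars_pow k ι (f.totalDegree + 1 + (f.totalDegree + 1))
  have hN := idealOfVars_pow_le_polyAnn f (Nat.lt_succ_self f.totalDegree)
  exact finite_quotient_of_le ((pow_add _ _ _).trans_le (Ideal.mul_mono hN hN))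

theorem finite_apolar {ι : Type*} [Finite ι] (f : MvPolynomial ι k) :
    Module.Finite k (Apolar f) := by
  have := finite_quotient_polyAnn f
  let φ : (MvPolynomial ι k ⧸ polyAnn f) →ₐ[k] Apolar f :=
    Ideal.Quotient.liftₐ _ (apolarPresentation f) fun p hp => Ideal.Quotient.eq_zero_iff_mem.2 hp
  refine Module.Finite.of_surjective φ.toLinearMap fun x => ?_
  obtain ⟨p, rfl⟩ := apolarPresentation_surjective f x
  exact ⟨Ideal.Quotient.mk _ p, rfl⟩

/-- The apolar ideal of `f` has finite colength, so a regular sequence generating it has the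
length of the dimension of the power series ring. -/
theorem IsCompleteIntersection.isFreeConormal {n : ℕ} {f : MvPolynomial (Fin n) k}
    (h : IsCompleteIntersection (apolarIdeal f)) : IsFreeConormal (polyAnn f) n := by
  obtain ⟨rs, hrs, hI⟩ := h
  have hfin := finite_apolar f
  have hart : IsArtinianRing (Apolar f) := IsArtinianRing.of_finite k _
  have hnt : Nontrivial (Apolar f) := by
    refine Ideal.Quotient.nontrivial_iff.2 fun htop => hrs.top_ne_smul ?_
    rw [hI, htop, Ideal.smul_top_eq_map]
    simp
  have hdim : ringKrullDim (Apolar f) = 0 := ringKrullDimZero_iff_ringKrullDim_eq_zero.1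
    (isArtinianRing_iff_isNoetherianRing_krullDimLE_zero.1 hart).2
  have hlen := ringKrullDim_add_length_eq_ringKrullDim_of_isRegular rs hrs
  rw [hI, hdim, zero_add, ringKrullDim_mvPowerSeries] at hlen
  have hlen' : rs.length = n := by exact_mod_cast hlen
  have := isFreeConormal_of_isWeaklyRegular hrs.toIsWeaklyRegular
  rw [hlen', hI] at this
  exact this.polyAnn

theorem mem_polyAnn_one {ι : Type*} {p : MvPolynomial ι k} :
    p ∈ polyAnn (1 : MvPolynomial ι k) ↔ MvPolynomial.constantCoeff p = 0 := by
  rw [mem_polyAnn, contract_apply_one, MvPolynomial.C_eq_zero]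
  simp [← MvPowerSeries.coeff_zero_eq_constantCoeff_apply, MvPolynomial.constantCoeff_eq]

theorem polyAnn_one (ι : Type*) : polyAnn (1 : MvPolynomial ι k) = MvPolynomial.idealOfVars ι k := by
  ext p
  rw [mem_polyAnn_one, ← pow_one (MvPolynomial.idealOfVars ι k),
    MvPolynomial.mem_pow_idealOfVars_iff']
  refine ⟨fun h b hb => ?_, fun h => h 0 (by simp)⟩
  rw [(Finsupp.degree_eq_zero_iff b).1 (by omega)]
  exact h

theorem isFreeConormal_polyAnn_one (n : ℕ) :
    IsFreeConormal (polyAnn (1 : MvPolynomial (Fin n) k)) n := by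
  refine ⟨MvPolynomial.X, fun b => ?_, fun x hx => ?_, fun r hr b => ?_⟩
  · rw [mem_polyAnn_one, MvPolynomial.constantCoeff_X]
  · rw [polyAnn_one, MvPolynomial.idealOfVars] at hx
    obtain ⟨r, hr⟩ := Ideal.mem_span_range_iff_exists_fun.1 hx
    exact ⟨r, by rw [hr, sub_self]; exact zero_mem _⟩
  · rw [polyAnn_one, ← pow_two, MvPolynomial.mem_pow_idealOfVars_iff'] at hr
    have h := hr (Finsupp.single b 1) (by simp)
    rw [MvPolynomial.coeff_sum, Finset.sum_eq_single b] at h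
    · rw [mem_polyAnn_one, MvPolynomial.constantCoeff_eq]
      have := MvPolynomial.coeff_mul_X 0 b (r b)
      rw [zero_add] at this
      rw [← this, h]
    · intro c _ hc
      classical
      rw [MvPolynomial.coeff_mul_X', if_neg]
      simpa [Finsupp.single_apply] using hc
    · simp

end

end

noncomputable section

open Polynomial hiding contract contract_one

/-! ### The iterated ray sum -/

section IteratedRaySum

variable {ι k : Type*} [Finite ι]

section

variable [CommRing k] {f F : MvPolynomial ι k} {d : ℕ}

theorem contract_rename_mul_X_none_raySum (hd : 1 ≤ d) {s : MvPowerSeries ι k}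
    (hs : contract s F = 1) :
    contract (MvPowerSeries.rename some s * MvPowerSeries.X none)
      (MvPolynomial.rename some f + MvPolynomial.X none ^ d * MvPolynomial.rename some F) =
      MvPolynomial.X none ^ (d - 1) := by
  have h0 := contract_rename_some_mul_X_none_pow s 1 0 f
  have h1 := contract_rename_some_mul_X_none_pow s 1 d F
  rw [pow_one, pow_zero, one_mul, if_neg (by omega)] at h0
  rw [pow_one, if_pos hd, hs, map_one, mul_one] at h1
  rw [contract_add_right, h0, h1, zero_add]

theorem contract_rename_mul_X_none_X_none_pow {s : MvPowerSeries ι k}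
    (hs : MvPowerSeries.constantCoeff s = 0) :
    contract (MvPowerSeries.rename some s * MvPowerSeries.X none)
      (MvPolynomial.X none ^ d) = 0 := by
  have h1 := contract_rename_some_mul_X_none_pow s 1 d (1 : MvPolynomial ι k)
  rw [pow_one, map_one, mul_one, contract_apply_one, hs, map_zero, map_zero, mul_zero, ite_self]
    at h1
  exact h1

end

variable [Field k]

omit [Finite ι] in
theorem constantCoeff_eq_zero_of_contract_eq_one {F : MvPolynomial ι k} (hF : 0 < F.totalDegree)
    {s : MvPowerSeries ι k} (hs : contract s F = 1) : MvPowerSeries.constantCoeff s = 0 := by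
  by_contra h
  have h1 : contract s⁻¹ (contract s F) = F := by
    rw [← contract_mul, MvPowerSeries.inv_mul_cancel _ h, contract_one]
  rw [hs, contract_apply_one] at h1
  rw [← h1, MvPolynomial.totalDegree_C] at hF
  exact hF.false

theorem raySum_raySum_eq {f : MvPolynomial ι k} {D s : MvPowerSeries ι k} {d m : ℕ} (hd : 2 ≤ d)
    (hD2 : contract (D ^ 2) f = 0) (hdeg : 0 < (contract D f).totalDegree)
    (hs : contract s (contract D f) = 1) :
    raySum m (raySum d f D) (MvPowerSeries.rename some s * MvPowerSeries.X none) =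
      MvPolynomial.rename some (MvPolynomial.rename some f +
        MvPolynomial.X none ^ d * MvPolynomial.rename some (contract D f)) +
      MvPolynomial.X none ^ m * MvPolynomial.rename some (MvPolynomial.X none ^ (d - 1)) := by
  rw [raySum_eq_of_sq (hdeg.trans_le (totalDegree_contract_le D f)) hD2]
  have h1 := contract_rename_mul_X_none_raySum (f := f) (d := d) (by omega) hs
  rw [raySum_eq_of_sq, h1]
  · have h2 := totalDegree_contract_le (MvPowerSeries.rename some s * MvPowerSeries.X none)
      (MvPolynomial.rename some f + MvPolynomial.X none ^ d *
        MvPolynomial.rename some (contract D f))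
    rw [h1, MvPolynomial.totalDegree_X_pow] at h2
    omega
  · rw [pow_two, contract_mul, h1]
    exact contract_rename_mul_X_none_X_none_pow (constantCoeff_eq_zero_of_contract_eq_one hdeg hs)

omit [Finite ι] in
theorem map_rayPoly {S T : Type*} [CommRing S] [CommRing T] (φ : S →+* T) (d : ℕ) (D : S) :
    (rayPoly d D).map φ = rayPoly d (φ D) := by
  simp [rayPoly]

/-- The polynomial ring in the old variables and two new ones, as an iterated polynomial ring. -/
def optionOptionEquiv (ι k : Type*) [CommRing k] :
    MvPolynomial (Option (Option ι)) k ≃ₐ[k] (MvPolynomial ι k)[X][X] :=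
  (MvPolynomial.optionEquivLeft k (Option ι)).trans
    (Polynomial.mapAlgEquiv (MvPolynomial.optionEquivLeft k ι))

/-- The annihilator of the iterated ray sum is an iterated ray ideal. -/
theorem map_polyAnn_raySum_raySum {f D σ : MvPolynomial ι k} {d m : ℕ} (hd : 2 ≤ d) (hm : 2 ≤ m)
    (hD2 : contract (D : MvPowerSeries ι k) (contract (D : MvPowerSeries ι k) f) = 0)
    (hdeg : 0 < (contract (D : MvPowerSeries ι k) f).totalDegree)
    (hs : contract (σ : MvPowerSeries ι k) (contract (D : MvPowerSeries ι k) f) = 1) :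
    (polyAnn (MvPolynomial.rename some (MvPolynomial.rename some f +
        MvPolynomial.X none ^ d * MvPolynomial.rename some
          (contract (D : MvPowerSeries ι k) f)) +
      MvPolynomial.X none ^ m * MvPolynomial.rename some (MvPolynomial.X none ^ (d - 1)))).map
        (optionOptionEquiv ι k : _ →+* _) =
      rayIdeal (rayIdeal (polyAnn f) (polyAnn (contract (D : MvPowerSeries ι k) f)) (rayPoly d D))
        (rayIdeal (polyAnn 1) (polyAnn 1) (rayPoly d D)) (rayPoly m (C σ * X)) := by
  set F := contract (D : MvPowerSeries ι k) f with hF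
  set φ : MvPolynomial (Option ι) k := MvPolynomial.rename some σ * MvPolynomial.X none with hφ
  have hφ' : (φ : MvPowerSeries (Option ι) k) =
      MvPowerSeries.rename some (σ : MvPowerSeries ι k) * MvPowerSeries.X none := by
    rw [hφ, MvPolynomial.coe_mul, MvPolynomial.coe_X, MvPowerSeries.rename_coe]
  have h1 : contract (φ : MvPowerSeries (Option ι) k) (MvPolynomial.rename some f +
      MvPolynomial.X none ^ d * MvPolynomial.rename some F) = MvPolynomial.X none ^ (d - 1) := by
    rw [hφ', contract_rename_mul_X_none_raySum (by omega) hs]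
  have h2 : contract (φ : MvPowerSeries (Option ι) k) (MvPolynomial.X none ^ (d - 1)) = 0 := by
    rw [hφ', contract_rename_mul_X_none_X_none_pow
      (constantCoeff_eq_zero_of_contract_eq_one hdeg hs)]
  have hDM : D ∈ polyAnn (1 : MvPolynomial ι k) := by
    rw [← hs]
    exact polyAnn_le_polyAnn_contract _ _ (mem_polyAnn.2 hD2)
  have hφe : MvPolynomial.optionEquivLeft k ι φ = C σ * X := by
    rw [hφ, map_mul, MvPolynomial.optionEquivLeft_X_none, optionEquivLeft_rename_some]
  have hE : (optionOptionEquiv ι k : MvPolynomial (Option (Option ι)) k →+* (MvPolynomial ι k)[X][X])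
      = (mapRingHom (MvPolynomial.optionEquivLeft k ι :
          MvPolynomial (Option ι) k →+* (MvPolynomial ι k)[X])).comp
        (MvPolynomial.optionEquivLeft k (Option ι) :
          MvPolynomial (Option (Option ι)) k →+* (MvPolynomial (Option ι) k)[X]) := rfl
  have h3 := map_polyAnn_raySum (f := MvPolynomial.rename some f +
      MvPolynomial.X none ^ d * MvPolynomial.rename some F) (D := φ) hm (by rw [h1, h2])
  rw [h1] at h3
  rw [hE, ← Ideal.map_map, h3, map_rayIdeal, map_polyAnn_raySum hd hD2,
    map_polyAnn_X_none_pow hd hDM, map_rayPoly]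
  congr 2

omit [Finite ι] in
theorem finrank_quotient_map_algEquiv {P Q : Type*} [CommRing P] [CommRing Q] [Algebra k P]
    [Algebra k Q] (E : P ≃ₐ[k] Q) (I : Ideal P) :
    Module.finrank k (P ⧸ I) = Module.finrank k (Q ⧸ I.map (E : P →+* Q)) :=
  (Ideal.quotientEquivAlg I _ E rfl).toLinearEquiv.finrank_eq

end IteratedRaySum

/-- The cotangent dimension count: the annihilator `J` of the iterated ray sum satisfies
`dim P ⧸ J ^ 2 = (n + 3) dim P ⧸ J`. -/
theorem finrank_quotient_polyAnn_mul_self {k : Type*} [Field k] {n : ℕ}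
    {f D σ : MvPolynomial (Fin n) k} {d m : ℕ} (hd : 2 ≤ d) (hm : 2 ≤ m)
    (hD2 : contract (D : MvPowerSeries (Fin n) k) (contract (D : MvPowerSeries (Fin n) k) f) = 0)
    (hdeg : 0 < (contract (D : MvPowerSeries (Fin n) k) f).totalDegree)
    (hs : contract (σ : MvPowerSeries (Fin n) k) (contract (D : MvPowerSeries (Fin n) k) f) = 1)
    (hf : IsCompleteIntersection (apolarIdeal f))
    (hDf : IsCompleteIntersection (apolarIdeal (contract (D : MvPowerSeries (Fin n) k) f)))
    {h : MvPolynomial (Option (Option (Fin n))) k}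
    (hh : h = MvPolynomial.rename some (MvPolynomial.rename some f +
        MvPolynomial.X none ^ d * MvPolynomial.rename some
          (contract (D : MvPowerSeries (Fin n) k) f)) +
      MvPolynomial.X none ^ m * MvPolynomial.rename some (MvPolynomial.X none ^ (d - 1))) :
    Module.finrank k (MvPolynomial (Option (Option (Fin n))) k ⧸ polyAnn h * polyAnn h) =
      (n + 3) * Module.finrank k (MvPolynomial (Option (Option (Fin n))) k ⧸ polyAnn h) := by
  have := finite_quotient_polyAnn_mul_self f
  have hM := map_polyAnn_raySum_raySum hd hm hD2 hdeg hs
  rw [← hh] at hM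
  have key := (finrank_quotient_iterated_rayIdeal (k := k) (D := D) (σ := σ) hd hm
    hf.isFreeConormal hDf.isFreeConormal (isFreeConormal_polyAnn_one n)
    (polyAnn_le_polyAnn_contract f _) (by
      conv_rhs => rw [← hs]
      exact polyAnn_le_polyAnn_contract _ _)
    (fun s => mul_mem_polyAnn_iff) (fun s => by rw [mul_mem_polyAnn_iff, hs])).2
  rw [finrank_quotient_map_algEquiv (Q := (MvPolynomial (Fin n) k)[X][X]) (optionOptionEquiv (Fin n) k),
    finrank_quotient_map_algEquiv (Q := (MvPolynomial (Fin n) k)[X][X])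
      (optionOptionEquiv (Fin n) k), Ideal.map_mul, hM]
  exact key

end

noncomputable section

/-! ### First order families -/

section FirstOrder

variable {ι k : Type*} [Field k]

/-- The reduction of a polynomial over the dual numbers to the residue field. -/
def fstPoly (ι k : Type*) [Field k] :
    MvPolynomial ι (TrivSqZeroExt k k) →+* MvPolynomial ι k :=
  MvPolynomial.map (TrivSqZeroExt.fstHom k k k).toRingHom

theorem coeff_fstPoly (p : MvPolynomial ι (TrivSqZeroExt k k)) (a : ι →₀ ℕ) :
    MvPolynomial.coeff a (fstPoly ι k p) = (MvPolynomial.coeff a p).fst :=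
  MvPolynomial.coeff_map _ p a

/-- The polynomial of the infinitesimal parts of the coefficients of a polynomial over the dual
numbers. -/
def sndPoly (p : MvPolynomial ι (TrivSqZeroExt k k)) : MvPolynomial ι k :=
  ∑ a ∈ p.support, MvPolynomial.monomial a (MvPolynomial.coeff a p).snd

theorem coeff_sndPoly (p : MvPolynomial ι (TrivSqZeroExt k k)) (a : ι →₀ ℕ) :
    MvPolynomial.coeff a (sndPoly p) = (MvPolynomial.coeff a p).snd := by
  classical
  rw [sndPoly, MvPolynomial.coeff_sum]
  simp only [MvPolynomial.coeff_monomial]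
  rw [Finset.sum_ite_eq' p.support a]
  split_ifs with h
  · rfl
  · rw [MvPolynomial.notMem_support_iff.1 h, TrivSqZeroExt.snd_zero]

theorem sndPoly_zero : sndPoly (0 : MvPolynomial ι (TrivSqZeroExt k k)) = 0 := by
  ext a
  simp [coeff_sndPoly]

theorem sndPoly_add (p q : MvPolynomial ι (TrivSqZeroExt k k)) :
    sndPoly (p + q) = sndPoly p + sndPoly q := by
  ext a
  simp [coeff_sndPoly]

theorem sndPoly_sub (p q : MvPolynomial ι (TrivSqZeroExt k k)) :
    sndPoly (p - q) = sndPoly p - sndPoly q := by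
  ext a
  simp [coeff_sndPoly]

theorem sndPoly_mul (p q : MvPolynomial ι (TrivSqZeroExt k k)) :
    sndPoly (p * q) = fstPoly ι k p * sndPoly q + sndPoly p * fstPoly ι k q := by
  classical
  ext a
  rw [coeff_sndPoly, MvPolynomial.coeff_mul, MvPolynomial.coeff_add, MvPolynomial.coeff_mul,
    MvPolynomial.coeff_mul, ← Finset.sum_add_distrib, TrivSqZeroExt.snd_sum]
  refine Finset.sum_congr rfl fun u _ => ?_
  rw [TrivSqZeroExt.snd_mul, coeff_fstPoly, coeff_fstPoly, coeff_sndPoly, coeff_sndPoly,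
    smul_eq_mul, MulOpposite.smul_eq_mul_unop, MulOpposite.unop_op]

/-- The polynomial `a + ε b` over the dual numbers. -/
def dualPoly (a b : MvPolynomial ι k) : MvPolynomial ι (TrivSqZeroExt k k) :=
  MvPolynomial.map (TrivSqZeroExt.inlHom k k) a +
    MvPolynomial.C (TrivSqZeroExt.inr 1) * MvPolynomial.map (TrivSqZeroExt.inlHom k k) b

theorem fstPoly_map_inl (a : MvPolynomial ι k) :
    fstPoly ι k (MvPolynomial.map (TrivSqZeroExt.inlHom k k) a) = a := by
  ext c
  rw [coeff_fstPoly, MvPolynomial.coeff_map]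
  rfl

theorem sndPoly_map_inl (a : MvPolynomial ι k) :
    sndPoly (MvPolynomial.map (TrivSqZeroExt.inlHom k k) a) = 0 := by
  ext c
  rw [coeff_sndPoly, MvPolynomial.coeff_map]
  rfl

theorem fstPoly_eps_mul (p : MvPolynomial ι (TrivSqZeroExt k k)) :
    fstPoly ι k (MvPolynomial.C (TrivSqZeroExt.inr 1) * p) = 0 := by
  ext c
  rw [coeff_fstPoly, MvPolynomial.coeff_C_mul, TrivSqZeroExt.fst_mul, TrivSqZeroExt.fst_inr,
    zero_mul, MvPolynomial.coeff_zero]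

theorem sndPoly_eps_mul (p : MvPolynomial ι (TrivSqZeroExt k k)) :
    sndPoly (MvPolynomial.C (TrivSqZeroExt.inr 1) * p) = fstPoly ι k p := by
  ext c
  rw [coeff_sndPoly, MvPolynomial.coeff_C_mul, TrivSqZeroExt.snd_mul, TrivSqZeroExt.fst_inr,
    zero_smul, zero_add, TrivSqZeroExt.snd_inr, coeff_fstPoly]
  simp

theorem fstPoly_dualPoly (a b : MvPolynomial ι k) : fstPoly ι k (dualPoly a b) = a := by
  rw [dualPoly, map_add, fstPoly_eps_mul, fstPoly_map_inl, add_zero]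

theorem sndPoly_dualPoly (a b : MvPolynomial ι k) : sndPoly (dualPoly a b) = b := by
  rw [dualPoly, sndPoly_add, sndPoly_eps_mul, fstPoly_map_inl, sndPoly_map_inl, zero_add]

theorem eq_of_fstPoly_eq_of_sndPoly_eq {p q : MvPolynomial ι (TrivSqZeroExt k k)}
    (h1 : fstPoly ι k p = fstPoly ι k q) (h2 : sndPoly p = sndPoly q) : p = q := by
  ext c
  · rw [← coeff_fstPoly, h1, coeff_fstPoly]
  · rw [← coeff_sndPoly, h2, coeff_sndPoly]

variable {I : Ideal (MvPolynomial ι k)}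

theorem IsFirstOrderFamily.mem_iff_exists {V : Type*} [AddCommGroup V] [Module k V] [Module kᵐᵒᵖ V]
    [IsCentralScalar k V] {J : Ideal (MvPolynomial ι (TrivSqZeroExt k V))}
    (hJ : IsFirstOrderFamily I V J) {a : MvPolynomial ι k} :
    a ∈ I ↔ ∃ p ∈ J, MvPolynomial.map (TrivSqZeroExt.fstHom k k V).toRingHom p = a := by
  rw [← Ideal.mem_map_iff_of_surjective, hJ.2]
  refine MvPolynomial.map_surjective _ fun c => ⟨TrivSqZeroExt.inl c, ?_⟩
  simp

theorem exists_eq_sum_smul_of_smul_eq_zero {R M : Type*} [CommRing R] [AddCommGroup M] [Module R M]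
    [Module.Flat R M] {r : R} {x : M} (h : r • x = 0) :
    ∃ (n : ℕ) (c : Fin n → R) (y : Fin n → M), x = ∑ j, c j • y j ∧ ∀ j, r * c j = 0 := by
  have h' : ∑ i : Fin 1, (fun _ => r : Fin 1 → R) i • (fun _ => x : Fin 1 → M) i = 0 := by
    rwa [Fin.sum_univ_one]
  obtain ⟨n, c, y, hy, hc⟩ := Module.Flat.isTrivialRelation_of_sum_smul_eq_zero h'
  exact ⟨n, c 0, y, hy 0, fun j => by rw [← hc j, Fin.sum_univ_one]⟩

/-- Flatness of a family over the dual numbers: an element of the ideal without constant part is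
`ε b` with `b` in the ideal of the special fibre. -/
theorem IsFirstOrderFamily.sndPoly_mem {J : Ideal (MvPolynomial ι (TrivSqZeroExt k k))}
    (hJ : IsFirstOrderFamily I k J) {p : MvPolynomial ι (TrivSqZeroExt k k)} (hp : p ∈ J)
    (h0 : fstPoly ι k p = 0) : sndPoly p ∈ I := by
  have hflat := hJ.1
  set b := sndPoly p with hb
  have hpe : p = MvPolynomial.C (TrivSqZeroExt.inr 1) * dualPoly b 0 := by
    refine eq_of_fstPoly_eq_of_sndPoly_eq ?_ ?_
    · rw [h0, fstPoly_eps_mul]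
    · rw [sndPoly_eps_mul, fstPoly_dualPoly]
  have hrel : (TrivSqZeroExt.inr 1 : TrivSqZeroExt k k) •
      Ideal.Quotient.mk J (dualPoly b 0) = 0 := by
    change Ideal.Quotient.mk J ((TrivSqZeroExt.inr 1 : TrivSqZeroExt k k) • dualPoly b 0) = 0
    rw [Ideal.Quotient.eq_zero_iff_mem, MvPolynomial.smul_eq_C_mul, ← hpe]
    exact hp
  obtain ⟨n, c, y, hy, hc⟩ := exists_eq_sum_smul_of_smul_eq_zero (R := TrivSqZeroExt k k)
    (M := MvPolynomial ι (TrivSqZeroExt k k) ⧸ J) hrel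
  choose z hz using fun j => Ideal.Quotient.mk_surjective (y j)
  have hmem : dualPoly b 0 - ∑ j, c j • z j ∈ J := by
    rw [← Ideal.Quotient.eq_zero_iff_mem, map_sub, hy, map_sum, sub_eq_zero]
    refine Finset.sum_congr rfl fun j _ => ?_
    rw [← hz j]
    rfl
  refine hJ.mem_iff_exists.2 ⟨_, hmem, ?_⟩
  change fstPoly ι k _ = _
  rw [map_sub, fstPoly_dualPoly, map_sum, Finset.sum_eq_zero, sub_zero]
  intro j _
  have h2 : (c j).fst = 0 := by
    have := congrArg TrivSqZeroExt.snd (hc j)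
    simpa using this
  ext e
  rw [coeff_fstPoly, MvPolynomial.coeff_smul]
  simp [h2]

theorem IsFirstOrderFamily.mk_sndPoly_eq {J : Ideal (MvPolynomial ι (TrivSqZeroExt k k))}
    (hJ : IsFirstOrderFamily I k J) {p q : MvPolynomial ι (TrivSqZeroExt k k)} (hp : p ∈ J)
    (hq : q ∈ J) (h : fstPoly ι k p = fstPoly ι k q) :
    Ideal.Quotient.mk I (sndPoly p) = Ideal.Quotient.mk I (sndPoly q) := by
  rw [Ideal.Quotient.eq, ← sndPoly_sub]
  exact hJ.sndPoly_mem (sub_mem hp hq) (by rw [map_sub, h, sub_self])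

/-- The lift of an element of the ideal of the special fibre to a family. -/
def IsFirstOrderFamily.lift {J : Ideal (MvPolynomial ι (TrivSqZeroExt k k))}
    (hJ : IsFirstOrderFamily I k J) (a : I) : MvPolynomial ι (TrivSqZeroExt k k) :=
  (hJ.mem_iff_exists.1 a.2).choose

theorem IsFirstOrderFamily.lift_mem {J : Ideal (MvPolynomial ι (TrivSqZeroExt k k))}
    (hJ : IsFirstOrderFamily I k J) (a : I) : hJ.lift a ∈ J :=
  (hJ.mem_iff_exists.1 a.2).choose_spec.1

theorem IsFirstOrderFamily.fstPoly_lift {J : Ideal (MvPolynomial ι (TrivSqZeroExt k k))}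
    (hJ : IsFirstOrderFamily I k J) (a : I) : fstPoly ι k (hJ.lift a) = a :=
  (hJ.mem_iff_exists.1 a.2).choose_spec.2

/-- The homomorphism `I → P ⧸ I` of a first order family, with `a ↦ b` if `a + ε b` lies in the
ideal of the family. -/
def IsFirstOrderFamily.hom {J : Ideal (MvPolynomial ι (TrivSqZeroExt k k))}
    (hJ : IsFirstOrderFamily I k J) : I →ₗ[MvPolynomial ι k] MvPolynomial ι k ⧸ I where
  toFun a := Ideal.Quotient.mk I (sndPoly (hJ.lift a))
  map_add' a b := by
    rw [← map_add, ← sndPoly_add]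
    refine hJ.mk_sndPoly_eq (hJ.lift_mem _) (add_mem (hJ.lift_mem a) (hJ.lift_mem b)) ?_
    simp only [map_add, hJ.fstPoly_lift, Submodule.coe_add]
  map_smul' c a := by
    have h := hJ.mk_sndPoly_eq (hJ.lift_mem (c • a)) (J.mul_mem_left (dualPoly c 0) (hJ.lift_mem a))
      (by rw [hJ.fstPoly_lift, map_mul, fstPoly_dualPoly, hJ.fstPoly_lift]; rfl)
    rw [h, sndPoly_mul, fstPoly_dualPoly, sndPoly_dualPoly, zero_mul, add_zero]
    rfl

theorem IsFirstOrderFamily.hom_apply {J : Ideal (MvPolynomial ι (TrivSqZeroExt k k))}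
    (hJ : IsFirstOrderFamily I k J) {p : MvPolynomial ι (TrivSqZeroExt k k)} (hp : p ∈ J) {a : I}
    (h : fstPoly ι k p = a) : hJ.hom a = Ideal.Quotient.mk I (sndPoly p) :=
  hJ.mk_sndPoly_eq (hJ.lift_mem _) hp (by rw [hJ.fstPoly_lift, h])

theorem IsFirstOrderFamily.mem_iff {J : Ideal (MvPolynomial ι (TrivSqZeroExt k k))}
    (hJ : IsFirstOrderFamily I k J) {p : MvPolynomial ι (TrivSqZeroExt k k)} :
    p ∈ J ↔ ∃ h : fstPoly ι k p ∈ I, hJ.hom ⟨_, h⟩ = Ideal.Quotient.mk I (sndPoly p) := by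
  refine ⟨fun hp => ⟨hJ.mem_iff_exists.2 ⟨p, hp, rfl⟩, hJ.hom_apply hp rfl⟩, ?_⟩
  rintro ⟨h, hp⟩
  set a : I := ⟨_, h⟩
  -- It remains to see that `ε b` lies in `J` for `b` in `I`: multiply a lift of `b` by `ε`.
  have hb : sndPoly p - sndPoly (hJ.lift a) ∈ I := Ideal.Quotient.eq.1 hp.symm
  have : p = hJ.lift a + MvPolynomial.C (TrivSqZeroExt.inr 1) * hJ.lift ⟨_, hb⟩ := by
    refine eq_of_fstPoly_eq_of_sndPoly_eq ?_ ?_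
    · rw [map_add, hJ.fstPoly_lift, fstPoly_eps_mul, add_zero]
    · rw [sndPoly_add, sndPoly_eps_mul, hJ.fstPoly_lift, add_sub_cancel]
  rw [this]
  exact add_mem (hJ.lift_mem a) (J.mul_mem_left _ (hJ.lift_mem _))

/-- The first order family defined by a homomorphism `I → P ⧸ I`. -/
def familyOfHom (ψ : I →ₗ[MvPolynomial ι k] MvPolynomial ι k ⧸ I) :
    Ideal (MvPolynomial ι (TrivSqZeroExt k k)) where
  carrier := {p | ∃ h : fstPoly ι k p ∈ I, ψ ⟨_, h⟩ = Ideal.Quotient.mk I (sndPoly p)}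
  zero_mem' := by
    have h : fstPoly ι k 0 ∈ I := by rw [map_zero]; exact zero_mem _
    have e : (⟨_, h⟩ : I) = 0 := Subtype.ext (map_zero _)
    exact ⟨h, by rw [e, map_zero, sndPoly_zero, map_zero]⟩
  add_mem' := by
    rintro p q ⟨hp, hp'⟩ ⟨hq, hq'⟩
    have h : fstPoly ι k (p + q) ∈ I := by rw [map_add]; exact add_mem hp hq
    have e : (⟨_, h⟩ : I) = ⟨_, hp⟩ + ⟨_, hq⟩ := Subtype.ext (map_add _ _ _)
    exact ⟨h, by rw [e, map_add, hp', hq', sndPoly_add, map_add]⟩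
  smul_mem' := by
    rintro c p ⟨hp, hp'⟩
    have h : fstPoly ι k (c • p) ∈ I := by
      rw [smul_eq_mul, map_mul]; exact I.mul_mem_left _ hp
    refine ⟨h, ?_⟩
    have e : (⟨_, h⟩ : I) = fstPoly ι k c • ⟨_, hp⟩ := Subtype.ext (map_mul _ _ _)
    rw [e, map_smul, hp', smul_eq_mul, sndPoly_mul, map_add,
      Ideal.Quotient.eq_zero_iff_mem.2 (I.mul_mem_left (sndPoly c) hp), add_zero]
    rfl

theorem mem_familyOfHom {ψ : I →ₗ[MvPolynomial ι k] MvPolynomial ι k ⧸ I}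
    {p : MvPolynomial ι (TrivSqZeroExt k k)} : p ∈ familyOfHom ψ ↔
      ∃ h : fstPoly ι k p ∈ I, ψ ⟨_, h⟩ = Ideal.Quotient.mk I (sndPoly p) :=
  Iff.rfl

/-- Lifts of a basis of the special fibre form a basis of the family over the dual numbers. -/
theorem flat_familyOfHom [Module.Finite k (MvPolynomial ι k ⧸ I)]
    (ψ : I →ₗ[MvPolynomial ι k] MvPolynomial ι k ⧸ I) :
    Module.Flat (TrivSqZeroExt k k) (MvPolynomial ι (TrivSqZeroExt k k) ⧸ familyOfHom ψ) := by
  let b := Module.finBasis k (MvPolynomial ι k ⧸ I)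
  choose s hs using fun j => Ideal.Quotient.mk_surjective (b j)
  have hsum : ∀ u : Fin (Module.finrank k (MvPolynomial ι k ⧸ I)) → k,
      Ideal.Quotient.mk I (∑ j, u j • s j) = ∑ j, u j • b j := by
    intro u
    rw [map_sum]
    exact Finset.sum_congr rfl fun j _ => by rw [← hs j]; rfl
  let Φ : (Fin (Module.finrank k (MvPolynomial ι k ⧸ I)) → TrivSqZeroExt k k)
      →ₗ[TrivSqZeroExt k k] MvPolynomial ι (TrivSqZeroExt k k) ⧸ familyOfHom ψ :=
    Fintype.linearCombination _ fun j => Ideal.Quotient.mk _ (dualPoly (s j) 0)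
  have hΦ : ∀ c, Φ c = Ideal.Quotient.mk _
      (dualPoly (∑ j, (c j).fst • s j) (∑ j, (c j).snd • s j)) := by
    intro c
    have : dualPoly (∑ j, (c j).fst • s j) (∑ j, (c j).snd • s j) =
        ∑ j, c j • dualPoly (s j) 0 := by
      refine eq_of_fstPoly_eq_of_sndPoly_eq ?_ ?_ <;> ext e
      · rw [fstPoly_dualPoly, coeff_fstPoly, MvPolynomial.coeff_sum, MvPolynomial.coeff_sum,
          TrivSqZeroExt.fst_sum]
        refine Finset.sum_congr rfl fun j _ => ?_
        rw [MvPolynomial.coeff_smul, MvPolynomial.coeff_smul, smul_eq_mul, smul_eq_mul,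
          TrivSqZeroExt.fst_mul, ← coeff_fstPoly, fstPoly_dualPoly]
      · rw [sndPoly_dualPoly, coeff_sndPoly, MvPolynomial.coeff_sum, MvPolynomial.coeff_sum,
          TrivSqZeroExt.snd_sum]
        refine Finset.sum_congr rfl fun j _ => ?_
        rw [MvPolynomial.coeff_smul, MvPolynomial.coeff_smul, smul_eq_mul, smul_eq_mul,
          TrivSqZeroExt.snd_mul, ← coeff_fstPoly, ← coeff_sndPoly, fstPoly_dualPoly,
          sndPoly_dualPoly]
        simp [mul_comm]
    rw [this, map_sum]
    rfl
  have hinj : Function.Injective Φ := by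
    rw [injective_iff_map_eq_zero]
    intro c hc
    rw [hΦ, Ideal.Quotient.eq_zero_iff_mem, mem_familyOfHom] at hc
    obtain ⟨h1, h2⟩ := hc
    have hu : ∀ j, (c j).fst = 0 := by
      rw [fstPoly_dualPoly, ← Ideal.Quotient.eq_zero_iff_mem, hsum] at h1
      exact Fintype.linearIndependent_iff.1 b.linearIndependent _ h1
    have hv : ∀ j, (c j).snd = 0 := by
      rw [sndPoly_dualPoly, hsum] at h2
      refine Fintype.linearIndependent_iff.1 b.linearIndependent _ (h2.symm.trans ?_)
      convert map_zero ψ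
      rw [fstPoly_dualPoly]
      exact Finset.sum_eq_zero fun j _ => by rw [hu j, zero_smul]
    funext j
    exact TrivSqZeroExt.ext (hu j) (hv j)
  have hsurj : Function.Surjective Φ := by
    intro x
    obtain ⟨p, rfl⟩ := Ideal.Quotient.mk_surjective x
    set u := b.repr (Ideal.Quotient.mk I (fstPoly ι k p)) with hu
    have hi : fstPoly ι k p - ∑ j, u j • s j ∈ I := by
      rw [← Ideal.Quotient.eq, hsum, hu, b.sum_repr]
    obtain ⟨q, hq⟩ := Ideal.Quotient.mk_surjective (ψ ⟨_, hi⟩)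
    set v := b.repr (Ideal.Quotient.mk I (sndPoly p - q)) with hv
    refine ⟨fun j => TrivSqZeroExt.inl (u j) + TrivSqZeroExt.inr (v j), ?_⟩
    rw [hΦ, eq_comm, Ideal.Quotient.eq, mem_familyOfHom]
    simp only [TrivSqZeroExt.fst_add, TrivSqZeroExt.fst_inl, TrivSqZeroExt.fst_inr, add_zero,
      TrivSqZeroExt.snd_add, TrivSqZeroExt.snd_inl, TrivSqZeroExt.snd_inr, zero_add, map_sub,
      fstPoly_dualPoly, sndPoly_sub, sndPoly_dualPoly]
    refine ⟨hi, ?_⟩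
    rw [hsum, hv, b.sum_repr, ← hq, map_sub, sub_sub_cancel]
  exact Module.Flat.of_linearEquiv (LinearEquiv.ofBijective Φ ⟨hinj, hsurj⟩).symm

theorem isFirstOrderFamily_familyOfHom [Module.Finite k (MvPolynomial ι k ⧸ I)]
    (ψ : I →ₗ[MvPolynomial ι k] MvPolynomial ι k ⧸ I) :
    IsFirstOrderFamily I k (familyOfHom ψ) := by
  refine ⟨flat_familyOfHom ψ, ?_⟩
  ext a
  rw [Ideal.mem_map_iff_of_surjective _
    (MvPolynomial.map_surjective _ fun c => ⟨TrivSqZeroExt.inl c, by simp⟩)]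
  constructor
  · rintro ⟨p, ⟨h, -⟩, rfl⟩
    exact h
  · intro ha
    obtain ⟨q, hq⟩ := Ideal.Quotient.mk_surjective (ψ ⟨a, ha⟩)
    refine ⟨dualPoly a q, ⟨by rwa [fstPoly_dualPoly], ?_⟩, fstPoly_dualPoly a q⟩
    rw [sndPoly_dualPoly, hq]
    congr 2
    exact fstPoly_dualPoly a q

/-- The tangent space to the Hilbert scheme at `[I]` is `Hom (I, P ⧸ I)`. -/
def hilbTangentEquiv [Module.Finite k (MvPolynomial ι k ⧸ I)] :
    HilbTangent I ≃ (I →ₗ[MvPolynomial ι k] MvPolynomial ι k ⧸ I) where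
  toFun J := J.2.hom
  invFun ψ := ⟨familyOfHom ψ, isFirstOrderFamily_familyOfHom ψ⟩
  left_inv J := Subtype.ext (Ideal.ext fun p => by rw [mem_familyOfHom, J.2.mem_iff])
  right_inv ψ := by
    refine LinearMap.ext fun a => ?_
    have h := IsFirstOrderFamily.lift_mem (isFirstOrderFamily_familyOfHom ψ) a
    obtain ⟨h1, h2⟩ := mem_familyOfHom.1 h
    refine h2.symm.trans ?_
    congr 1
    exact Subtype.ext (IsFirstOrderFamily.fstPoly_lift _ a)

/-- Gluing two tangent vectors over `k ⊕ k ^ 2` and pushing forward computes the linear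
combination of the corresponding homomorphisms. -/
theorem hilbTangentEquiv_linear [Module.Finite k (MvPolynomial ι k ⧸ I)] (c d : k)
    {J : Ideal (MvPolynomial ι (TrivSqZeroExt k (k × k)))} (hJ : IsFirstOrderFamily I (k × k) J)
    {J₁ J₂ J₃ : HilbTangent I} (h₁ : pushFamily (LinearMap.fst k k k) J = J₁.1)
    (h₂ : pushFamily (LinearMap.snd k k k) J = J₂.1)
    (h₃ : pushFamily (c • LinearMap.fst k k k + d • LinearMap.snd k k k) J = J₃.1) (a : I) :
    hilbTangentEquiv J₃ a = c • hilbTangentEquiv J₁ a + d • hilbTangentEquiv J₂ a := by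
  obtain ⟨p, hp, hpa⟩ := hJ.mem_iff_exists.1 a.2
  have key : ∀ (l : k × k →ₗ[k] k) (J' : HilbTangent I), pushFamily l J = J'.1 →
      hilbTangentEquiv J' a = Ideal.Quotient.mk I
        (sndPoly (MvPolynomial.map (TrivSqZeroExt.map l).toRingHom p)) := by
    intro l J' hl
    refine J'.2.hom_apply (hl ▸ Ideal.mem_map_of_mem _ hp) ?_
    rw [← hpa]
    ext e
    rw [coeff_fstPoly, MvPolynomial.coeff_map, MvPolynomial.coeff_map]
    simp
  rw [key _ _ h₁, key _ _ h₂, key _ _ h₃]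
  change _ = Ideal.Quotient.mk I (c • _) + Ideal.Quotient.mk I (d • _)
  rw [← map_add]
  congr 1
  ext e
  simp [coeff_sndPoly, MvPolynomial.coeff_map]

end FirstOrder

end

noncomputable section

/-! ### Homomorphisms into a Gorenstein quotient -/

section Gorenstein

variable {k P : Type*} [Field k] [CommRing P] [Algebra k P] {I : Ideal P}

/-- A homomorphism `I → P ⧸ I` followed by a functional on `P ⧸ I`, as a functional on `I ⧸ I ^ 2`. -/
def dualOfHom (l : (P ⧸ I) →ₗ[k] k) (ψ : I →ₗ[P] P ⧸ I) : I.Cotangent →ₗ[k] k :=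
  l ∘ₗ ((I • (⊤ : Submodule P I)).liftQ ψ (by
    rw [Submodule.smul_le]
    intro r hr x _
    rw [LinearMap.mem_ker, map_smul]
    obtain ⟨y, hy⟩ := Ideal.Quotient.mk_surjective (ψ x)
    rw [← hy]
    exact Ideal.Quotient.eq_zero_iff_mem.2 (I.mul_mem_right y hr)) :
      I.Cotangent →ₗ[P] P ⧸ I).restrictScalars k

theorem dualOfHom_toCotangent (l : (P ⧸ I) →ₗ[k] k) (ψ : I →ₗ[P] P ⧸ I) (x : I) :
    dualOfHom l ψ (I.toCotangent x) = l (ψ x) := rfl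

theorem dualOfHom_bijective [Module.Finite k (P ⧸ I)] (l : (P ⧸ I) →ₗ[k] k)
    (hl : ∀ x, (∀ y, l (y * x) = 0) → x = 0) : Function.Bijective (dualOfHom l) := by
  have hext : ∀ x y : P ⧸ I, (∀ z, l (z * x) = l (z * y)) → x = y := fun x y h =>
    sub_eq_zero.1 (hl _ fun z => by rw [mul_sub, map_sub, h, sub_self])
  constructor
  · intro ψ ψ' h
    refine LinearMap.ext fun x => hext _ _ fun z => ?_
    obtain ⟨p, rfl⟩ := Ideal.Quotient.mk_surjective z
    have h1 := LinearMap.congr_fun h (I.toCotangent (p • x))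
    rwa [dualOfHom_toCotangent, dualOfHom_toCotangent, ψ.map_smul, ψ'.map_smul] at h1
  · intro ℓ
    -- The functional `l` identifies `P ⧸ I` with its dual.
    let θ : (P ⧸ I) →ₗ[k] Module.Dual k (P ⧸ I) := (LinearMap.mul k (P ⧸ I)).compr₂ l
    have hθ : ∀ x z, θ x z = l (x * z) := fun _ _ => rfl
    have hinj : Function.Injective θ := by
      rw [injective_iff_map_eq_zero]
      intro x hx
      exact hl x fun y => by rw [mul_comm, ← hθ, hx]; rfl
    have hsurj : Function.Surjective θ :=
      (LinearMap.injective_iff_surjective_of_finrank_eq_finrank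
        Subspace.dual_finrank_eq.symm).1 hinj
    have hex : ∀ x : I, ∃ v : P ⧸ I, ∀ p : P,
        l (Ideal.Quotient.mk I p * v) = ℓ (I.toCotangent (p • x)) := by
      intro x
      let μ : P →ₗ[k] k := ℓ ∘ₗ (I.toCotangent.restrictScalars k) ∘ₗ
        ((LinearMap.toSpanSingleton P I x).restrictScalars k)
      have hμ : ∀ p : P, μ p = ℓ (I.toCotangent (p • x)) := fun _ => rfl
      let μ' : (P ⧸ I) →ₗ[k] k := (Submodule.liftQ (I.restrictScalars k) μ (by
        intro p hp
        rw [LinearMap.mem_ker, hμ]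
        have : I.toCotangent (p • x) = 0 := by
          rw [Ideal.toCotangent_eq_zero, pow_two]
          exact Ideal.mul_mem_mul hp x.2
        rw [this, map_zero]))
      obtain ⟨v, hv⟩ := hsurj μ'
      refine ⟨v, fun p => ?_⟩
      rw [mul_comm, ← hθ, hv, ← hμ]
      rfl
    choose ψ hψ using hex
    refine ⟨⟨⟨ψ, fun x y => ?_⟩, fun c x => ?_⟩, ?_⟩
    · refine hext _ _ fun z => ?_
      obtain ⟨p, rfl⟩ := Ideal.Quotient.mk_surjective z
      rw [mul_add, map_add, hψ, hψ, hψ, smul_add, map_add, map_add]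
    · refine hext _ _ fun z => ?_
      obtain ⟨p, rfl⟩ := Ideal.Quotient.mk_surjective z
      have e : Ideal.Quotient.mk I p * (c • ψ x) = Ideal.Quotient.mk I (p * c) * ψ x := by
        rw [map_mul, mul_assoc]; rfl
      change l (Ideal.Quotient.mk I p * ψ (c • x)) = l (Ideal.Quotient.mk I p * (c • ψ x))
      rw [e, hψ, hψ, mul_smul]
    · refine LinearMap.ext fun y => ?_
      obtain ⟨x, rfl⟩ := I.toCotangent_surjective y
      rw [dualOfHom_toCotangent]
      have := hψ x 1
      rwa [map_one, one_mul, one_smul] at this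

theorem finrank_cotangent_add [Module.Finite k (P ⧸ I * I)] :
    Module.finrank k I.Cotangent + Module.finrank k (P ⧸ I) = Module.finrank k (P ⧸ I * I) := by
  have hfin : Module.Finite k (P ⧸ I ^ 2) := by rwa [pow_two]
  let φ : (P ⧸ I ^ 2) →ₗ[k] P ⧸ I :=
    (Ideal.Quotient.factorₐ k (Ideal.pow_le_self two_ne_zero)).toLinearMap
  have hφ : LinearMap.range φ = ⊤ := LinearMap.range_eq_top.2
    (Ideal.Quotient.factor_surjective (Ideal.pow_le_self two_ne_zero))
  have hker : LinearMap.ker φ = I.cotangentIdeal.restrictScalars k := by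
    ext x
    obtain ⟨p, rfl⟩ := Ideal.Quotient.mk_surjective x
    rw [Submodule.restrictScalars_mem, Ideal.mk_mem_cotangentIdeal, LinearMap.mem_ker]
    exact Ideal.Quotient.eq_zero_iff_mem
  rw [← pow_two, ← φ.finrank_range_add_finrank_ker, hφ, finrank_top, hker, add_comm]
  congr 1
  exact (I.cotangentEquivIdeal.restrictScalars k).finrank_eq

end Gorenstein

/-! ### The tangent space at an apolar algebra -/

section ApolarTangent

variable {ι k : Type*} [Field k]

theorem coeff_zero_contract_coe_eq_zero {f p : MvPolynomial ι k}
    (h : ∀ q : MvPolynomial ι k,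
      MvPolynomial.coeff 0 (contract ((q * p : MvPolynomial ι k) : MvPowerSeries ι k) f) = 0) :
    p ∈ polyAnn f := by
  classical
  rw [mem_polyAnn]
  ext c
  have h1 := h (MvPolynomial.monomial c 1)
  rw [MvPolynomial.coe_mul, contract_mul, MvPolynomial.coe_monomial] at h1
  rw [MvPolynomial.coeff_zero, ← h1]
  generalize contract (p : MvPowerSeries ι k) f = g
  induction g using MvPolynomial.induction_on' with
  | add p q hp hq => rw [contract_add_right, MvPolynomial.coeff_add, MvPolynomial.coeff_add, hp, hq]
  | monomial a r =>
    rw [contract_monomial_monomial, one_mul, MvPolynomial.coeff_monomial]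
    by_cases hca : c ≤ a
    · rw [if_pos hca, MvPolynomial.coeff_monomial]
      have : a - c = 0 ↔ a = c := by
        rw [tsub_eq_zero_iff_le]
        exact ⟨fun h => le_antisymm h hca, fun h => h.le⟩
      simp only [this]
    · rw [if_neg hca, if_neg, MvPolynomial.coeff_zero]
      rintro rfl
      exact hca le_rfl

/-- The functional `p ↦ (p ⌟ f)(0)` on `P ⧸ Ann f`, whose associated bilinear form is
nondegenerate. -/
theorem exists_nondegenerate_functional (f : MvPolynomial ι k) :
    ∃ l : (MvPolynomial ι k ⧸ polyAnn f) →ₗ[k] k, ∀ x, (∀ y, l (y * x) = 0) → x = 0 := by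
  let μ : MvPolynomial ι k →ₗ[k] k :=
    { toFun := fun p => MvPolynomial.coeff 0 (contract (p : MvPowerSeries ι k) f)
      map_add' := fun p q => by
        rw [MvPolynomial.coe_add, contract_add_left, MvPolynomial.coeff_add]
      map_smul' := fun c p => by
        rw [MvPolynomial.smul_eq_C_mul, MvPolynomial.coe_mul, MvPolynomial.coe_C, contract_mul,
          contract_C, MvPolynomial.coeff_C_mul]
        rfl }
  refine ⟨Submodule.liftQ ((polyAnn f).restrictScalars k) μ fun p hp => ?_, fun x hx => ?_⟩
  · change MvPolynomial.coeff 0 (contract (p : MvPowerSeries ι k) f) = 0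
    rw [mem_polyAnn.1 hp, MvPolynomial.coeff_zero]
  · obtain ⟨p, rfl⟩ := Ideal.Quotient.mk_surjective x
    rw [Ideal.Quotient.eq_zero_iff_mem]
    exact coeff_zero_contract_coe_eq_zero fun q => hx (Ideal.Quotient.mk _ q)

/-- If `I` is the annihilator of a polynomial, then the tangent space at `[I]` is dual to
`I ⧸ I ^ 2`. -/
theorem hasTangentDim_polyAnn [Finite ι] {f : MvPolynomial ι k} {r : ℕ}
    (hr : Module.finrank k (MvPolynomial ι k ⧸ polyAnn f * polyAnn f) =
      r + Module.finrank k (MvPolynomial ι k ⧸ polyAnn f)) : HasTangentDim (polyAnn f) r := by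
  have := finite_quotient_polyAnn f
  have := finite_quotient_polyAnn_mul_self f
  obtain ⟨l, hl⟩ := exists_nondegenerate_functional f
  have hfin : Module.finrank k (polyAnn f).Cotangent = r := by
    have := finrank_cotangent_add (k := k) (I := polyAnn f)
    omega
  have hfinite : Module.Finite k (polyAnn f).Cotangent := by
    have hfin : Module.Finite k (MvPolynomial ι k ⧸ (polyAnn f) ^ 2) := by rwa [pow_two]
    have : Module.Finite k ((polyAnn f).cotangentIdeal.restrictScalars k) := inferInstance
    exact Module.Finite.equiv ((polyAnn f).cotangentEquivIdeal.restrictScalars k).symm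
  let E : Module.Dual k (polyAnn f).Cotangent ≃ₗ[k] (Fin r → k) :=
    LinearEquiv.ofFinrankEq _ _ (by rw [Subspace.dual_finrank_eq, hfin, Module.finrank_fin_fun])
  refine ⟨(hilbTangentEquiv.trans (Equiv.ofBijective _ (dualOfHom_bijective l hl))).trans E.toEquiv,
    fun a b J hJ J₁ J₂ J₃ h₁ h₂ h₃ => ?_⟩
  change E _ = a • E _ + b • E _
  rw [← E.map_smul, ← E.map_smul, ← E.map_add]
  congr 1
  refine LinearMap.ext fun y => ?_
  obtain ⟨x, rfl⟩ := (polyAnn f).toCotangent_surjective y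
  change l (hilbTangentEquiv J₃ x) = a • l (hilbTangentEquiv J₁ x) + b • l (hilbTangentEquiv J₂ x)
  rw [hilbTangentEquiv_linear a b hJ h₁ h₂ h₃, map_add, map_smul, map_smul]

end ApolarTangent

end

noncomputable section

open Module

/-! ### Structure constants -/

section StructureConstants

/-- The index set of the structure constants of an algebra with basis indexed by `ι`, together
with the coordinates of its unit. -/
abbrev ScIndex (ι : Type*) := (ι × ι × ι) ⊕ ι

variable {R B ι : Type*} [CommRing R] [CommRing B] [Algebra R B]

/-- The structure constants of an algebra with respect to a basis, and the coordinates of `1`. -/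
def structureConstants (b : Basis ι R B) : ScIndex ι → R :=
  Sum.elim (fun s => b.repr (b s.1 * b s.2.1) s.2.2) fun l => b.repr 1 l

theorem structureConstants_inl (b : Basis ι R B) (i j l : ι) :
    structureConstants b (Sum.inl (i, j, l)) = b.repr (b i * b j) l := rfl

theorem structureConstants_inr (b : Basis ι R B) (l : ι) :
    structureConstants b (Sum.inr l) = b.repr 1 l := rfl

theorem sum_structureConstants_inl [Fintype ι] (b : Basis ι R B) (i j : ι) :
    ∑ l, structureConstants b (Sum.inl (i, j, l)) • b l = b i * b j :=
  b.sum_repr (b i * b j)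

theorem sum_structureConstants_inr [Fintype ι] (b : Basis ι R B) :
    ∑ l, structureConstants b (Sum.inr l) • b l = 1 :=
  b.sum_repr 1

section BaseChange

variable {R' B' : Type*} [CommRing R'] [CommRing B'] [Algebra R' B']

/-- A semilinear ring homomorphism that matches bases matches coordinates. -/
theorem repr_ringHom_apply [Finite ι] (φ : R →+* R') (ρ : B →+* B')
    (hρ : ∀ r, ρ (algebraMap R B r) = algebraMap R' B' (φ r)) {b : Basis ι R B}
    {b' : Basis ι R' B'} (hb : ∀ i, ρ (b i) = b' i) (x : B) (l : ι) :
    b'.repr (ρ x) l = φ (b.repr x l) := by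
  have := Fintype.ofFinite ι
  have h : ρ x = ∑ i, φ (b.repr x i) • b' i := by
    conv_lhs => rw [← b.sum_repr x]
    rw [map_sum]
    refine Finset.sum_congr rfl fun i _ => ?_
    rw [Algebra.smul_def, map_mul, hρ, hb, Algebra.smul_def]
  rw [h, b'.repr_sum_self]

/-- Structure constants are compatible with base change. -/
theorem structureConstants_of_semilinear [Finite ι] (φ : R →+* R') (ρ : B →+* B')
    (hρ : ∀ r, ρ (algebraMap R B r) = algebraMap R' B' (φ r)) {b : Basis ι R B}
    {b' : Basis ι R' B'} (hb : ∀ i, ρ (b i) = b' i) (s : ScIndex ι) :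
    structureConstants b' s = φ (structureConstants b s) := by
  rcases s with ⟨i, j, l⟩ | l
  · rw [structureConstants_inl, structureConstants_inl, ← repr_ringHom_apply φ ρ hρ hb, ρ.map_mul,
      hb, hb]
  · rw [structureConstants_inr, structureConstants_inr, ← repr_ringHom_apply φ ρ hρ hb, ρ.map_one]

end BaseChange

theorem structureConstants_map [Finite ι] {B' : Type*} [CommRing B'] [Algebra R B'] (e : B ≃ₐ[R] B')
    (b : Basis ι R B) : structureConstants (b.map e.toLinearEquiv) = structureConstants b :=
  funext fun s => structureConstants_of_semilinear (RingHom.id R) (e : B →+* B')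
    (fun r => e.commutes r) (b := b) (fun i => by simp) s

/-- The polynomials that express the structure constants with respect to a second basis `b'`
through those with respect to `b`. -/
def changeOfBasisPoly {ι' : Type*} [Fintype ι] (b : Basis ι R B) (b' : Basis ι' R B) :
    ScIndex ι' → MvPolynomial (ScIndex ι) R :=
  Sum.elim
    (fun s => ∑ x, ∑ y, ∑ z, MvPolynomial.C (b.repr (b' s.1) x * b.repr (b' s.2.1) y *
      b'.repr (b z) s.2.2) * MvPolynomial.X (Sum.inl (x, y, z)))
    fun l => ∑ z, MvPolynomial.C (b'.repr (b z) l) * MvPolynomial.X (Sum.inr z)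

theorem eval_changeOfBasisPoly {ι' C : Type*} [Fintype ι] [CommRing C] [Algebra R C]
    (b : Basis ι R B) (b' : Basis ι' R B) (e : B ≃ₗ[R] C) (s : ScIndex ι') :
    MvPolynomial.eval (structureConstants (b.map e)) (changeOfBasisPoly b b' s) =
      structureConstants (b'.map e) s := by
  have hrepr : ∀ z l, (b'.map e).repr ((b.map e) z) l = b'.repr (b z) l := fun z l => by simp
  have hexp : ∀ i, (b'.map e) i = ∑ x, b.repr (b' i) x • (b.map e) x := fun i => by
    simp only [Basis.map_apply]
    conv_lhs => rw [← b.sum_repr (b' i)]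
    simp only [map_sum, map_smul]
  rcases s with ⟨i, j, l⟩ | l
  · rw [structureConstants_inl, hexp i, hexp j, Finset.sum_mul_sum]
    simp only [changeOfBasisPoly, Sum.elim_inl, map_sum, map_mul, MvPolynomial.eval_C,
      MvPolynomial.eval_X, Finsupp.coe_finsetSum, Finset.sum_apply]
    refine Finset.sum_congr rfl fun x _ => Finset.sum_congr rfl fun y _ => ?_
    rw [smul_mul_smul_comm, ← sum_structureConstants_inl (b.map e) x y]
    simp only [map_smul, map_sum, Finsupp.smul_apply, Finsupp.coe_finsetSum, Finset.sum_apply,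
      hrepr, smul_eq_mul, Finset.mul_sum]
    exact Finset.sum_congr rfl fun z _ => by ring
  · rw [structureConstants_inr, ← sum_structureConstants_inr (b.map e)]
    simp only [changeOfBasisPoly, Sum.elim_inr, map_sum, map_mul, MvPolynomial.eval_C,
      MvPolynomial.eval_X, map_smul, Finsupp.smul_apply, Finsupp.coe_finsetSum, Finset.sum_apply,
      hrepr, smul_eq_mul]
    exact Finset.sum_congr rfl fun z _ => mul_comm _ _

end StructureConstants

/-! ### Limits of split algebras -/

section SplitLimit

variable {k : Type*} [Field k]

/-- The point `c` of the affine space of structure constants lies in the Zariski closure of the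
structure constants of the split algebras `k ^ κ`. -/
def IsSplitLimit {ι : Type} (c : ScIndex ι → k) : Prop :=
  ∀ P : MvPolynomial (ScIndex ι) k,
    (∀ (κ : Type) [Finite κ] (b : Basis ι k (κ → k)),
      MvPolynomial.eval (structureConstants b) P = 0) → MvPolynomial.eval c P = 0

/-- The structure constants of `A`, with respect to any finite basis, are limits of structure
constants of split algebras. -/
def IsLimitOfSplit (k A : Type*) [Field k] [CommRing A] [Algebra k A] : Prop :=
  ∀ (ι : Type) [Finite ι] (b : Basis ι k A), IsSplitLimit (structureConstants b)

variable {A A' : Type*} [CommRing A] [Algebra k A] [CommRing A'] [Algebra k A']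

theorem eval_bind₁_changeOfBasisPoly {ι ι' C : Type*} [Fintype ι] [CommRing C] [Algebra k C]
    (b : Basis ι k A) (b' : Basis ι' k A) (e : A ≃ₗ[k] C) (P : MvPolynomial (ScIndex ι') k) :
    MvPolynomial.eval (structureConstants (b.map e)) (MvPolynomial.bind₁ (changeOfBasisPoly b b') P)
      = MvPolynomial.eval (structureConstants (b'.map e)) P := by
  rw [MvPolynomial.eval, MvPolynomial.eval₂Hom_bind₁]
  congr 2
  funext s
  exact eval_changeOfBasisPoly b b' e s

theorem IsSplitLimit.of_basis {ι ι' : Type} [Finite ι] {b : Basis ι k A}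
    (h : IsSplitLimit (structureConstants b)) (b' : Basis ι' k A) :
    IsSplitLimit (structureConstants b') := by
  have := Fintype.ofFinite ι
  intro P hP
  have h2 := h (MvPolynomial.bind₁ (changeOfBasisPoly b b') P) fun κ _ c => by
    have e1 : b.map (b.equiv c (Equiv.refl ι)) = c := by
      refine Basis.eq_of_apply_eq fun i => ?_
      rw [Basis.map_apply, Basis.equiv_apply, Equiv.refl_apply]
    rw [← e1, eval_bind₁_changeOfBasisPoly]
    exact hP κ _
  have h3 := eval_bind₁_changeOfBasisPoly b b' (LinearEquiv.refl k A) P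
  have h4 : b.map (LinearEquiv.refl k A) = b := Basis.eq_of_apply_eq fun i => rfl
  have h5 : b'.map (LinearEquiv.refl k A) = b' := Basis.eq_of_apply_eq fun i => rfl
  rw [h4, h5] at h3
  rw [← h3, h2]

theorem IsSplitLimit.isLimitOfSplit {ι : Type} [Finite ι] {b : Basis ι k A}
    (h : IsSplitLimit (structureConstants b)) : IsLimitOfSplit k A :=
  fun _ _ b' => h.of_basis b'

theorem IsLimitOfSplit.of_algEquiv (h : IsLimitOfSplit k A) (e : A ≃ₐ[k] A') :
    IsLimitOfSplit k A' := fun ι _ b => by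
  rw [← structureConstants_map e.symm b]
  exact h ι _

theorem isLimitOfSplit_pi (κ : Type) [Finite κ] : IsLimitOfSplit k (κ → k) :=
  fun _ _ b _ hP => hP κ b

/-- The structure constants of a product of algebras. -/
def prodStructureConstants {R ι ι' : Type*} [Zero R] (c : ScIndex ι → R) (c' : ScIndex ι' → R) :
    ScIndex (ι ⊕ ι') → R
  | Sum.inl (Sum.inl i, Sum.inl j, Sum.inl l) => c (Sum.inl (i, j, l))
  | Sum.inl (Sum.inr i, Sum.inr j, Sum.inr l) => c' (Sum.inl (i, j, l))
  | Sum.inr (Sum.inl l) => c (Sum.inr l)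
  | Sum.inr (Sum.inr l) => c' (Sum.inr l)
  | _ => 0

theorem structureConstants_prod {ι ι' : Type*} (b : Basis ι k A) (b' : Basis ι' k A') :
    structureConstants (b.prod b') =
      prodStructureConstants (structureConstants b) (structureConstants b') := by
  funext s
  rcases s with ⟨i | i, j | j, l | l⟩ | (l | l) <;>
    simp [structureConstants, prodStructureConstants]

theorem IsLimitOfSplit.prod [Module.Finite k A] [Module.Finite k A'] (h : IsLimitOfSplit k A)
    (h' : IsLimitOfSplit k A') : IsLimitOfSplit k (A × A') := by
  let b := Module.finBasis k A
  let b' := Module.finBasis k A'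
  refine IsSplitLimit.isLimitOfSplit (b := b.prod b') ?_
  rw [structureConstants_prod]
  intro P hP
  -- Fix one factor and let the other one vary.
  have key1 : ∀ {ι ι' : Type} (P : MvPolynomial (ScIndex (ι ⊕ ι')) k) (c' : ScIndex ι' → k),
      ∃ Q : MvPolynomial (ScIndex ι) k, ∀ c, MvPolynomial.eval c Q =
        MvPolynomial.eval (prodStructureConstants c c') P := by
    intro ι ι' P c'
    refine ⟨MvPolynomial.bind₁ (prodStructureConstants MvPolynomial.X
      fun s => MvPolynomial.C (c' s)) P, fun c => ?_⟩
    rw [MvPolynomial.eval, MvPolynomial.eval₂Hom_bind₁]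
    congr 2
    funext s
    rcases s with ⟨i | i, j | j, l | l⟩ | (l | l) <;> simp [prodStructureConstants]
  have key2 : ∀ {ι ι' : Type} (P : MvPolynomial (ScIndex (ι ⊕ ι')) k) (c : ScIndex ι → k),
      ∃ Q : MvPolynomial (ScIndex ι') k, ∀ c', MvPolynomial.eval c' Q =
        MvPolynomial.eval (prodStructureConstants c c') P := by
    intro ι ι' P c
    refine ⟨MvPolynomial.bind₁ (prodStructureConstants (fun s => MvPolynomial.C (c s))
      MvPolynomial.X) P, fun c' => ?_⟩
    rw [MvPolynomial.eval, MvPolynomial.eval₂Hom_bind₁]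
    congr 2
    funext s
    rcases s with ⟨i | i, j | j, l | l⟩ | (l | l) <;> simp [prodStructureConstants]
  obtain ⟨Q, hQ⟩ := key1 P (structureConstants b')
  rw [← hQ]
  refine h _ b Q fun κ _ c => ?_
  obtain ⟨Q', hQ'⟩ := key2 P (structureConstants c)
  rw [hQ, ← hQ']
  refine h' _ b' Q' fun κ' _ c' => ?_
  rw [hQ', ← structureConstants_prod,
    ← structureConstants_map (AlgEquiv.sumArrowEquivProdArrow κ κ' k k).symm (c.prod c')]
  exact hP _ _

theorem IsLimitOfSplit.pi_fin [Module.Finite k A] (h : IsLimitOfSplit k A) (n : ℕ) :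
    IsLimitOfSplit k (Fin n → A) := by
  induction n with
  | zero =>
    refine (isLimitOfSplit_pi (Fin 0)).of_algEquiv (AlgEquiv.ofBijective
      (AlgHom.pi (R := k) fun i => i.elim0) ⟨fun _ _ _ => Subsingleton.elim _ _,
        fun _ => ⟨0, Subsingleton.elim _ _⟩⟩)
  | succ n ih =>
    exact (h.prod ih).of_algEquiv
      { toFun := fun x => Fin.cons x.1 x.2
        invFun := fun x => (x 0, fun i => x i.succ)
        left_inv := fun x => by simp
        right_inv := fun x => by funext i; refine Fin.cases ?_ (fun i => ?_) i <;> simp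
        map_mul' := fun x y => by funext i; refine Fin.cases ?_ (fun i => ?_) i <;> simp
        map_add' := fun x y => by funext i; refine Fin.cases ?_ (fun i => ?_) i <;> simp
        commutes' := fun c => by funext i; refine Fin.cases ?_ (fun i => ?_) i <;> simp }

end SplitLimit

end

noncomputable section

open Polynomial hiding contract contract_one

/-! ### Degeneration to the quotient by a ray ideal -/

section RayDegeneration

variable {k S : Type*} [Field k] [CommRing S]

/-- The polynomial `X ∏ (X - a j) - D`, a deformation of `X ^ d - D`. -/
def deformPoly {n : ℕ} (a : Fin n → S) (D : S) : S[X] := X * ∏ j, (X - C (a j)) - C D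

theorem deformPoly_monic_and_natDegree [Nontrivial S] {n : ℕ} (a : Fin n → S) (D : S) :
    (deformPoly a D).Monic ∧ (deformPoly a D).natDegree = n + 1 := by
  have h1 : (∏ j, (X - C (a j))).Monic := monic_prod_X_sub_C a _
  have h2 : (X * ∏ j, (X - C (a j))).natDegree = n + 1 := by
    rw [monic_X.natDegree_mul h1, natDegree_finsetProd_X_sub_C_eq_card]
    simp [add_comm]
  have h3 : (C D).degree < (X * ∏ j, (X - C (a j))).degree := by
    refine degree_C_le.trans_lt ?_
    rw [degree_eq_natDegree (monic_X.mul h1).ne_zero, h2]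
    exact_mod_cast Nat.succ_pos n
  exact ⟨(monic_X.mul h1).sub_of_left h3, by rw [deformPoly, natDegree_sub_C, h2]⟩

theorem coeff_deformPoly_zero {n : ℕ} (a : Fin n → S) (D : S) :
    (deformPoly a D).coeff 0 = -D := by
  rw [deformPoly, coeff_sub, coeff_X_mul_zero, coeff_C_zero, zero_sub]

theorem deformPoly_zero (n : ℕ) (D : S) : deformPoly (0 : Fin n → S) D = rayPoly (n + 1) D := by
  simp [deformPoly, rayPoly, pow_succ']

theorem map_deformPoly {S' : Type*} [CommRing S'] (φ : S →+* S') {n : ℕ} (a : Fin n → S) (D : S) :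
    (deformPoly a D).map φ = deformPoly (fun j => φ (a j)) (φ D) := by
  simp [deformPoly, Polynomial.map_prod]

theorem eval_mem_of_coeff_mem {K : Ideal S} {r : S[X]} (h : ∀ i, r.coeff i ∈ K) (x : S) :
    r.eval x ∈ K := by
  rw [eval_eq_sum_range]
  exact sum_mem fun i _ => K.mul_mem_right _ (h i)

variable [Algebra k S]

/-- A polynomial of small degree with many values in `K` has its coefficients in `K`. -/
theorem coeff_mem_of_eval_mem {K : Ideal S} {ν : Type*} [Fintype ν] {x : ν → k}
    (hx : Function.Injective x) {r : S[X]} (hr : r.natDegree < Fintype.card ν)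
    (h : ∀ j, r.eval (algebraMap k S (x j)) ∈ K) (i : ℕ) : r.coeff i ∈ K := by
  rw [← mkLin_eq_zero (k := k), ← Module.forall_dual_apply_eq_zero_iff k]
  intro l
  set μ : S →ₗ[k] k := l ∘ₗ mkLin k K with hμ
  set ρ : k[X] := polyOfCoeff (Fintype.card ν) fun i => μ (r.coeff i) with hρ
  have hρ0 : ρ = 0 := by
    refine eq_zero_of_natDegree_lt_card_of_eval_eq_zero ρ hx (fun j => ?_) ?_
    · have h1 : ρ.eval (x j) = μ (r.eval (algebraMap k S (x j))) := by
        rw [hρ, polyOfCoeff, eval_finsetSum, eval_eq_sum_range' hr, map_sum]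
        refine Finset.sum_congr rfl fun i _ => ?_
        rw [eval_mul, eval_C, eval_pow, eval_X, mul_comm, mul_comm (r.coeff i), ← map_pow,
          ← Algebra.smul_def, map_smul, smul_eq_mul]
      rw [h1, hμ, LinearMap.comp_apply, mkLin_eq_zero.2 (h j), map_zero]
    · refine (natDegree_sum_le_of_forall_le (n := Fintype.card ν - 1) _ _ fun i hi => ?_).trans_lt
        (by omega)
      exact (natDegree_C_mul_X_pow_le _ _).trans (by rw [Finset.mem_range] at hi; omega)
  by_cases hi : i < Fintype.card ν
  · have := coeff_polyOfCoeff (fun i => μ (r.coeff i)) hi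
    rw [← hρ, hρ0, coeff_zero] at this
    exact this.symm
  · rw [coeff_eq_zero_of_natDegree_lt (by omega), map_zero, map_zero]

/-- For distinct nonzero `a j`, the quotient by the ray ideal of the deformed polynomial is the
product of `S ⧸ I` and copies of `S ⧸ K`: put `X = D / ∏ (-a j)`, respectively `X = a j`. -/
theorem nonempty_rayQuotient_algEquiv [Nontrivial S] {I K : Ideal S} [Module.Finite k (S ⧸ I)]
    [Module.Finite k (S ⧸ K)] {D : S} (hIK : I ≤ K) (hDK : D ∈ K) (hD2 : D * D ∈ I)
    (hKD : ∀ κ ∈ K, κ * D ∈ I) {n : ℕ} {a : Fin n → k} (ha : Function.Injective a)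
    (ha0 : ∀ j, a j ≠ 0) :
    Nonempty ((S[X] ⧸ rayIdeal I K (deformPoly (fun j => algebraMap k S (a j)) D)) ≃ₐ[k]
      (S ⧸ I) × (Fin n → S ⧸ K)) := by
  obtain ⟨hq, hqd⟩ := deformPoly_monic_and_natDegree (fun j => algebraMap k S (a j)) D
  have hcomp : ∀ κ ∈ K, κ * (deformPoly (fun j => algebraMap k S (a j)) D).coeff 0 ∈ I := by
    intro κ hκ
    rw [coeff_deformPoly_zero, mul_neg, neg_mem_iff]
    exact hKD κ hκ
  set q := deformPoly (fun j => algebraMap k S (a j)) D with hqdef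
  set e : k := ∏ j, (-a j) with he
  have he0 : e ≠ 0 := Finset.prod_ne_zero_iff.2 fun j _ => neg_ne_zero.2 (ha0 j)
  set x : S := D * algebraMap k S e⁻¹ with hx
  have hxK : x ∈ K := K.mul_mem_right _ hDK
  let Ψ : S[X] →ₐ[k] (S ⧸ I) × (Fin n → S ⧸ K) :=
    AlgHom.prod ((Ideal.Quotient.mkₐ k I).comp ((aeval x : S[X] →ₐ[S] S).restrictScalars k))
      (AlgHom.pi fun j => (Ideal.Quotient.mkₐ k K).comp
        ((aeval (algebraMap k S (a j)) : S[X] →ₐ[S] S).restrictScalars k))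
  have hΨ : ∀ p, Ψ p = 0 ↔ p.eval x ∈ I ∧ ∀ j, p.eval (algebraMap k S (a j)) ∈ K := by
    intro p
    change ((Ideal.Quotient.mk I (aeval x p), fun j => Ideal.Quotient.mk K (aeval _ p)) :
      (S ⧸ I) × (Fin n → S ⧸ K)) = 0 ↔ _
    rw [Prod.mk_eq_zero, Ideal.Quotient.eq_zero_iff_mem, coe_aeval_eq_eval, funext_iff]
    simp only [coe_aeval_eq_eval, Pi.zero_apply, Ideal.Quotient.eq_zero_iff_mem]
  have hqx : q.eval x ∈ I := by
    have h1 : x - 0 ∣ (∏ j, (X - C (algebraMap k S (a j)))).eval x -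
        (∏ j, (X - C (algebraMap k S (a j)))).eval 0 := sub_dvd_eval_sub _ _ _
    obtain ⟨y, hy⟩ := h1
    have h2 : (∏ j, (X - C (algebraMap k S (a j)))).eval 0 = algebraMap k S e := by
      rw [eval_prod, he, map_prod]
      simp
    have h3 : D = x * algebraMap k S e := by
      rw [hx, mul_assoc, ← map_mul, inv_mul_cancel₀ he0, map_one, mul_one]
    have h4 : q.eval x = D * D * (algebraMap k S e⁻¹ * algebraMap k S e⁻¹ * y) := by
      rw [hqdef, deformPoly, eval_sub, eval_mul, eval_X, eval_C]
      rw [h2, sub_zero] at hy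
      calc _ = x * ((∏ j, (X - C (algebraMap k S (a j)))).eval x - algebraMap k S e) := by
            rw [mul_sub, ← h3]
        _ = _ := by rw [hy, hx]; ring
    rw [h4]
    exact I.mul_mem_right _ hD2
  have hle : rayIdeal I K q ≤ RingHom.ker Ψ := by
    refine rayIdeal_le (fun s hs => ?_) (fun s hs => ?_) ?_ <;> rw [RingHom.mem_ker, hΨ]
    · rw [eval_C]
      exact ⟨hs, fun j => by rw [eval_C]; exact hIK hs⟩
    · rw [eval_mul, eval_X, eval_C]
      refine ⟨?_, fun j => by rw [eval_mul, eval_C]; exact K.mul_mem_left _ hs⟩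
      rw [hx, mul_comm, ← mul_assoc]
      exact I.mul_mem_right _ (hKD s hs)
    · refine ⟨hqx, fun j => ?_⟩
      rw [hqdef, deformPoly, eval_sub, eval_mul, eval_prod, Finset.prod_eq_zero (Finset.mem_univ j),
        mul_zero, eval_C, zero_sub, neg_mem_iff]
      · exact hDK
      · simp
  have hker : ∀ p, Ψ p = 0 → p ∈ rayIdeal I K q := by
    intro p hp
    set r := p %ₘ q with hr
    have hpr : Ψ r = 0 := by
      have h1 : q * (p /ₘ q) ∈ RingHom.ker Ψ := (RingHom.ker Ψ).mul_mem_right _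
        (hle self_mem_rayIdeal)
      have h2 := congrArg Ψ (modByMonic_add_div p q)
      rwa [map_add, hp, RingHom.mem_ker.1 h1, add_zero] at h2
    obtain ⟨h0, h1⟩ := (hΨ r).1 hpr
    have hrd : r.natDegree < n + 1 := by
      rw [← hqd]
      exact natDegree_modByMonic_lt p hq fun h => by rw [h, natDegree_one] at hqd; omega
    obtain ⟨y, hy⟩ : x - 0 ∣ r.eval x - r.eval 0 := sub_dvd_eval_sub _ _ _
    rw [sub_zero] at hy
    have hr0 : r.eval 0 ∈ K := by
      have := K.sub_mem (hIK h0) (hy ▸ K.mul_mem_right y hxK : r.eval x - r.eval 0 ∈ K)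
      rwa [sub_sub_cancel] at this
    let z : Option (Fin n) → k := fun j => j.elim 0 a
    have hz : Function.Injective z := by
      rintro (_ | i) (_ | j) h
      · rfl
      · exact absurd h.symm (ha0 j)
      · exact absurd h (ha0 i)
      · exact congrArg some (ha h)
    have hcoeff : ∀ i, r.coeff i ∈ K := coeff_mem_of_eval_mem hz (by simpa using hrd) (by
      rintro (_ | j)
      · change r.eval (algebraMap k S 0) ∈ K
        rwa [map_zero]
      · exact h1 j)
    rw [mem_rayIdeal_iff hq (by omega) hIK hcomp, ← hr]
    refine ⟨?_, fun j => hcoeff _⟩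
    have h3 : r.eval x = (r.divX).eval x * x + r.coeff 0 := by
      conv_lhs => rw [← divX_mul_X_add r]
      rw [eval_add, eval_mul, eval_X, eval_C]
    have h4 : (r.divX).eval x * x ∈ I := by
      rw [hx, ← mul_assoc]
      refine I.mul_mem_right _ (hKD _ (eval_mem_of_coeff_mem (fun i => ?_) _))
      rw [coeff_divX]
      exact hcoeff _
    rw [h3] at h0
    exact (I.add_mem_iff_right h4).1 h0
  have hfin : Module.Finite k (S[X] ⧸ rayIdeal I K q) :=
    finite_quotient_rayIdeal hq hqd (by omega) hIK hcomp
  let Ψ' : (S[X] ⧸ rayIdeal I K q) →ₐ[k] (S ⧸ I) × (Fin n → S ⧸ K) :=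
    Ideal.Quotient.liftₐ _ Ψ fun p hp => hle hp
  have hinj : Function.Injective Ψ' := by
    rw [injective_iff_map_eq_zero]
    intro y hy
    obtain ⟨p, rfl⟩ := Ideal.Quotient.mk_surjective y
    exact Ideal.Quotient.eq_zero_iff_mem.2 (hker p hy)
  have hrank : Module.finrank k (S[X] ⧸ rayIdeal I K q) =
      Module.finrank k ((S ⧸ I) × (Fin n → S ⧸ K)) := by
    rw [finrank_quotient_rayIdeal hq hqd (by omega) hIK hcomp, Module.finrank_prod,
      Module.finrank_pi_fintype]
    simp
  exact ⟨AlgEquiv.ofBijective Ψ' ⟨hinj,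
    (LinearMap.injective_iff_surjective_of_finrank_eq_finrank (f := Ψ'.toLinearMap) hrank).1 hinj⟩⟩

theorem exists_eval_eq_apply_eval (l : S →ₗ[k] k) (c : S[X]) :
    ∃ w : k[X], ∀ t, w.eval t = l (c.eval (algebraMap k S t)) := by
  refine ⟨∑ i ∈ c.support, C (l (c.coeff i)) * X ^ i, fun t => ?_⟩
  rw [eval_finsetSum, eval_eq_sum, Polynomial.sum, map_sum]
  refine Finset.sum_congr rfl fun i _ => ?_
  rw [eval_mul, eval_C, eval_pow, eval_X, mul_comm, mul_comm (c.coeff i), ← map_pow,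
    ← Algebra.smul_def, map_smul, smul_eq_mul]

/-- Linear functions of the coordinates of a fixed element are polynomial in `t` along the family
`X ∏ (X - t c j) - D`: division by this polynomial can be done over `S[t]`. -/
theorem exists_eval_eq_apply_rayCoord [Nontrivial S] (I K : Ideal S) (D : S) {n : ℕ} (c : Fin n → k)
    (l : (S ⧸ I) × (Fin n → S ⧸ K) →ₗ[k] k) (p : S[X]) :
    ∃ w : k[X], ∀ t, w.eval t = l (rayCoord k I K
      (deformPoly (fun j => algebraMap k S (t * c j)) D) (n + 1) p) := by
  set Q : S[X][X] := deformPoly (fun j => X * C (algebraMap k S (c j))) (C D) with hQ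
  have hQm : Q.Monic := (deformPoly_monic_and_natDegree _ _).1
  have hmap : ∀ t, Q.map (evalRingHom (algebraMap k S t)) =
      deformPoly (fun j => algebraMap k S (t * c j)) D := fun t => by
    rw [hQ, map_deformPoly]
    simp only [map_mul, coe_evalRingHom, eval_X, eval_C]
  have hcoeff : ∀ t i, (p %ₘ deformPoly (fun j => algebraMap k S (t * c j)) D).coeff i =
      ((p.map C %ₘ Q).coeff i).eval (algebraMap k S t) := fun t i => by
    rw [← hmap, ← coe_evalRingHom, ← coeff_map, map_modByMonic _ hQm, map_map]
    congr 2
    have : (evalRingHom (algebraMap k S t)).comp C = RingHom.id S := by ext; simp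
    rw [this, Polynomial.map_id]
  obtain ⟨w0, hw0⟩ := exists_eval_eq_apply_eval (l ∘ₗ LinearMap.inl k _ _ ∘ₗ mkLin k I)
    ((p.map C %ₘ Q).coeff 0)
  choose w hw using fun j : Fin n => exists_eval_eq_apply_eval
    (l ∘ₗ LinearMap.inr k _ _ ∘ₗ LinearMap.single k (fun _ : Fin n => S ⧸ K) j ∘ₗ mkLin k K)
    ((p.map C %ₘ Q).coeff (j + 1))
  refine ⟨w0 + ∑ j, w j, fun t => ?_⟩
  rw [eval_add, eval_finsetSum, hw0]
  simp only [hw, ← hcoeff, LinearMap.comp_apply]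
  rw [← map_sum, ← map_add, ← map_sum]
  congr 1
  have hsum := LinearMap.sum_single_apply (fun _ : Fin n => S ⧸ K) fun j =>
    mkLin k K ((p %ₘ deformPoly (fun j => algebraMap k S (t * c j)) D).coeff (j + 1))
  refine Prod.ext (add_zero _) ((zero_add _).trans ?_)
  exact hsum

/-- If `S ⧸ I` and `S ⧸ K` are limits of split algebras, so is the quotient by the ray ideal of
`X ^ d - D`. -/
theorem IsLimitOfSplit.quotient_rayIdeal [Infinite k] [Nontrivial S] {I K : Ideal S}
    [Module.Finite k (S ⧸ I)] [Module.Finite k (S ⧸ K)] {D : S} (hIK : I ≤ K) (hDK : D ∈ K)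
    (hD2 : D * D ∈ I) (hKD : ∀ κ ∈ K, κ * D ∈ I) (hI : IsLimitOfSplit k (S ⧸ I))
    (hK : IsLimitOfSplit k (S ⧸ K)) {d : ℕ} (hd : 1 ≤ d) :
    IsLimitOfSplit k (S[X] ⧸ rayIdeal I K (rayPoly d D)) := by
  obtain ⟨n, rfl⟩ : ∃ n, d = n + 1 := ⟨d - 1, by omega⟩
  set c : Fin n → k := fun j => Infinite.natEmbedding k (j + 1) - Infinite.natEmbedding k 0 with hc
  have hcinj : Function.Injective c := fun i j h => by
    have := (Infinite.natEmbedding k).injective (sub_left_injective h)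
    exact Fin.ext (by omega)
  have hc0 : ∀ j, c j ≠ 0 := fun j h => by
    have := (Infinite.natEmbedding k).injective (sub_eq_zero.1 h)
    omega
  set q : k → S[X] := fun t => deformPoly (fun j => algebraMap k S (t * c j)) D with hq
  have hqm : ∀ t, (q t).Monic := fun t => (deformPoly_monic_and_natDegree _ _).1
  have hqd : ∀ t, (q t).natDegree = n + 1 := fun t => (deformPoly_monic_and_natDegree _ _).2
  have hcomp : ∀ t, ∀ κ ∈ K, κ * (q t).coeff 0 ∈ I := fun t κ hκ => by
    rw [hq, coeff_deformPoly_zero, mul_neg, neg_mem_iff]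
    exact hKD κ hκ
  have hq0 : q 0 = rayPoly (n + 1) D := by
    rw [← deformPoly_zero, hq]
    simp only [zero_mul, map_zero]
    rfl
  let β := Module.finBasis k ((S ⧸ I) × (Fin (n + 1 - 1) → S ⧸ K))
  choose r hr using fun i => exists_forall_rayCoord_eq (k := k) I K hd (β i)
  let e := fun t => rayQuotEquiv k (hqm t) (hqd t) hd hIK (hcomp t)
  have he : ∀ t p, e t (Ideal.Quotient.mk _ p) = rayCoord k I K (q t) (n + 1) p :=
    fun t p => quotientLinearEquivOfSurjective_mk _ _ _ _ _
  let b := fun t => β.map (e t).symm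
  have hb : ∀ t i, b t i = Ideal.Quotient.mk _ (r i) := fun t i => by
    rw [Module.Basis.map_apply, LinearEquiv.symm_apply_eq, he, hr i _ (hqm t) (hqd t)]
  have hsc : ∀ s, ∃ w : k[X], ∀ t, w.eval t = structureConstants (b t) s := by
    rintro (⟨i, j, l⟩ | l)
    · obtain ⟨w, hw⟩ := exists_eval_eq_apply_rayCoord I K D c (β.coord l) (r i * r j)
      refine ⟨w, fun t => ?_⟩
      rw [hw, structureConstants_inl, hb, hb, ← map_mul]
      simp only [b, Module.Basis.map_repr, LinearEquiv.symm_symm, LinearEquiv.trans_apply, he]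
      rfl
    · obtain ⟨w, hw⟩ := exists_eval_eq_apply_rayCoord I K D c (β.coord l) 1
      refine ⟨w, fun t => ?_⟩
      rw [hw, structureConstants_inr, ← map_one (Ideal.Quotient.mk _)]
      simp only [b, Module.Basis.map_repr, LinearEquiv.symm_symm, LinearEquiv.trans_apply, he]
      rfl
  choose w hw using hsc
  suffices h : IsSplitLimit (structureConstants (b 0)) by
    have := h.isLimitOfSplit
    rwa [hq0] at this
  intro P hP
  set W : k[X] := MvPolynomial.aeval w P with hW
  have hWt : ∀ t, W.eval t = MvPolynomial.eval (structureConstants (b t)) P := fun t => by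
    have h1 : structureConstants (b t) = fun s => (w s).eval t := funext fun s => (hw s t).symm
    rw [h1, hW, ← coe_aeval_eq_eval, ← AlgHom.comp_apply, MvPolynomial.comp_aeval]
    rfl
  -- The polynomial `W` vanishes away from the origin, hence everywhere.
  have hW0 : W * X = 0 := by
    refine funext fun t => ?_
    rw [eval_mul, eval_X, eval_zero]
    rcases eq_or_ne t 0 with rfl | ht
    · rw [mul_zero]
    have hinj : Function.Injective fun j => t * c j := fun i j h => hcinj (mul_left_cancel₀ ht h)
    obtain ⟨Φ⟩ := nonempty_rayQuotient_algEquiv hIK hDK hD2 hKD hinj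
      fun j => mul_ne_zero ht (hc0 j)
    rw [hWt, ((hI.prod (hK.pi_fin n)).of_algEquiv Φ.symm) _ (b t) P hP, zero_mul]
  have hW1 : W = 0 := (mul_eq_zero.1 hW0).resolve_right X_ne_zero
  rw [← hWt, hW1, eval_zero]

end RayDegeneration

end

noncomputable section

open Module

/-! ### Base change of algebras with a basis -/

section BaseChange

variable {R R' B B' ι : Type*} [CommRing R] [CommRing B] [Algebra R B] [CommRing R'] [CommRing B']
  [Algebra R' B']

theorem mem_ideal_map_iff_repr [Finite ι] (b : Basis ι R B) (𝔞 : Ideal R) {x : B} :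
    x ∈ 𝔞.map (algebraMap R B) ↔ ∀ i, b.repr x i ∈ 𝔞 := by
  have := Fintype.ofFinite ι
  constructor
  · intro hx
    have hx' : x ∈ (𝔞 • ⊤ : Submodule R B) := by
      rw [Ideal.smul_top_eq_map]
      exact hx
    refine Submodule.smul_induction_on hx' (fun r hr y _ i => ?_) fun y z hy hz i => ?_
    · rw [map_smul, Finsupp.smul_apply, smul_eq_mul]
      exact 𝔞.mul_mem_right _ hr
    · rw [map_add, Finsupp.add_apply]
      exact 𝔞.add_mem (hy i) (hz i)
  · intro h
    rw [← b.sum_repr x]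
    refine sum_mem fun i _ => ?_
    rw [Algebra.smul_def]
    exact Ideal.mul_mem_right _ _ (Ideal.mem_map_of_mem _ (h i))

theorem ker_of_semilinear [Finite ι] (φ : R →+* R') (ρ : B →+* B')
    (hρ : ∀ r, ρ (algebraMap R B r) = algebraMap R' B' (φ r)) {b : Basis ι R B}
    {b' : Basis ι R' B'} (hb : ∀ i, ρ (b i) = b' i) :
    RingHom.ker ρ = (RingHom.ker φ).map (algebraMap R B) := by
  ext x
  rw [mem_ideal_map_iff_repr b, RingHom.mem_ker, ← b'.repr.map_eq_zero_iff, Finsupp.ext_iff]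
  exact forall_congr' fun i => by rw [repr_ringHom_apply φ ρ hρ hb]; rfl

/-- Two algebras whose structure constants correspond are related by base change. -/
theorem exists_ringHom_of_structureConstants [Finite ι] (φ : R →+* R') (b : Basis ι R B)
    (b' : Basis ι R' B') (h : ∀ s, structureConstants b' s = φ (structureConstants b s)) :
    ∃ ρ : B →+* B', (∀ r, ρ (algebraMap R B r) = algebraMap R' B' (φ r)) ∧
      ∀ i, ρ (b i) = b' i := by
  have := Fintype.ofFinite ι
  let ρ : B →+ B' :=
    { toFun := fun x => ∑ i, φ (b.repr x i) • b' i
      map_zero' := by simp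
      map_add' := fun x y => by simp [add_smul, Finset.sum_add_distrib] }
  have hρ : ∀ x, ρ x = ∑ i, φ (b.repr x i) • b' i := fun x => rfl
  have hsmul : ∀ r x, ρ (r • x) = φ r • ρ x := fun r x => by
    simp [hρ, Finset.smul_sum, mul_smul]
  have hb : ∀ i, ρ (b i) = b' i := fun i => by
    classical
    rw [hρ, Finset.sum_eq_single i]
    · simp
    · intro j _ hj
      rw [b.repr_self, Finsupp.single_eq_of_ne hj, map_zero, zero_smul]
    · simp
  have hone : ρ 1 = 1 := by
    rw [hρ, ← sum_structureConstants_inr b']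
    exact Finset.sum_congr rfl fun l _ => by rw [h]; rfl
  have hbb : ∀ i j, ρ (b i * b j) = b' i * b' j := fun i j => by
    rw [hρ, ← sum_structureConstants_inl b' i j]
    exact Finset.sum_congr rfl fun l _ => by rw [h]; rfl
  have hmul : ∀ x y, ρ (x * y) = ρ x * ρ y := fun x y => by
    rw [← b.sum_repr x, ← b.sum_repr y, Finset.sum_mul_sum, map_sum, map_sum, map_sum,
      Finset.sum_mul_sum]
    refine Finset.sum_congr rfl fun i _ => ?_
    rw [map_sum]
    refine Finset.sum_congr rfl fun j _ => ?_
    rw [smul_mul_smul_comm, hsmul, hsmul, hsmul, hbb, hb, hb, smul_mul_smul_comm, map_mul]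
  refine ⟨{ ρ with map_one' := hone, map_mul' := hmul }, fun r => ?_, hb⟩
  change ρ _ = _
  rw [Algebra.algebraMap_eq_smul_one, hsmul, hone, Algebra.algebraMap_eq_smul_one]

/-- A basis can be pushed forward along a base change to a quotient of the base. -/
theorem exists_basis_of_semilinear [Finite ι] {φ : R →+* R'} (hφ : Function.Surjective φ)
    {ρ : B →+* B'} (hρs : Function.Surjective ρ)
    (hρ : ∀ r, ρ (algebraMap R B r) = algebraMap R' B' (φ r)) (b : Basis ι R B)
    (hker : RingHom.ker ρ ≤ (RingHom.ker φ).map (algebraMap R B)) :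
    ∃ b' : Basis ι R' B', ∀ i, ρ (b i) = b' i := by
  have := Fintype.ofFinite ι
  have hsum : ∀ r : ι → R, ρ (∑ i, r i • b i) = ∑ i, φ (r i) • ρ (b i) := fun r => by
    simp [Algebra.smul_def, hρ]
  have hli : LinearIndependent R' fun i => ρ (b i) := by
    rw [Fintype.linearIndependent_iff]
    intro c hc i
    choose r hr using fun i => hφ (c i)
    simp only [← hr] at hc ⊢
    rw [← hsum] at hc
    have := (mem_ideal_map_iff_repr b _).1 (hker hc) i
    rwa [b.repr_sum_self] at this
  refine ⟨Basis.mk hli fun y _ => ?_, fun i => (congrFun (Basis.coe_mk hli _) i).symm⟩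
  obtain ⟨x, rfl⟩ := hρs y
  rw [← b.sum_repr x, hsum]
  exact sum_mem fun i _ => Submodule.smul_mem _ _ (Submodule.subset_span ⟨i, rfl⟩)

theorem discr_of_semilinear [Fintype ι] [DecidableEq ι] (φ : R →+* R') (ρ : B →+* B')
    (hρ : ∀ r, ρ (algebraMap R B r) = algebraMap R' B' (φ r)) {b : Basis ι R B}
    {b' : Basis ι R' B'} (hb : ∀ i, ρ (b i) = b' i) :
    Algebra.discr R' b' = φ (Algebra.discr R b) := by
  have htrace : ∀ x, Algebra.trace R' B' (ρ x) = φ (Algebra.trace R B x) := fun x => by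
    rw [Algebra.trace_eq_matrix_trace b, Algebra.trace_eq_matrix_trace b', Matrix.trace,
      Matrix.trace, map_sum]
    refine Finset.sum_congr rfl fun i _ => ?_
    rw [Matrix.diag_apply, Matrix.diag_apply, Algebra.leftMulMatrix_eq_repr_mul,
      Algebra.leftMulMatrix_eq_repr_mul, ← hb, ← ρ.map_mul, repr_ringHom_apply φ ρ hρ hb]
  rw [Algebra.discr_def, Algebra.discr_def, RingHom.map_det]
  congr 1
  ext i j
  rw [Algebra.traceMatrix_apply, Algebra.traceForm_apply, RingHom.mapMatrix_apply,
    Matrix.map_apply, Algebra.traceMatrix_apply, Algebra.traceForm_apply, ← htrace, ρ.map_mul, hb,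
    hb]

end BaseChange

/-! ### Discriminants and split algebras -/

section Discriminant

variable {F C ι : Type*} [Field F] [CommRing C] [Algebra F C] [Fintype ι] [DecidableEq ι]

theorem discr_ne_zero_iff (b : Basis ι F C) : Algebra.discr F b ≠ 0 ↔
    ∀ x : C, (∀ y, Algebra.trace F C (x * y) = 0) → x = 0 := by
  rw [Algebra.discr_def, Algebra.traceMatrix_of_basis,
    ← LinearMap.BilinForm.nondegenerate_iff_det_ne_zero]
  refine ⟨fun h => h.1, fun h => ⟨h, fun y hy => h y fun x => ?_⟩⟩
  rw [mul_comm]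
  exact hy x

theorem discr_pi_ne_zero {κ : Type*} [Finite κ] (b : Basis ι F (κ → F)) :
    Algebra.discr F b ≠ 0 := by
  classical
  have := Fintype.ofFinite κ
  rw [discr_ne_zero_iff]
  intro x hx
  funext c
  have h := hx (Pi.single c 1)
  rw [Algebra.trace_eq_matrix_trace (Pi.basisFun F κ), Matrix.trace,
    Finset.sum_eq_single c] at h
  · rw [Matrix.diag_apply, Algebra.leftMulMatrix_eq_repr_mul] at h
    simpa using h
  · intro d _ hd
    rw [Matrix.diag_apply, Algebra.leftMulMatrix_eq_repr_mul]
    simp [hd]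
  · simp

theorem isReduced_of_discr_ne_zero {b : Basis ι F C} (h : Algebra.discr F b ≠ 0) :
    IsReduced C :=
  ⟨fun x hx => (discr_ne_zero_iff b).1 h x fun y =>
    (Algebra.isNilpotent_trace_of_isNilpotent ((Commute.all x y).isNilpotent_mul_right hx)).eq_zero⟩

end Discriminant

theorem isFiniteSplit_of_isReduced (F C : Type*) [Field F] [IsAlgClosed F] [CommRing C]
    [Algebra F C] [Module.Finite F C] [IsReduced C] : Algebra.IsFiniteSplit F C := by
  have : IsArtinianRing C := isArtinian_of_tower F inferInstance
  let e : ∀ I : MaximalSpectrum C, (C ⧸ I.asIdeal) ≃ₐ[F] F := fun I =>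
    (AlgEquiv.ofBijective (Algebra.ofId F (C ⧸ I.asIdeal))
      IsAlgClosed.algebraMap_bijective_of_isIntegral).symm
  exact Algebra.IsFiniteSplit.of_algEquiv
    (((IsArtinianRing.equivPi C).restrictScalars F).trans (AlgEquiv.piCongrRight e)).symm

end

noncomputable section

open Module

/-! ### The generic split algebra -/

theorem discr_of_structureConstants {R R' B B' ι : Type*} [CommRing R] [CommRing B] [Algebra R B]
    [CommRing R'] [CommRing B'] [Algebra R' B'] [Fintype ι] [DecidableEq ι] (φ : R →+* R')
    (b : Basis ι R B) (b' : Basis ι R' B')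
    (h : ∀ s, structureConstants b' s = φ (structureConstants b s)) :
    Algebra.discr R' b' = φ (Algebra.discr R b) := by
  obtain ⟨ρ, hρ, hb⟩ := exists_ringHom_of_structureConstants φ b b' h
  exact discr_of_semilinear φ ρ hρ hb

section Generic

variable {R ι : Type*} [CommRing R] [Fintype ι] [DecidableEq ι]

/-- The basis of `R ^ ι` formed by the rows of an invertible matrix. -/
def rowBasis (M : Matrix ι ι R) (hM : IsUnit M.det) : Basis ι R (ι → R) :=
  (Pi.basisFun R ι).map (Matrix.toLinearEquiv' M.transpose
    (M.transpose.invertibleOfIsUnitDet (by rwa [Matrix.det_transpose])))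

theorem rowBasis_apply (M : Matrix ι ι R) (hM : IsUnit M.det) (i : ι) : rowBasis M hM i = M i := by
  funext j
  rw [rowBasis, Basis.map_apply, Pi.basisFun_apply]
  exact congrFun (Matrix.mulVec_single_one M.transpose i) j

theorem isUnit_det_of_basis (b : Basis ι R (ι → R)) : IsUnit (Matrix.of fun i j => b i j).det := by
  have h := (Pi.basisFun R ι).isUnit_det b
  rw [Basis.det_apply, ← Matrix.det_transpose] at h
  convert h using 2
  ext i j
  simp [Basis.toMatrix_apply]

variable (k : Type*) [Field k]

/-- The ring of functions on the general linear group. -/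
abbrev GenericRing (k ι : Type*) [Field k] [Fintype ι] [DecidableEq ι] : Type _ :=
  Localization.Away (Matrix.mvPolynomialX ι ι k).det

instance : IsDomain (GenericRing k ι) :=
  IsLocalization.isDomain_localization
    (powers_le_nonZeroDivisors_of_noZeroDivisors (Matrix.det_mvPolynomialX_ne_zero ι k))

/-- The generic basis of a split algebra, formed by the rows of the generic matrix. -/
def genericBasis (k ι : Type*) [Field k] [Fintype ι] [DecidableEq ι] :
    Basis ι (GenericRing k ι) (ι → GenericRing k ι) :=
  rowBasis ((Matrix.mvPolynomialX ι ι k).map (algebraMap _ _)) (by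
    rw [← RingHom.mapMatrix_apply, ← RingHom.map_det]
    exact IsLocalization.Away.algebraMap_isUnit _)

variable {k}

/-- Every basis of `R ^ ι` is a specialization of the generic one. -/
theorem exists_specialization [Algebra k R] (b : Basis ι R (ι → R)) :
    ∃ θ : GenericRing k ι →ₐ[k] R,
      (∀ p : MvPolynomial (ι × ι) k, θ (algebraMap _ _ p) = MvPolynomial.aeval (fun s : ι × ι => b s.1 s.2) p) ∧
      ∀ s, structureConstants b s = θ (structureConstants (genericBasis k ι) s) := by
  set θ₀ : MvPolynomial (ι × ι) k →ₐ[k] R := MvPolynomial.aeval (fun s : ι × ι => b s.1 s.2)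
    with hθ₀
  have hdet : IsUnit (θ₀ (Matrix.mvPolynomialX ι ι k).det) := by
    have h : θ₀ (Matrix.mvPolynomialX ι ι k).det = (Matrix.of fun i j => b i j).det := by
      rw [AlgHom.map_det]
      congr 1
      ext i j
      simp [hθ₀]
    rw [h]
    exact isUnit_det_of_basis b
  have hM : ∀ y : Submonoid.powers (Matrix.mvPolynomialX ι ι k).det, IsUnit (θ₀ y) := by
    rintro ⟨_, n, rfl⟩
    rw [map_pow]
    exact hdet.pow n
  let θ : GenericRing k ι →ₐ[k] R := IsLocalization.liftAlgHom hM
  have hθ : ∀ p, θ (algebraMap _ _ p) = θ₀ p := fun p => IsLocalization.lift_eq hM p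
  refine ⟨θ, hθ, fun s => ?_⟩
  refine structureConstants_of_semilinear (θ : GenericRing k ι →+* R)
    (RingHom.compLeft (θ : GenericRing k ι →+* R) ι) (fun r => rfl) (fun i => ?_) s
  funext j
  change θ (genericBasis k ι i j) = _
  rw [genericBasis, rowBasis_apply, Matrix.map_apply, hθ, hθ₀, Matrix.mvPolynomialX_apply,
    MvPolynomial.aeval_X]

theorem exists_specialization_pi [Nontrivial R] [Algebra k R] {κ : Type*} [Finite κ]
    (b : Basis ι R (κ → R)) : ∃ θ : GenericRing k ι →ₐ[k] R,
      ∀ s, structureConstants b s = θ (structureConstants (genericBasis k ι) s) := by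
  obtain ⟨θ, -, hθ⟩ := exists_specialization (k := k) (b.map
    (AlgEquiv.piCongrLeft' R (fun _ : κ => R)
      (b.indexEquiv (Pi.basisFun R κ)).symm).toLinearEquiv)
  rw [structureConstants_map] at hθ
  exact ⟨θ, hθ⟩

end Generic

section Closure

variable {k : Type*} [Field k] {ι : Type} [Fintype ι] [DecidableEq ι]

/-- An equation satisfied by all split algebras is satisfied by the generic one. -/
theorem aeval_structureConstants_genericBasis [Infinite k] {P : MvPolynomial (ScIndex ι) k}
    (hP : ∀ (κ : Type) [Finite κ] (b : Basis ι k (κ → k)),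
      MvPolynomial.eval (structureConstants b) P = 0) :
    MvPolynomial.aeval (structureConstants (genericBasis k ι)) P = 0 := by
  obtain ⟨n, H, hH⟩ := IsLocalization.Away.surj (Matrix.mvPolynomialX ι ι k).det
    (MvPolynomial.aeval (structureConstants (genericBasis k ι)) P)
  have hH0 : H * (Matrix.mvPolynomialX ι ι k).det = 0 := by
    refine MvPolynomial.funext fun x => ?_
    rw [map_mul, map_zero]
    by_cases hx : MvPolynomial.eval x (Matrix.mvPolynomialX ι ι k).det = 0
    · rw [hx, mul_zero]
    have hdet : IsUnit (Matrix.of fun i j => x (i, j)).det := by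
      rw [isUnit_iff_ne_zero]
      convert hx
      rw [RingHom.map_det]
      congr 1
      ext i j
      simp
    obtain ⟨θ, hθ, hsc⟩ := exists_specialization (k := k) (rowBasis _ hdet)
    have h1 := congrArg θ hH
    have h2 : θ (MvPolynomial.aeval (structureConstants (genericBasis k ι)) P) = 0 := by
      rw [← AlgHom.comp_apply, MvPolynomial.comp_aeval, ← funext hsc]
      exact hP ι _
    rw [map_mul, h2, zero_mul, hθ] at h1
    have h3 : (fun s : ι × ι => rowBasis (Matrix.of fun i j => x (i, j)) hdet s.1 s.2) = x := by
      funext s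
      rw [rowBasis_apply]
      rfl
    rw [h3, MvPolynomial.aeval_eq_eval] at h1
    change 0 = MvPolynomial.eval x H at h1
    rw [← h1, zero_mul]
  rw [(mul_eq_zero.1 hH0).resolve_right (Matrix.det_mvPolynomialX_ne_zero ι k), map_zero] at hH
  exact (IsUnit.mul_left_eq_zero ((IsLocalization.Away.algebraMap_isUnit _).pow n)).1 hH

/-- An equation satisfied by all split algebras over `k` is satisfied by all split algebras over
extension fields. -/
theorem aeval_structureConstants_eq_zero [Infinite k] {P : MvPolynomial (ScIndex ι) k}
    (hP : ∀ (κ : Type) [Finite κ] (b : Basis ι k (κ → k)),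
      MvPolynomial.eval (structureConstants b) P = 0) {F C : Type*} [Field F] [Algebra k F]
    [CommRing C] [Algebra F C] [Algebra.IsFiniteSplit F C] (b : Basis ι F C) :
    MvPolynomial.aeval (structureConstants b) P = 0 := by
  obtain ⟨n, ⟨e⟩⟩ := Algebra.IsFiniteSplit.nonempty_algEquiv_fun F C
  obtain ⟨θ, hθ⟩ := exists_specialization_pi (k := k) (b.map e.toLinearEquiv)
  rw [structureConstants_map] at hθ
  rw [funext hθ]
  have := congrArg θ (aeval_structureConstants_genericBasis hP)
  rwa [← AlgHom.comp_apply, MvPolynomial.comp_aeval, map_zero] at this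

end Closure

/-! ### Limits of split algebras are smoothable -/

/-- An algebra with basis descends to every subring that contains its structure constants. -/
theorem exists_descend_basis.{u, v} {k : Type*} {L C : Type u} {ι : Type v} [Field k] [CommRing L]
    [Algebra k L] [CommRing C] [Algebra L C] [Finite ι] (g : Basis ι L C) (V : Subalgebra k L)
    (hV : ∀ s, structureConstants g s ∈ V) :
    ∃ (B : Type u) (_ : CommRing B) (_ : Algebra V B) (γ : Basis ι V B),
      ∀ s, structureConstants γ s = ⟨structureConstants g s, hV s⟩ := by
  have := Fintype.ofFinite ι
  have hmem : ∀ s l, structureConstants g s • g l ∈ Submodule.span V (Set.range g) := fun s l =>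
    Submodule.smul_mem _ (⟨structureConstants g s, hV s⟩ : V)
      (Submodule.subset_span (Set.mem_range_self l))
  have hone : (1 : C) ∈ Submodule.span V (Set.range g) := by
    rw [← sum_structureConstants_inr g]
    exact sum_mem fun l _ => hmem _ l
  have hmul : ∀ x y, x ∈ Submodule.span V (Set.range g) → y ∈ Submodule.span V (Set.range g) →
      x * y ∈ Submodule.span V (Set.range g) := by
    intro x y hx hy
    have h := Submodule.mul_mem_mul hx hy
    rw [Submodule.span_mul_span] at h
    refine Submodule.span_le.2 ?_ h
    rintro _ ⟨_, ⟨i, rfl⟩, _, ⟨j, rfl⟩, rfl⟩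
    change g i * g j ∈ Submodule.span V (Set.range g)
    rw [← sum_structureConstants_inl g]
    exact sum_mem fun l _ => hmem _ l
  have hli : LinearIndependent V g := g.linearIndependent.restrict_scalars fun x y h =>
    Subtype.ext (by simpa [Algebra.smul_def] using h)
  let B := (Submodule.span V (Set.range g)).toSubalgebra hone hmul
  let γ : Basis ι V B := Basis.span hli
  refine ⟨B, inferInstance, inferInstance, γ, fun s => Subtype.ext ?_⟩
  exact (structureConstants_of_semilinear (b := γ) (b' := g) V.val.toRingHom B.val.toRingHom
    (fun r => rfl) (fun i => congrArg Subtype.val (Basis.span_apply hli i)) s).symm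

section Fibre

variable {k V B A ι : Type*} [Field k] [CommRing V] [Algebra k V] [CommRing B] [Algebra V B]
  [Algebra k B] [IsScalarTower k V B] [CommRing A] [Algebra k A] [Fintype ι]

theorem nonempty_fibre_algEquiv (γ : Basis ι V B) (b : Basis ι k A) (π : V →ₐ[k] k)
    (hπ : ∀ s, structureConstants b s = π (structureConstants γ s)) :
    Nonempty ((B ⧸ (RingHom.ker π.toRingHom).map (algebraMap V B)) ≃ₐ[k] A) := by
  obtain ⟨ρ, hρ, hργ⟩ := exists_ringHom_of_structureConstants π.toRingHom γ b hπ
  have hk : ∀ c, ρ (algebraMap k B c) = algebraMap k A c := fun c => by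
    rw [IsScalarTower.algebraMap_apply k V B, hρ]
    exact congrArg (algebraMap k A) (π.commutes c)
  have hker : RingHom.ker ρ = _ := ker_of_semilinear π.toRingHom ρ hρ hργ
  have hρs : Function.Surjective ρ := by
    intro a
    refine ⟨∑ i, algebraMap k B (b.repr a i) * γ i, ?_⟩
    conv_rhs => rw [← b.sum_repr a]
    rw [map_sum]
    refine Finset.sum_congr rfl fun i _ => ?_
    rw [map_mul, hk, hργ, Algebra.smul_def]
  rw [← hker]
  exact ⟨AlgEquiv.ofRingEquiv (f := RingHom.quotientKerEquivOfSurjective hρs) hk⟩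

/-- Fibres at closed points where the discriminant does not vanish are smooth. -/
theorem smooth_fibre [DecidableEq ι] [IsAlgClosed k] [Algebra.FiniteType k V] (γ : Basis ι V B) (q : Ideal V)
    [q.IsMaximal] (hq : Algebra.discr V γ ∉ q) :
    Algebra.Smooth k (B ⧸ q.map (algebraMap V B)) := by
  let := Ideal.Quotient.field q
  have : Algebra.FiniteType k (V ⧸ q) :=
    Algebra.FiniteType.of_surjective (Ideal.Quotient.mkₐ k q) Ideal.Quotient.mk_surjective
  have : Module.Finite k (V ⧸ q) := finite_of_finite_type_of_isJacobsonRing k _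
  let e : k ≃ₐ[k] (V ⧸ q) := AlgEquiv.ofBijective (Algebra.ofId k _)
    IsAlgClosed.algebraMap_bijective_of_isIntegral
  let φ : V →ₐ[k] k := (e.symm : _ →ₐ[k] k).comp (Ideal.Quotient.mkₐ k q)
  have hφ : ∀ v, φ v = 0 ↔ v ∈ q := fun v => by
    change e.symm (Ideal.Quotient.mk q v) = 0 ↔ _
    rw [map_eq_zero_iff _ e.symm.injective, Ideal.Quotient.eq_zero_iff_mem]
  have hφker : RingHom.ker φ.toRingHom = q := Ideal.ext hφ
  have hcomp : ∀ v, Ideal.Quotient.mk (q.map (algebraMap V B)) (algebraMap V B v) =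
      algebraMap k _ (φ.toRingHom v) := fun v => by
    refine Ideal.Quotient.eq.2 ?_
    have h1 : algebraMap V B v - algebraMap k B (φ v) =
        algebraMap V B (v - algebraMap k V (φ v)) := by
      rw [map_sub, IsScalarTower.algebraMap_apply k V B]
    refine h1 ▸ Ideal.mem_map_of_mem _ ((hφ _).1 ?_)
    rw [map_sub, φ.commutes]
    exact sub_self _
  obtain ⟨b', hb'⟩ := exists_basis_of_semilinear (φ := φ.toRingHom)
    (fun c => ⟨algebraMap k _ c, φ.commutes c⟩) Ideal.Quotient.mk_surjective hcomp γ
    (by rw [hφker, Ideal.mk_ker])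
  have hdiscr : Algebra.discr k b' ≠ 0 := by
    rw [discr_of_semilinear φ.toRingHom _ hcomp hb']
    exact fun h0 => hq ((hφ _).1 h0)
  have := isReduced_of_discr_ne_zero hdiscr
  have : Module.Finite k (B ⧸ q.map (algebraMap V B)) := .of_basis b'
  have := isFiniteSplit_of_isReduced k (B ⧸ q.map (algebraMap V B))
  infer_instance

end Fibre

/-- The special fibre of a free family with generically nonzero discriminant is smoothable. -/
theorem isSmoothable_of_family.{u} {k V A B : Type u} [Field k] [IsAlgClosed k] [CommRing V]
    [IsDomain V] [Algebra k V] [Algebra.FiniteType k V] [CommRing B] [Algebra V B] [CommRing A]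
    [Algebra k A] {ι : Type} [Fintype ι] [DecidableEq ι] (γ : Basis ι V B) (b : Basis ι k A)
    (hγ : Algebra.discr V γ ≠ 0) (π : V →ₐ[k] k)
    (hπ : ∀ s, structureConstants b s = π (structureConstants γ s)) : IsSmoothable k A := by
  let : Algebra k B := ((algebraMap V B).comp (algebraMap k V)).toAlgebra
  have htower : IsScalarTower k V B := .of_algebraMap_eq fun _ => rfl
  have hfin : Module.Finite V B := .of_basis γ
  have hfree : Module.Free V B := .of_basis γ
  refine ⟨V, inferInstance, inferInstance, inferInstance, inferInstance, B, inferInstance,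
    inferInstance, inferInstance, htower, hfin, inferInstance, ?_, Algebra.discr V γ, hγ,
    fun q hq hr => smooth_fibre γ q hr⟩
  exact ⟨RingHom.ker π.toRingHom, RingHom.ker_isMaximal_of_surjective _
    fun c => ⟨algebraMap k _ c, π.commutes c⟩, nonempty_fibre_algEquiv γ b π hπ⟩

/-- The generic split algebra is defined over the ring generated by its structure constants, the
coordinate ring of the closure of the split algebras. This is a family of algebras with smooth
general fibre that has all limits of split algebras among its fibres. -/
theorem IsLimitOfSplit.isSmoothable.{u} {k : Type u} [Field k] [IsAlgClosed k] {A : Type u}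
    [CommRing A] [Algebra k A] [Module.Finite k A] (h : IsLimitOfSplit k A) : IsSmoothable k A := by
  let ι := Fin (finrank k A)
  let b : Basis ι k A := finBasis k A
  let g := genericBasis k ι
  let Φ : MvPolynomial (ScIndex ι) k →ₐ[k] GenericRing k ι :=
    MvPolynomial.aeval (structureConstants g)
  have hΦX : ∀ s, Φ (MvPolynomial.X s) = structureConstants g s := fun s =>
    MvPolynomial.aeval_X _ _
  have hΦ : ∀ s, structureConstants g s ∈ Φ.range := fun s => ⟨MvPolynomial.X s, hΦX s⟩
  have hft : Algebra.FiniteType k Φ.range :=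
    Algebra.FiniteType.of_surjective Φ.rangeRestrict Φ.rangeRestrict_surjective
  obtain ⟨B, _, _, γ, hγ⟩ := exists_descend_basis g Φ.range hΦ
  have hker : RingHom.ker Φ.rangeRestrict.toRingHom ≤
      RingHom.ker (MvPolynomial.aeval (R := k) (structureConstants b)).toRingHom := by
    intro P hP
    have hP' : Φ P = 0 := congrArg Subtype.val hP
    refine h ι b P fun κ _ c => ?_
    obtain ⟨θ, hθ⟩ := exists_specialization_pi (k := k) c
    have := congrArg θ hP'
    rw [← AlgHom.comp_apply, MvPolynomial.comp_aeval, map_zero, ← funext hθ] at this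
    exact this
  let π : Φ.range →ₐ[k] k := AlgHom.liftOfSurjective Φ.rangeRestrict Φ.rangeRestrict_surjective
    (MvPolynomial.aeval (structureConstants b)) hker
  refine isSmoothable_of_family γ b (fun h0 => ?_) π fun s => ?_
  · obtain ⟨θ, -, hθ⟩ := exists_specialization (k := k) (Pi.basisFun k ι)
    refine discr_pi_ne_zero (Pi.basisFun k ι) ?_
    rw [discr_of_structureConstants θ.toRingHom g _ hθ,
      discr_of_structureConstants Φ.range.val.toRingHom γ g fun s => by rw [hγ]; rfl, h0, map_zero,
      map_zero]
  · have h1 : structureConstants γ s = Φ.rangeRestrict (MvPolynomial.X s) := by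
      rw [hγ]
      exact Subtype.ext (hΦX s).symm
    rw [h1]
    refine (MvPolynomial.aeval_X (R := k) (structureConstants b) s).symm.trans ?_
    exact (AlgHom.liftOfSurjective_apply _ _ _ _ _).symm

end

noncomputable section

open Module

/-! ### Factors of limits of split algebras -/

theorem IsAdicComplete.map_of_basis {R B ι : Type*} [CommRing R] [CommRing B] [Algebra R B]
    [Finite ι] (b : Basis ι R B) (𝔞 : Ideal R) [IsAdicComplete 𝔞 R] :
    IsAdicComplete (𝔞.map (algebraMap R B)) B := by
  have := Fintype.ofFinite ι
  have key : ∀ (n : ℕ) (x y : B), x ≡ y [SMOD ((𝔞.map (algebraMap R B)) ^ n • ⊤ : Submodule B B)] ↔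
      ∀ i, b.repr x i ≡ b.repr y i [SMOD (𝔞 ^ n • ⊤ : Submodule R R)] := by
    intro n x y
    rw [SModEq.sub_mem, smul_eq_mul, Ideal.mul_top, ← Ideal.map_pow, mem_ideal_map_iff_repr b]
    refine forall_congr' fun i => ?_
    rw [SModEq.sub_mem, smul_eq_mul, Ideal.mul_top, map_sub, Finsupp.sub_apply]
  refine { haus' := fun x hx => ?_, prec' := fun f hf => ?_ }
  · refine b.ext_elem fun i => ?_
    rw [map_zero, Finsupp.zero_apply]
    refine IsHausdorff.haus (I := 𝔞) inferInstance _ fun n => ?_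
    have := (key n x 0).1 (hx n) i
    rwa [map_zero, Finsupp.zero_apply] at this
  · choose L hL using fun i => IsPrecomplete.prec (I := 𝔞) (M := R) inferInstance
      (f := fun n => b.repr (f n) i) fun {m n} hmn => (key m _ _).1 (hf hmn) i
    refine ⟨∑ i, L i • b i, fun n => (key n _ _).2 fun i => ?_⟩
    rw [b.repr_sum_self]
    exact hL i n

/-- Idempotents lift along a Henselian ideal. -/
theorem HenselianRing.exists_isIdempotentElem {B : Type*} [CommRing B] {I : Ideal B}
    [HenselianRing B I] {ε : B} (hε : ε * ε - ε ∈ I) : ∃ e, IsIdempotentElem e ∧ e - ε ∈ I := by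
  obtain ⟨e, he, heε⟩ := HenselianRing.is_henselian (I := I)
    (Polynomial.X ^ 2 - Polynomial.X : Polynomial B) (by monicity!) ε
    (by simpa [sq] using hε) (by
      refine IsUnit.of_mul_eq_one (Ideal.Quotient.mk I (2 * ε - 1)) ?_
      rw [← map_mul, ← map_one (Ideal.Quotient.mk I)]
      refine Ideal.Quotient.eq.2 ?_
      have : Polynomial.eval ε (Polynomial.derivative (Polynomial.X ^ 2 - Polynomial.X)) *
          (2 * ε - 1) - 1 = 4 * (ε * ε - ε) := by
        simp
        ring
      rw [this]
      exact I.mul_mem_left _ hε)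
  refine ⟨e, ?_, heε⟩
  have h : e ^ 2 - e = 0 := by simpa using he
  rw [IsIdempotentElem, ← sq, sub_eq_zero.1 h]

theorem isReduced_of_ker_eq_span_idempotent {C D : Type*} [CommRing C] [CommRing D] [IsReduced C]
    {f : C →+* D} (hf : Function.Surjective f) {e : C} (he : IsIdempotentElem e)
    (hker : RingHom.ker f = Ideal.span {e}) : IsReduced D := by
  refine ⟨fun y hy => ?_⟩
  obtain ⟨x, rfl⟩ := hf y
  obtain ⟨n, hn⟩ := hy
  rw [← map_pow, ← RingHom.mem_ker, hker, Ideal.mem_span_singleton'] at hn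
  obtain ⟨a, ha⟩ := hn
  have h1 : IsNilpotent ((1 - e) * x) := by
    refine ⟨n + 1, ?_⟩
    have h2 : ((1 - e) * x) ^ (n + 1) = (1 - e) ^ n * x * (a * (e - e * e)) := by
      rw [mul_pow, pow_succ x, ← ha]
      ring
    rw [h2, he.eq, sub_self, mul_zero, mul_zero]
  have h3 : x = x * e := by
    have := h1.eq_zero
    linear_combination this
  rw [← RingHom.mem_ker, hker, h3]
  exact Ideal.mul_mem_left _ _ (Ideal.mem_span_singleton_self e)

/-- The quotient by an idempotent is flat. -/
theorem flat_quotient_span_idempotent {R B : Type*} [CommRing R] [CommRing B] [Algebra R B]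
    [Module.Flat R B] {e : B} (he : IsIdempotentElem e) : Module.Flat R (B ⧸ Ideal.span {e}) := by
  have : IsLocalization.Away (1 - e) (B ⧸ Ideal.span {e}) :=
    IsLocalization.away_of_isIdempotentElem he.one_sub
      (by rw [sub_sub_cancel, Ideal.Quotient.algebraMap_eq, Ideal.mk_ker])
      Ideal.Quotient.mk_surjective
  have : Module.Flat B (B ⧸ Ideal.span {e}) := IsLocalization.flat _ (Submonoid.powers (1 - e))
  exact Module.Flat.trans R B _

section PowerSeries

variable {k : Type*} [Field k] {B A : Type*} [CommRing B] [Algebra (PowerSeries k) B] [CommRing A]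
  [Algebra k A]

/-- A free algebra over `k⟦t⟧` whose base change to an algebraic closure of `k((t))` is split
has a limit of split algebras as special fibre. -/
theorem isLimitOfSplit_of_powerSeries [Infinite k] [Module.Finite (PowerSeries k) B]
    [Module.Flat (PowerSeries k) B] {F : Type*} [Field F] [IsAlgClosed F]
    [Algebra (PowerSeries k) F] [FaithfulSMul (PowerSeries k) F]
    [IsReduced (TensorProduct (PowerSeries k) F B)] {ρ : B →+* A} (hρs : Function.Surjective ρ)
    (hρ : ∀ r, ρ (algebraMap (PowerSeries k) B r) = algebraMap k A (PowerSeries.constantCoeff r))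
    (hker : RingHom.ker ρ ≤ Ideal.span {algebraMap (PowerSeries k) B PowerSeries.X}) :
    IsLimitOfSplit k A := by
  let : Algebra k F := ((algebraMap (PowerSeries k) F).comp (algebraMap k (PowerSeries k))).toAlgebra
  have : IsScalarTower k (PowerSeries k) F := .of_algebraMap_eq fun _ => rfl
  have hfree : Module.Free (PowerSeries k) B := Module.free_of_flat_of_isLocalRing
  let b := Module.finBasis (PowerSeries k) B
  have hcs : Function.Surjective (PowerSeries.constantCoeff (R := k)) := fun c =>
    ⟨PowerSeries.C c, PowerSeries.constantCoeff_C c⟩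
  obtain ⟨b', hb'⟩ := exists_basis_of_semilinear hcs hρs hρ b (hker.trans (by
    rw [Ideal.span_le, Set.singleton_subset_iff]
    exact Ideal.mem_map_of_mem _ PowerSeries.constantCoeff_X))
  refine IsSplitLimit.isLimitOfSplit (b := b') fun P hP => ?_
  have hsplit := isFiniteSplit_of_isReduced F (TensorProduct (PowerSeries k) F B)
  have h1 := aeval_structureConstants_eq_zero hP (Algebra.TensorProduct.basis F b)
  have h2 : ∀ s, structureConstants (Algebra.TensorProduct.basis F b) s =
      IsScalarTower.toAlgHom k (PowerSeries k) F (structureConstants b s) := fun s =>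
    structureConstants_of_semilinear (algebraMap (PowerSeries k) F)
      (Algebra.TensorProduct.includeRight (R := PowerSeries k) (A := F) (B := B)).toRingHom
      (fun r => (Algebra.TensorProduct.includeRight (R := PowerSeries k) (A := F) (B := B)).commutes r)
      (fun i => (Algebra.TensorProduct.basis_apply b i).symm) s
  rw [funext h2, ← MvPolynomial.comp_aeval, AlgHom.comp_apply] at h1
  have h3 : MvPolynomial.aeval (structureConstants b) P = 0 :=
    FaithfulSMul.algebraMap_injective (PowerSeries k) F (h1.trans (map_zero _).symm)
  have h4 : MvPolynomial.eval (structureConstants b') P =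
      PowerSeries.constantCoeff (MvPolynomial.aeval (structureConstants b) P) := by
    rw [MvPolynomial.aeval_def, MvPolynomial.hom_eval₂,
      funext (structureConstants_of_semilinear _ ρ hρ hb')]
    congr 1
  rw [h4, h3, map_zero]

/-- If a free algebra over `k⟦t⟧` has nonzero discriminant, every factor of its special fibre is a
limit of split algebras: the corresponding idempotent lifts. -/
theorem isLimitOfSplit_of_idempotent [Infinite k] {ι : Type*} [Fintype ι] [DecidableEq ι]
    (β : Basis ι (PowerSeries k) B) (hβ : Algebra.discr (PowerSeries k) β ≠ 0) {ρ : B →+* A}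
    (hρs : Function.Surjective ρ)
    (hρ : ∀ r, ρ (algebraMap (PowerSeries k) B r) = algebraMap k A (PowerSeries.constantCoeff r))
    {ε : B} (hε : ε * ε - ε ∈ Ideal.span {algebraMap (PowerSeries k) B PowerSeries.X})
    (hker : RingHom.ker ρ = Ideal.span {algebraMap (PowerSeries k) B PowerSeries.X, ε}) :
    IsLimitOfSplit k A := by
  have hfin : Module.Finite (PowerSeries k) B := .of_basis β
  have hfree : Module.Free (PowerSeries k) B := .of_basis β
  have hcomplete := IsAdicComplete.map_of_basis β (Ideal.span {(PowerSeries.X : PowerSeries k)})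
  rw [Ideal.map_span, Set.image_singleton] at hcomplete
  obtain ⟨e, he, heε⟩ := HenselianRing.exists_isIdempotentElem hε
  have hflat : Module.Flat (PowerSeries k) (B ⧸ Ideal.span {e}) := flat_quotient_span_idempotent he
  let F := AlgebraicClosure (FractionRing (PowerSeries k))
  have hF : FaithfulSMul (PowerSeries k) F := by
    rw [faithfulSMul_iff_algebraMap_injective,
      IsScalarTower.algebraMap_eq (PowerSeries k) (FractionRing (PowerSeries k)) F]
    exact (FaithfulSMul.algebraMap_injective (FractionRing (PowerSeries k)) F).comp (IsFractionRing.injective (PowerSeries k) _)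
  have hred : IsReduced (TensorProduct (PowerSeries k) F B) := by
    refine isReduced_of_discr_ne_zero (F := F) (b := Algebra.TensorProduct.basis F β) ?_
    rw [discr_of_semilinear (algebraMap (PowerSeries k) F)
      (Algebra.TensorProduct.includeRight (R := PowerSeries k) (A := F) (B := B)).toRingHom
      (fun r => (Algebra.TensorProduct.includeRight (R := PowerSeries k) (A := F) (B := B)).commutes r)
      (fun i => (Algebra.TensorProduct.basis_apply β i).symm)]
    exact (map_ne_zero_iff _ (FaithfulSMul.algebraMap_injective (PowerSeries k) F)).2 hβ
  let q : B →ₐ[PowerSeries k] (B ⧸ Ideal.span {e}) := Ideal.Quotient.mkₐ _ _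
  have hqs : Function.Surjective q := Ideal.Quotient.mk_surjective
  have hred' : IsReduced (TensorProduct (PowerSeries k) F (B ⧸ Ideal.span {e})) := by
    refine isReduced_of_ker_eq_span_idempotent
      (f := (Algebra.TensorProduct.map (AlgHom.id (PowerSeries k) F) q).toRingHom) ?_
      (e := (1 : F) ⊗ₜ[PowerSeries k] e) ?_ ?_
    · exact TensorProduct.map_surjective Function.surjective_id hqs
    · rw [IsIdempotentElem, Algebra.TensorProduct.tmul_mul_tmul, mul_one, he.eq]
    · refine (Algebra.TensorProduct.lTensor_ker q hqs).trans ?_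
      have : RingHom.ker q = Ideal.span {e} := Ideal.mk_ker
      rw [this, Ideal.map_span, Set.image_singleton]
      rfl
  have hρe : ρ e = 0 := by
    have h1 : e - ε ∈ RingHom.ker ρ := hker ▸ Ideal.span_mono (by simp) heε
    have h2 : ε ∈ RingHom.ker ρ := hker ▸ Ideal.subset_span (by simp)
    have := (RingHom.ker ρ).add_mem h1 h2
    rwa [sub_add_cancel] at this
  refine isLimitOfSplit_of_powerSeries (F := F) (B := B ⧸ Ideal.span {e})
    (ρ := Ideal.Quotient.lift _ ρ ?_) ?_ ?_ ?_
  · intro a ha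
    obtain ⟨c, rfl⟩ := Ideal.mem_span_singleton'.1 ha
    rw [map_mul, hρe, mul_zero]
  · exact Ideal.Quotient.lift_surjective_of_surjective _ _ hρs
  · exact hρ
  · intro y hy
    obtain ⟨x, rfl⟩ := Ideal.Quotient.mk_surjective y
    have hx : x ∈ RingHom.ker ρ := hy
    rw [hker, Ideal.mem_span_pair] at hx
    obtain ⟨a, c, rfl⟩ := hx
    obtain ⟨s, hs⟩ := Ideal.mem_span_singleton'.1 heε
    refine Ideal.mem_span_singleton'.2 ⟨Ideal.Quotient.mk _ (a - c * s), ?_⟩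
    change Ideal.Quotient.mk (Ideal.span {e}) (_ * _) = _
    refine Ideal.Quotient.eq.2 (Ideal.mem_span_singleton'.2 ⟨-c, ?_⟩)
    linear_combination c * hs

end PowerSeries

end

noncomputable section

open Module

/-! ### Complete intersections with prescribed leading forms -/

section LowDegree

variable {V ι : Type*} [CommRing V]

/-- The polynomials of total degree less than `n`. -/
def lowDegree (V ι : Type*) [CommRing V] (n : ℕ) : Submodule V (MvPolynomial ι V) where
  carrier := {p | ∀ m : ι →₀ ℕ, n ≤ m.degree → p.coeff m = 0}
  add_mem' := fun {p q} hp hq m hm => by rw [MvPolynomial.coeff_add, hp m hm, hq m hm, add_zero]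
  zero_mem' := fun m _ => MvPolynomial.coeff_zero m
  smul_mem' := fun c p hp m hm => by rw [MvPolynomial.coeff_smul, hp m hm, smul_zero]

theorem lowDegree_mono {m n : ℕ} (h : m ≤ n) : lowDegree V ι m ≤ lowDegree V ι n :=
  fun _ hp a ha => hp a (h.trans ha)

theorem mem_lowDegree_zero {p : MvPolynomial ι V} : p ∈ lowDegree V ι 0 ↔ p = 0 :=
  ⟨fun h => MvPolynomial.ext _ _ fun m => (h m (Nat.zero_le _)).trans (MvPolynomial.coeff_zero m).symm,
    fun h => h ▸ zero_mem _⟩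

theorem exists_mem_lowDegree (p : MvPolynomial ι V) : ∃ n, p ∈ lowDegree V ι n := by
  refine ⟨p.totalDegree + 1, fun m hm => MvPolynomial.coeff_eq_zero_of_totalDegree_lt ?_⟩
  change p.totalDegree < m.degree
  omega

theorem monomial_mem_lowDegree {n : ℕ} {e : ι →₀ ℕ} (he : e.degree < n) (c : V) :
    MvPolynomial.monomial e c ∈ lowDegree V ι n := by
  classical
  intro m hm
  rw [MvPolynomial.coeff_monomial, if_neg]
  rintro rfl
  omega

theorem mul_mem_lowDegree {a b : ℕ} {p q : MvPolynomial ι V} (hp : p ∈ lowDegree V ι a)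
    (hq : q ∈ lowDegree V ι (b + 1)) : p * q ∈ lowDegree V ι (a + b) := by
  classical
  intro m hm
  rw [MvPolynomial.coeff_mul]
  refine Finset.sum_eq_zero fun u hu => ?_
  rw [Finset.HasAntidiagonal.mem_antidiagonal] at hu
  rw [← hu, map_add] at hm
  by_cases h : a ≤ u.1.degree
  · rw [hp _ h, zero_mul]
  · rw [hq _ (by omega), mul_zero]

theorem map_mem_lowDegree {V' : Type*} [CommRing V'] (φ : V →+* V') {n : ℕ} {p : MvPolynomial ι V}
    (hp : p ∈ lowDegree V ι n) : MvPolynomial.map φ p ∈ lowDegree V' ι n := fun m hm => by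
  rw [MvPolynomial.coeff_map, hp m hm, map_zero]

/-- `p` is the sum of the monomial `α ^ e` and terms of lower total degree. -/
def HasLeadingMonomial (p : MvPolynomial ι V) (e : ι →₀ ℕ) : Prop :=
  p - MvPolynomial.monomial e 1 ∈ lowDegree V ι e.degree

theorem hasLeadingMonomial_monomial (e : ι →₀ ℕ) :
    HasLeadingMonomial (MvPolynomial.monomial e (1 : V)) e := by
  rw [HasLeadingMonomial, sub_self]
  exact zero_mem _

theorem HasLeadingMonomial.mul {p q : MvPolynomial ι V} {e e' : ι →₀ ℕ}
    (hp : HasLeadingMonomial p e) (hq : HasLeadingMonomial q e') :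
    HasLeadingMonomial (p * q) (e + e') := by
  have hq' : q ∈ lowDegree V ι (e'.degree + 1) := by
    have := add_mem (lowDegree_mono (Nat.le_succ _) hq)
      (monomial_mem_lowDegree (Nat.lt_succ_self e'.degree) (1 : V))
    rwa [sub_add_cancel] at this
  have h1 := mul_mem_lowDegree hp hq'
  have h2 := mul_mem_lowDegree hq (monomial_mem_lowDegree (Nat.lt_succ_self e.degree) (1 : V))
  rw [add_comm e'.degree] at h2
  rw [HasLeadingMonomial, map_add]
  convert add_mem h1 h2 using 1
  rw [show MvPolynomial.monomial (e + e') (1 : V) =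
    MvPolynomial.monomial e 1 * MvPolynomial.monomial e' 1 by rw [MvPolynomial.monomial_mul, one_mul]]
  ring

theorem HasLeadingMonomial.pow {p : MvPolynomial ι V} {e : ι →₀ ℕ} (hp : HasLeadingMonomial p e)
    (n : ℕ) : HasLeadingMonomial (p ^ n) (n • e) := by
  induction n with
  | zero => rw [pow_zero, zero_smul]; exact hasLeadingMonomial_monomial 0
  | succ n ih => rw [pow_succ, succ_nsmul]; exact ih.mul hp

theorem HasLeadingMonomial.prod {κ : Type*} {p : κ → MvPolynomial ι V} {e : κ → ι →₀ ℕ}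
    (s : Finset κ) (hp : ∀ j ∈ s, HasLeadingMonomial (p j) (e j)) :
    HasLeadingMonomial (∏ j ∈ s, p j) (∑ j ∈ s, e j) := by
  classical
  induction s using Finset.induction_on with
  | empty => exact hasLeadingMonomial_monomial 0
  | insert j s hj ih =>
    rw [Finset.prod_insert hj, Finset.sum_insert hj]
    exact (hp j (Finset.mem_insert_self j s)).mul
      (ih fun i hi => hp i (Finset.mem_insert_of_mem hi))

/-- A linear endomorphism of the polynomial ring that preserves leading monomials is bijective. -/
theorem bijective_of_hasLeadingMonomial {φ : MvPolynomial ι V →ₗ[V] MvPolynomial ι V}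
    (hφ : ∀ e, HasLeadingMonomial (φ (MvPolynomial.monomial e 1)) e) : Function.Bijective φ := by
  have hlow : ∀ n, ∀ p ∈ lowDegree V ι (n + 1), φ p - p ∈ lowDegree V ι n := by
    intro n p hp
    have h : φ p - p = ∑ e ∈ p.support, p.coeff e •
        (φ (MvPolynomial.monomial e 1) - MvPolynomial.monomial e 1) := by
      conv_lhs => rw [p.as_sum]
      rw [map_sum, ← Finset.sum_sub_distrib]
      refine Finset.sum_congr rfl fun e _ => ?_
      have : MvPolynomial.monomial e (p.coeff e) = p.coeff e • MvPolynomial.monomial e (1 : V) := by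
        rw [MvPolynomial.smul_monomial, smul_eq_mul, mul_one]
      rw [this, map_smul, smul_sub]
    rw [h]
    refine sum_mem fun e he => Submodule.smul_mem _ _ (lowDegree_mono ?_ (hφ e))
    by_contra hlt
    exact (MvPolynomial.mem_support_iff.1 he) (hp e (by omega))
  constructor
  · rw [injective_iff_map_eq_zero]
    intro p hp
    obtain ⟨n, hn⟩ := exists_mem_lowDegree p
    have : ∀ j ≤ n, p ∈ lowDegree V ι (n - j) := by
      intro j
      induction j with
      | zero => exact fun _ => hn
      | succ j ih =>
        intro hj
        have h1 := ih (by omega)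
        rw [show n - j = n - (j + 1) + 1 by omega] at h1
        have h2 := hlow _ p h1
        rwa [hp, zero_sub, neg_mem_iff] at h2
    have h := this n le_rfl
    rwa [Nat.sub_self, mem_lowDegree_zero] at h
  · intro p
    obtain ⟨n, hn⟩ := exists_mem_lowDegree p
    induction n generalizing p with
    | zero => exact ⟨0, by rw [mem_lowDegree_zero.1 hn, map_zero]⟩
    | succ n ih =>
      obtain ⟨u, hu⟩ := ih _ (hlow n p hn)
      exact ⟨p - u, by rw [map_sub, hu, sub_sub_cancel]⟩

end LowDegree

section Box

variable {V ι : Type*} [CommRing V] [Fintype ι] (N : ℕ) (L : ι → MvPolynomial ι V)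

/-- The ideal generated by the polynomials `X b ^ N + L b`. -/
def boxIdeal : Ideal (MvPolynomial ι V) :=
  Ideal.span (Set.range fun b => MvPolynomial.X b ^ N + L b)

/-- Substitute `X b ^ N + L b` for `X b ^ N` in the monomial `X ^ e`. -/
def boxMonomial (e : ι →₀ ℕ) : MvPolynomial ι V :=
  MvPolynomial.monomial (e.mapRange (· % N) (Nat.zero_mod N)) 1 *
    ∏ b, (MvPolynomial.X b ^ N + L b) ^ (e b / N)

/-- The linear extension of `boxMonomial`. -/
def boxMap : MvPolynomial ι V →ₗ[V] MvPolynomial ι V :=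
  (MvPolynomial.basisMonomials ι V).constr V (boxMonomial N L)

theorem boxMap_monomial (e : ι →₀ ℕ) :
    boxMap N L (MvPolynomial.monomial e 1) = boxMonomial N L e := by
  have := (MvPolynomial.basisMonomials ι V).constr_basis V (boxMonomial N L) e
  rwa [MvPolynomial.coe_basisMonomials] at this

variable {N L}

theorem boxMap_bijective (hL : ∀ b, L b ∈ lowDegree V ι N) : Function.Bijective (boxMap N L) := by
  refine bijective_of_hasLeadingMonomial fun e => ?_
  have h1 : ∀ b, HasLeadingMonomial (MvPolynomial.X b ^ N + L b) (Finsupp.single b N) := fun b => by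
    rw [HasLeadingMonomial, ← MvPolynomial.X_pow_eq_monomial, add_sub_cancel_left,
      Finsupp.degree_single]
    exact hL b
  have h2 := (hasLeadingMonomial_monomial (V := V) (e.mapRange (· % N) (Nat.zero_mod N))).mul
    (HasLeadingMonomial.prod Finset.univ fun b _ => (h1 b).pow (e b / N))
  have hexp : e.mapRange (· % N) (Nat.zero_mod N) + ∑ b, (e b / N) • Finsupp.single b N = e := by
    ext b
    rw [Finsupp.add_apply, Finsupp.mapRange_apply, Finsupp.coe_finsetSum, Finset.sum_apply,
      Finset.sum_eq_single b]
    · rw [Finsupp.smul_apply, Finsupp.single_eq_same, smul_eq_mul, mul_comm (e b / N)]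
      exact Nat.mod_add_div (e b) N
    · intro c _ hc
      rw [Finsupp.smul_apply, Finsupp.single_eq_of_ne hc.symm, smul_zero]
    · simp
  rw [hexp] at h2
  rw [boxMap_monomial]
  exact h2

theorem boxMap_X_pow_mul (hN : 0 < N) (b : ι) (u : MvPolynomial ι V) :
    boxMap N L (MvPolynomial.X b ^ N * u) = (MvPolynomial.X b ^ N + L b) * boxMap N L u := by
  classical
  have : boxMap N L ∘ₗ LinearMap.mulLeft V (MvPolynomial.X b ^ N) =
      LinearMap.mulLeft V (MvPolynomial.X b ^ N + L b) ∘ₗ boxMap N L := by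
    refine (MvPolynomial.basisMonomials ι V).ext fun e => ?_
    rw [MvPolynomial.coe_basisMonomials, LinearMap.comp_apply, LinearMap.comp_apply,
      LinearMap.mulLeft_apply, LinearMap.mulLeft_apply, MvPolynomial.X_pow_eq_monomial, MvPolynomial.monomial_mul, one_mul, boxMap_monomial,
      boxMap_monomial, boxMonomial, boxMonomial, mul_left_comm, ← MvPolynomial.X_pow_eq_monomial]
    congr 1
    · congr 2
      ext c
      rw [Finsupp.mapRange_apply, Finsupp.mapRange_apply, Finsupp.add_apply]
      rcases eq_or_ne c b with rfl | hc
      · rw [Finsupp.single_eq_same, Nat.add_mod_left]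
      · rw [Finsupp.single_eq_of_ne hc, zero_add]
    · rw [← Finset.mul_prod_erase _ _ (Finset.mem_univ b), ← Finset.mul_prod_erase Finset.univ
        (fun c => (MvPolynomial.X c ^ N + L c) ^ (e c / N)) (Finset.mem_univ b), ← mul_assoc,
        Finsupp.add_apply, Finsupp.single_eq_same, Nat.add_div_left _ hN, pow_succ']
      congr 1
      refine Finset.prod_congr rfl fun c hc => ?_
      rw [Finsupp.add_apply, Finsupp.single_eq_of_ne (Finset.ne_of_mem_erase hc), zero_add]
  exact LinearMap.congr_fun this u

/-- The exponents less than `N`. -/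
def boxExponent (x : ι → Fin N) : ι →₀ ℕ := Finsupp.equivFunOnFinite.symm fun b => x b

theorem boxExponent_apply (x : ι → Fin N) (b : ι) : boxExponent x b = x b := rfl

theorem boxExponent_injective : Function.Injective (boxExponent : (ι → Fin N) → ι →₀ ℕ) :=
  fun _ _ h => funext fun b => Fin.ext (DFunLike.congr_fun h b)

theorem boxMonomial_boxExponent (x : ι → Fin N) :
    boxMonomial N L (boxExponent x) = MvPolynomial.monomial (boxExponent x) 1 := by
  have h1 : (boxExponent x).mapRange (· % N) (Nat.zero_mod N) = boxExponent x := by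
    ext b
    exact Nat.mod_eq_of_lt (x b).2
  rw [boxMonomial, h1, Finset.prod_eq_one, mul_one]
  intro b _
  rw [boxExponent_apply, Nat.div_eq_of_lt (x b).2, pow_zero]

/-- The coordinates modulo `boxIdeal N L`. -/
def boxCoord (hL : ∀ b, L b ∈ lowDegree V ι N) : MvPolynomial ι V →ₗ[V] ((ι → Fin N) → V) :=
  LinearMap.pi fun x => MvPolynomial.lcoeff V (boxExponent x) ∘ₗ
    (LinearEquiv.ofBijective _ (boxMap_bijective hL)).symm.toLinearMap

theorem boxCoord_boxMap (hL : ∀ b, L b ∈ lowDegree V ι N) (u : MvPolynomial ι V) (x : ι → Fin N) :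
    boxCoord hL (boxMap N L u) x = u.coeff (boxExponent x) := by
  change MvPolynomial.coeff (boxExponent x)
    ((LinearEquiv.ofBijective _ (boxMap_bijective hL)).symm (boxMap N L u)) = _
  congr 1
  exact (LinearEquiv.ofBijective _ (boxMap_bijective hL)).symm_apply_apply u

theorem boxCoord_monomial (hL : ∀ b, L b ∈ lowDegree V ι N) (x : ι → Fin N) :
    boxCoord hL (MvPolynomial.monomial (boxExponent x) 1) = Pi.single x 1 := by
  classical
  funext y
  rw [← boxMonomial_boxExponent (L := L), ← boxMap_monomial, boxCoord_boxMap,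
    MvPolynomial.coeff_monomial, Pi.single_apply]
  simp only [boxExponent_injective.eq_iff, eq_comm]

theorem boxCoord_eq_zero (hN : 0 < N) (hL : ∀ b, L b ∈ lowDegree V ι N) {p : MvPolynomial ι V} :
    boxCoord hL p = 0 ↔ p ∈ boxIdeal N L := by
  constructor
  · intro h
    obtain ⟨u, rfl⟩ := (boxMap_bijective hL).2 p
    rw [u.as_sum, map_sum]
    refine sum_mem fun e he => ?_
    have he' : ∃ b, N ≤ e b := by
      by_contra! hlt
      have hbox : boxExponent (fun b => (⟨e b, hlt b⟩ : Fin N)) = e := Finsupp.ext fun b => rfl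
      have := congrFun h fun b => ⟨e b, hlt b⟩
      rw [boxCoord_boxMap, hbox] at this
      exact MvPolynomial.mem_support_iff.1 he this
    obtain ⟨b, hb⟩ := he'
    have : MvPolynomial.monomial e (u.coeff e) = MvPolynomial.X b ^ N *
        MvPolynomial.monomial (e - Finsupp.single b N) (u.coeff e) := by
      rw [MvPolynomial.X_pow_eq_monomial, MvPolynomial.monomial_mul, one_mul,
        add_tsub_cancel_of_le (Finsupp.single_le_iff.2 hb)]
    rw [this, boxMap_X_pow_mul hN]
    exact Ideal.mul_mem_right _ _ (Ideal.subset_span ⟨b, rfl⟩)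
  · intro h
    obtain ⟨c, rfl⟩ := Ideal.mem_span_range_iff_exists_fun.1 h
    rw [map_sum]
    refine Finset.sum_eq_zero fun b _ => ?_
    obtain ⟨u, hu⟩ := (boxMap_bijective hL).2 (c b)
    rw [← hu, mul_comm, ← boxMap_X_pow_mul hN]
    funext x
    rw [boxCoord_boxMap, MvPolynomial.X_pow_eq_monomial, MvPolynomial.coeff_monomial_mul', if_neg]
    · rfl
    · rw [Finsupp.single_le_iff, boxExponent_apply]
      exact not_le.2 (x b).2

/-- The coordinates on the quotient by `boxIdeal N L`. -/
def boxEquiv (hN : 0 < N) (hL : ∀ b, L b ∈ lowDegree V ι N) :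
    (MvPolynomial ι V ⧸ boxIdeal N L) ≃ₗ[V] ((ι → Fin N) → V) :=
  ((Submodule.quotEquivOfEq ((boxIdeal N L).restrictScalars V) (LinearMap.ker (boxCoord hL))
    (by ext p; exact (boxCoord_eq_zero hN hL).symm)).trans
      ((boxCoord hL).quotKerEquivOfSurjective fun y => by
        classical
        refine ⟨∑ x, y x • MvPolynomial.monomial (boxExponent x) 1, ?_⟩
        simp only [map_sum, map_smul, boxCoord_monomial]
        exact (pi_eq_sum_univ' y).symm))

/-- The quotient by `boxIdeal N L` is free on the monomials with all exponents less than `N`. -/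
def boxBasis (hN : 0 < N) (hL : ∀ b, L b ∈ lowDegree V ι N) :
    Basis (ι → Fin N) V (MvPolynomial ι V ⧸ boxIdeal N L) :=
  .ofEquivFun (boxEquiv hN hL)

theorem boxBasis_apply (hN : 0 < N) (hL : ∀ b, L b ∈ lowDegree V ι N) (x : ι → Fin N) :
    boxBasis hN hL x = Ideal.Quotient.mk _ (MvPolynomial.monomial (boxExponent x) 1) := by
  rw [boxBasis, Basis.coe_ofEquivFun, LinearEquiv.symm_apply_eq, ← boxCoord_monomial hL]
  rfl

end Box

end

noncomputable section

open Module

/-! ### Complete intersections are limits of split algebras -/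

section BoxFamily

variable {V V' ι : Type*} [CommRing V] [CommRing V'] [Fintype ι] {N : ℕ}

theorem exists_boxQuotient_ringHom (hN : 0 < N) {L : ι → MvPolynomial ι V}
    {L' : ι → MvPolynomial ι V'} (hL : ∀ b, L b ∈ lowDegree V ι N)
    (hL' : ∀ b, L' b ∈ lowDegree V' ι N) (φ : V →+* V')
    (hφ : ∀ b, L' b = MvPolynomial.map φ (L b)) :
    ∃ ρ : (MvPolynomial ι V ⧸ boxIdeal N L) →+* (MvPolynomial ι V' ⧸ boxIdeal N L'),
      (∀ p, ρ (Ideal.Quotient.mk _ p) = Ideal.Quotient.mk _ (MvPolynomial.map φ p)) ∧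
      (∀ r, ρ (algebraMap V _ r) = algebraMap V' _ (φ r)) ∧
      ∀ x, ρ (boxBasis hN hL x) = boxBasis hN hL' x := by
  have hle : boxIdeal N L ≤ (boxIdeal N L').comap (MvPolynomial.map φ) := by
    refine Ideal.span_le.2 ?_
    rintro _ ⟨b, rfl⟩
    refine Ideal.subset_span ⟨b, ?_⟩
    simp [hφ]
  refine ⟨Ideal.quotientMap _ (MvPolynomial.map φ) hle, fun p => Ideal.quotientMap_mk,
    fun r => ?_, fun x => ?_⟩
  · change Ideal.quotientMap _ _ hle (Ideal.Quotient.mk _ (MvPolynomial.C r)) =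
      Ideal.Quotient.mk _ (MvPolynomial.C (φ r))
    rw [Ideal.quotientMap_mk, MvPolynomial.map_C]
  · rw [boxBasis_apply, boxBasis_apply, Ideal.quotientMap_mk, MvPolynomial.map_monomial, map_one]

theorem discr_boxBasis_map [DecidableEq ι] (hN : 0 < N) {L : ι → MvPolynomial ι V}
    {L' : ι → MvPolynomial ι V'} (hL : ∀ b, L b ∈ lowDegree V ι N)
    (hL' : ∀ b, L' b ∈ lowDegree V' ι N) (φ : V →+* V')
    (hφ : ∀ b, L' b = MvPolynomial.map φ (L b)) :
    Algebra.discr V' (boxBasis hN hL') = φ (Algebra.discr V (boxBasis hN hL)) := by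
  obtain ⟨ρ, -, hρ, hb⟩ := exists_boxQuotient_ringHom hN hL hL' φ hφ
  exact discr_of_semilinear φ ρ hρ hb

end BoxFamily

section Grid

variable {k ι : Type*} [Field k] {N : ℕ}

/-- The lower order terms of the polynomial `∏ (X b - a c)`, which cuts out a grid of points. -/
def gridTail (a : Fin N → k) (b : ι) : MvPolynomial ι k :=
  ∏ c, (MvPolynomial.X b - MvPolynomial.C (a c)) - MvPolynomial.X b ^ N

theorem gridTail_mem_lowDegree (a : Fin N → k) (b : ι) : gridTail a b ∈ lowDegree k ι N := by
  have h1 : HasLeadingMonomial (∏ c, (MvPolynomial.X b - MvPolynomial.C (a c)))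
      (∑ _c : Fin N, Finsupp.single b 1) := by
    refine HasLeadingMonomial.prod _ fun c _ => ?_
    have : MvPolynomial.X b = MvPolynomial.monomial (Finsupp.single b 1) (1 : k) := rfl
    rw [HasLeadingMonomial, ← this, sub_sub_cancel_left, neg_mem_iff]
    exact monomial_mem_lowDegree (by simp) _
  have h2 : ∑ _c : Fin N, Finsupp.single b 1 = Finsupp.single b N := by simp
  rw [h2, HasLeadingMonomial, ← MvPolynomial.X_pow_eq_monomial, Finsupp.degree_single] at h1
  exact h1

/-- The quotient by the ideal of a grid is split. -/
theorem discr_boxBasis_gridTail_ne_zero [Fintype ι] [DecidableEq ι] (hN : 0 < N) {a : Fin N → k}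
    (ha : Function.Injective a) :
    Algebra.discr k (boxBasis hN fun b : ι => gridTail_mem_lowDegree a b) ≠ 0 := by
  set β := boxBasis hN fun b : ι => gridTail_mem_lowDegree a b
  let ev : MvPolynomial ι k →+* ((ι → Fin N) → k) :=
    RingHom.pi fun x => MvPolynomial.eval fun b => a (x b)
  have hev : ∀ p ∈ boxIdeal N (gridTail a), ev p = 0 := by
    intro p hp
    have : boxIdeal N (gridTail a) ≤ RingHom.ker ev := by
      refine Ideal.span_le.2 ?_
      rintro _ ⟨b, rfl⟩
      refine funext fun x => ?_
      change MvPolynomial.eval (fun b => a (x b)) (MvPolynomial.X b ^ N + gridTail a b) = 0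
      rw [gridTail, add_sub_cancel, map_prod, Finset.prod_eq_zero (Finset.mem_univ (x b))]
      simp
    exact this hp
  let ρ : (MvPolynomial ι k ⧸ boxIdeal N (gridTail a)) →+* ((ι → Fin N) → k) :=
    Ideal.Quotient.lift _ ev hev
  have hρC : ∀ r, ρ (algebraMap k _ r) = algebraMap k _ ((RingHom.id k) r) := fun r =>
    funext fun x => MvPolynomial.eval_C _
  have hli : LinearIndependent k fun x => ρ (β x) := by
    rw [Fintype.linearIndependent_iff]
    intro c hc
    set p : MvPolynomial ι k := ∑ x, MvPolynomial.monomial (boxExponent x) (c x) with hp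
    have hp0 : ∀ y : ι → Fin N, MvPolynomial.eval (fun b => a (y b)) p = 0 := by
      intro y
      have h1 := congrFun hc y
      rw [Finset.sum_apply] at h1
      rw [hp, map_sum, ← h1.trans (Pi.zero_apply y)]
      refine Finset.sum_congr rfl fun x _ => ?_
      rw [Pi.smul_apply, smul_eq_mul, boxBasis_apply]
      change _ = c x * MvPolynomial.eval (fun b => a (y b)) (MvPolynomial.monomial (boxExponent x) 1)
      rw [MvPolynomial.eval_monomial, MvPolynomial.eval_monomial, one_mul]
    have hpz : p = 0 := by
      classical
      refine MvPolynomial.eq_zero_of_eval_zero_at_prod_finset p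
        (fun _ => Finset.univ.image a) (fun b => ?_) fun x hx => ?_
      · rw [Finset.card_image_of_injective _ ha, Finset.card_univ, Fintype.card_fin,
          MvPolynomial.degreeOf_lt_iff hN]
        intro m hm
        rw [hp] at hm
        obtain ⟨x, -, hx⟩ := Finset.mem_biUnion.1 (MvPolynomial.support_sum hm)
        rw [Finset.mem_singleton.1 (MvPolynomial.support_monomial_subset hx), boxExponent_apply]
        exact (x b).2
      · choose y _ hy using fun b => Finset.mem_image.1 (hx b)
        rw [← funext hy]
        exact hp0 y
    intro x
    have h1 : p.coeff (boxExponent x) = c x := by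
      classical
      rw [hp, MvPolynomial.coeff_sum, Finset.sum_eq_single x]
      · rw [MvPolynomial.coeff_monomial, if_pos rfl]
      · intro y _ hy
        rw [MvPolynomial.coeff_monomial, if_neg (boxExponent_injective.ne hy)]
      · simp
    rw [← h1, hpz, MvPolynomial.coeff_zero]
  classical
  let b' : Basis (ι → Fin N) k ((ι → Fin N) → k) :=
    basisOfLinearIndependentOfCardEqFinrank' _ hli (by simp)
  have h := discr_of_semilinear (RingHom.id k) ρ hρC (b := β) (b' := b') fun x => by simp [b']
  rw [RingHom.id_apply] at h
  rw [← h]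
  exact discr_pi_ne_zero b'

end Grid

section CompleteIntersection

open PowerSeries in
/-- An ideal that is generated by as many elements as there are variables, up to its square, and
contains a power of the maximal ideal at the origin, defines a limit of split algebras: adding high
powers of the variables to the generators only adds further factors to the quotient, and the
resulting complete intersection deforms to a grid of points. -/
theorem isLimitOfSplit_quotient_of_le_span_sup {k : Type*} [Field k] [Infinite k] {n : ℕ}
    {I : Ideal (MvPolynomial (Fin n) k)} {i : Fin n → MvPolynomial (Fin n) k} (hi : ∀ b, i b ∈ I)
    (hgen : I ≤ Ideal.span (Set.range i) ⊔ I * I) {M : ℕ}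
    (hM : MvPolynomial.idealOfVars (Fin n) k ^ M ≤ I) :
    IsLimitOfSplit k (MvPolynomial (Fin n) k ⧸ I) := by
  -- Choose `N` such that `X b ^ N ∈ I²` and `N` exceeds the degrees of the generators.
  obtain ⟨N, hN, hNM, hNi⟩ : ∃ N, 0 < N ∧ M + M ≤ N ∧ ∀ b, i b ∈ lowDegree k (Fin n) N := by
    choose d hd using fun b => exists_mem_lowDegree (i b)
    refine ⟨M + M + ∑ b, d b + 1, by omega, by omega, fun b => lowDegree_mono ?_ (hd b)⟩
    have := Finset.single_le_sum (f := d) (fun _ _ => Nat.zero_le _) (Finset.mem_univ b)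
    omega
  have hXN : ∀ b, (MvPolynomial.X b : MvPolynomial (Fin n) k) ^ N ∈ I * I := fun b => by
    have h1 : (MvPolynomial.X b : MvPolynomial (Fin n) k) ∈ MvPolynomial.idealOfVars (Fin n) k :=
      Ideal.subset_span ⟨b, rfl⟩
    have h2 := Ideal.pow_le_pow_right hNM (Ideal.pow_mem_pow h1 N)
    rw [pow_add] at h2
    exact Ideal.mul_mono hM hM h2
  set J := boxIdeal N i with hJ
  have hJI : J ≤ I := by
    refine Ideal.span_le.2 ?_
    rintro _ ⟨b, rfl⟩
    exact I.add_mem (Ideal.mul_le_left (hXN b)) (hi b)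
  have hIJ : I ≤ J ⊔ I * I := by
    refine hgen.trans (sup_le (Ideal.span_le.2 ?_) le_sup_right)
    rintro _ ⟨b, rfl⟩
    have h1 : i b = (MvPolynomial.X b ^ N + i b) - MvPolynomial.X b ^ N := by ring
    rw [SetLike.mem_coe, h1]
    exact sub_mem (Ideal.mem_sup_left (Ideal.subset_span ⟨b, rfl⟩)) (Ideal.mem_sup_right (hXN b))
  -- Modulo `J`, the ideal `I` is idempotent, hence generated by an idempotent.
  obtain ⟨ε, hε, hIε⟩ : ∃ ε : MvPolynomial (Fin n) k, ε * ε - ε ∈ J ∧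
      I.map (Ideal.Quotient.mk J) = Ideal.span {Ideal.Quotient.mk J ε} := by
    have hid : IsIdempotentElem (I.map (Ideal.Quotient.mk J)) := by
      refine le_antisymm Ideal.mul_le_left ?_
      have := Ideal.map_mono (f := Ideal.Quotient.mk J) hIJ
      rwa [Ideal.map_sup, Ideal.map_quotient_self, bot_sup_eq, Ideal.map_mul] at this
    obtain ⟨e, he, heI⟩ := (Ideal.isIdempotentElem_iff_of_fg _
      (IsNoetherian.noetherian (I.map (Ideal.Quotient.mk J)))).1 hid
    obtain ⟨ε, rfl⟩ := Ideal.Quotient.mk_surjective e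
    refine ⟨ε, ?_, heI⟩
    rw [← Ideal.Quotient.eq, map_mul]
    exact he
  -- Deform the equations to those of a grid.
  let a : Fin N → k := fun c => Infinite.natEmbedding k c
  have ha : Function.Injective a := fun c c' h => Fin.ext ((Infinite.natEmbedding k).injective h)
  let L (V : Type _) [CommRing V] [Algebra k V] (t : V) (b : Fin n) : MvPolynomial (Fin n) V :=
    MvPolynomial.map (algebraMap k V) (i b) +
      t • (MvPolynomial.map (algebraMap k V) (gridTail a b - i b))
  have hL : ∀ (V : Type _) [CommRing V] [Algebra k V] (t : V) (b : Fin n),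
      L V t b ∈ lowDegree V (Fin n) N := fun V _ _ t b =>
    add_mem (map_mem_lowDegree _ (hNi b)) (Submodule.smul_mem _ _
      (map_mem_lowDegree _ (sub_mem (gridTail_mem_lowDegree a b) (hNi b))))
  have hLmap : ∀ {V V' : Type _} [CommRing V] [Algebra k V] [CommRing V'] [Algebra k V']
      (φ : V →ₐ[k] V') (t : V) (b : Fin n), L V' (φ t) b =
        MvPolynomial.map (φ : V →+* V') (L V t b) := fun φ t b => by
    simp only [L, map_add, MvPolynomial.smul_eq_C_mul, map_mul, MvPolynomial.map_C,
      MvPolynomial.map_map, AlgHom.comp_algebraMap]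
    rfl
  have hdiscr : Algebra.discr k⟦X⟧ (boxBasis hN (hL k⟦X⟧ X)) ≠ 0 := by
    have h1 := discr_boxBasis_map hN (hL (Polynomial k) Polynomial.X)
      (fun b => gridTail_mem_lowDegree a b) (Polynomial.aeval (1 : k) : Polynomial k →ₐ[k] k)
      fun b => by
        rw [← hLmap, Polynomial.aeval_X]
        simp [L, MvPolynomial.map_id]
    have h2 : Algebra.discr (Polynomial k) (boxBasis hN (hL (Polynomial k) Polynomial.X)) ≠ 0 := by
      intro h0
      rw [h0, map_zero] at h1
      exact discr_boxBasis_gridTail_ne_zero hN ha h1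
    have h3 := discr_boxBasis_map hN (hL (Polynomial k) Polynomial.X) (hL k⟦X⟧ X)
      (Polynomial.coeToPowerSeries.algHom k : Polynomial k →ₐ[k] k⟦X⟧) fun b => by
        rw [← hLmap]
        congr 1
        simp
    rw [h3]
    refine (map_ne_zero_iff _ fun p q h => ?_).2 h2
    simpa using h
  have hcid : (PowerSeries.constantCoeff (R := k)).comp (algebraMap k k⟦X⟧) = RingHom.id k :=
    RingHom.ext fun c => PowerSeries.constantCoeff_C c
  obtain ⟨σ, hσ, hσC, hσb⟩ := exists_boxQuotient_ringHom hN (hL k⟦X⟧ X) hNi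
    (PowerSeries.constantCoeff (R := k)) fun b => by
      simp only [L, map_add, MvPolynomial.smul_eq_C_mul, map_mul, MvPolynomial.map_C,
        PowerSeries.constantCoeff_X, MvPolynomial.C_0, zero_mul, add_zero, MvPolynomial.map_map,
        hcid, MvPolynomial.map_id]
  have hσs : Function.Surjective σ := by
    intro y
    obtain ⟨p, rfl⟩ := Ideal.Quotient.mk_surjective y
    refine ⟨Ideal.Quotient.mk _ (MvPolynomial.map (algebraMap k k⟦X⟧) p), ?_⟩
    rw [hσ, MvPolynomial.map_map, hcid, MvPolynomial.map_id]
  have hXker : RingHom.ker (PowerSeries.constantCoeff (R := k)) = Ideal.span {X} := by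
    ext r
    rw [RingHom.mem_ker, Ideal.mem_span_singleton, PowerSeries.X_dvd_iff]
  have hσker : RingHom.ker σ = Ideal.span {algebraMap k⟦X⟧ _ X} := by
    rw [ker_of_semilinear _ σ hσC hσb, hXker, Ideal.map_span,
      Set.image_singleton]
  obtain ⟨ε', hε'⟩ := hσs (Ideal.Quotient.mk J ε)
  refine isLimitOfSplit_of_idempotent (boxBasis hN (hL k⟦X⟧ X)) hdiscr
    (ρ := (Ideal.Quotient.factor hJI).comp σ) (ε := ε') ?_ ?_ ?_ ?_
  · exact (Ideal.Quotient.factor_surjective hJI).comp hσs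
  · intro r
    rw [RingHom.comp_apply, hσC]
    rfl
  · rw [← hσker, RingHom.mem_ker, map_sub, map_mul, hε', ← map_mul, ← map_sub]
    exact Ideal.Quotient.eq_zero_iff_mem.2 hε
  · have hfac : RingHom.ker (Ideal.Quotient.factor hJI) = Ideal.span {Ideal.Quotient.mk J ε} := by
      rw [Ideal.Quotient.factor_ker, hIε]
    rw [← RingHom.comap_ker, hfac, ← hε', ← Set.image_singleton, ← Ideal.map_span,
      Ideal.comap_map_of_surjective σ hσs, ← RingHom.ker_eq_comap_bot, hσker, ← Ideal.span_union,
      Set.union_comm]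
    rfl

end CompleteIntersection

end

noncomputable section

open Polynomial hiding contract contract_one

/-! ### Apolar algebras of iterated ray sums -/

section ApolarLimit

variable {k : Type*} [Field k] [Infinite k]

theorem isLimitOfSplit_polyAnn {n : ℕ} {f : MvPolynomial (Fin n) k}
    (h : IsFreeConormal (polyAnn f) n) : IsLimitOfSplit k (MvPolynomial (Fin n) k ⧸ polyAnn f) := by
  obtain ⟨i, hi, hgen, -⟩ := h
  refine isLimitOfSplit_quotient_of_le_span_sup hi (fun x hx => ?_)
    (idealOfVars_pow_le_polyAnn f (Nat.lt_succ_self _))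
  obtain ⟨r, hr⟩ := hgen x hx
  rw [← sub_add_cancel x (∑ b, r b * i b)]
  exact add_mem (Ideal.mem_sup_right hr) (Ideal.mem_sup_left
    (sum_mem fun b _ => Ideal.mul_mem_left _ _ (Ideal.subset_span ⟨b, rfl⟩)))

variable {ι : Type*} [Finite ι]

theorem isLimitOfSplit_polyAnn_raySum {f D : MvPolynomial ι k} {d : ℕ} (hd : 2 ≤ d)
    (hD2 : contract (D : MvPowerSeries ι k) (contract (D : MvPowerSeries ι k) f) = 0)
    (hf : IsLimitOfSplit k (MvPolynomial ι k ⧸ polyAnn f))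
    (hDf : IsLimitOfSplit k (MvPolynomial ι k ⧸ polyAnn (contract (D : MvPowerSeries ι k) f))) :
    IsLimitOfSplit k (MvPolynomial (Option ι) k ⧸ polyAnn (MvPolynomial.rename some f +
      MvPolynomial.X none ^ d * MvPolynomial.rename some (contract (D : MvPowerSeries ι k) f))) := by
  have := finite_quotient_polyAnn f
  have := finite_quotient_polyAnn (contract (D : MvPowerSeries ι k) f)
  have hDK : D ∈ polyAnn (contract (D : MvPowerSeries ι k) f) := mem_polyAnn.2 hD2
  refine (IsLimitOfSplit.quotient_rayIdeal (polyAnn_le_polyAnn_contract f _) hDK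
    (mul_mem_polyAnn_iff.2 hDK) (fun κ hκ => mul_mem_polyAnn_iff.2 hκ) hf hDf
    (by omega : 1 ≤ d)).of_algEquiv
      (Ideal.quotientEquivAlg _ _ (MvPolynomial.optionEquivLeft k ι) ?_).symm
  exact (map_polyAnn_raySum hd hD2).symm

theorem isLimitOfSplit_polyAnn_X_none_pow {d : ℕ} (hd : 2 ≤ d)
    (h1 : IsLimitOfSplit k (MvPolynomial ι k ⧸ polyAnn (1 : MvPolynomial ι k))) :
    IsLimitOfSplit k (MvPolynomial (Option ι) k ⧸
      polyAnn (MvPolynomial.X none ^ (d - 1) : MvPolynomial (Option ι) k)) := by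
  have := finite_quotient_polyAnn (1 : MvPolynomial ι k)
  have h0 : (0 : MvPolynomial ι k) ∈ polyAnn (1 : MvPolynomial ι k) := zero_mem _
  refine (IsLimitOfSplit.quotient_rayIdeal le_rfl h0 (by rwa [mul_zero])
    (fun κ _ => by rwa [mul_zero]) h1 h1 (by omega : 1 ≤ d)).of_algEquiv
      (Ideal.quotientEquivAlg _ _ (MvPolynomial.optionEquivLeft k ι) ?_).symm
  exact (map_polyAnn_X_none_pow hd h0).symm

theorem isLimitOfSplit_polyAnn_raySum_raySum {f D σ : MvPolynomial ι k} {d m : ℕ} (hd : 2 ≤ d)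
    (hm : 2 ≤ m) (hD2 : contract (D : MvPowerSeries ι k) (contract (D : MvPowerSeries ι k) f) = 0)
    (hdeg : 0 < (contract (D : MvPowerSeries ι k) f).totalDegree)
    (hs : contract (σ : MvPowerSeries ι k) (contract (D : MvPowerSeries ι k) f) = 1)
    (hf : IsLimitOfSplit k (MvPolynomial ι k ⧸ polyAnn f))
    (hDf : IsLimitOfSplit k (MvPolynomial ι k ⧸ polyAnn (contract (D : MvPowerSeries ι k) f)))
    (h1 : IsLimitOfSplit k (MvPolynomial ι k ⧸ polyAnn (1 : MvPolynomial ι k))) :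
    IsLimitOfSplit k (MvPolynomial (Option (Option ι)) k ⧸
      polyAnn (MvPolynomial.rename some (MvPolynomial.rename some f +
        MvPolynomial.X none ^ d * MvPolynomial.rename some
          (contract (D : MvPowerSeries ι k) f)) +
      MvPolynomial.X none ^ m * MvPolynomial.rename some (MvPolynomial.X none ^ (d - 1)))) := by
  set φ : MvPolynomial (Option ι) k := MvPolynomial.rename some σ * MvPolynomial.X none with hφ
  have hφ' : (φ : MvPowerSeries (Option ι) k) =
      MvPowerSeries.rename some (σ : MvPowerSeries ι k) * MvPowerSeries.X none := by
    rw [hφ, MvPolynomial.coe_mul, MvPolynomial.coe_X, MvPowerSeries.rename_coe]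
  have h2 : contract (φ : MvPowerSeries (Option ι) k) (MvPolynomial.rename some f +
      MvPolynomial.X none ^ d * MvPolynomial.rename some (contract (D : MvPowerSeries ι k) f)) =
        MvPolynomial.X none ^ (d - 1) := by
    rw [hφ', contract_rename_mul_X_none_raySum (by omega) hs]
  have h3 : contract (φ : MvPowerSeries (Option ι) k) (MvPolynomial.X none ^ (d - 1)) = 0 := by
    rw [hφ', contract_rename_mul_X_none_X_none_pow
      (constantCoeff_eq_zero_of_contract_eq_one hdeg hs)]
  have h4 := isLimitOfSplit_polyAnn_raySum (f := MvPolynomial.rename some f +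
      MvPolynomial.X none ^ d * MvPolynomial.rename some (contract (D : MvPowerSeries ι k) f))
    (D := φ) hm (by rw [h2, h3]) (isLimitOfSplit_polyAnn_raySum hd hD2 hf hDf)
    (by rw [h2]; exact isLimitOfSplit_polyAnn_X_none_pow hd h1)
  rwa [h2] at h4

end ApolarLimit

end

theorem mainTheorem11 {k : Type*} [Field k] [IsAlgClosed k]
    (hk2 : ringChar k ≠ 2) (hk3 : ringChar k ≠ 3) {n : ℕ}
    (f : MvPolynomial (Fin n) k) (D : MvPowerSeries (Fin n) k) (d m : ℕ)
    (hd : 2 ≤ d) (hm : 2 ≤ m) (hchar : ringChar k = 0 ∨ d ≤ ringChar k)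
    (hf : IsCompleteIntersection (apolarIdeal f))
    (hDf : IsCompleteIntersection (apolarIdeal (contract D f)))
    (hD2 : contract (D ^ 2) f = 0)
    (hdeg : 0 < (contract D f).totalDegree) :
    (∃ s : MvPowerSeries (Fin n) k, contract s (contract D f) = 1) ∧
    ∀ s : MvPowerSeries (Fin n) k, contract s (contract D f) = 1 →
      ∀ (g : MvPolynomial (Option (Fin n)) k) (h : MvPolynomial (Option (Option (Fin n))) k),
        g = raySum d f D →
        h = raySum m g (MvPowerSeries.rename some s * MvPowerSeries.X none) →
        g = MvPolynomial.rename some f +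
            MvPolynomial.X none ^ d * MvPolynomial.rename some (contract D f) ∧
        h = MvPolynomial.rename (some ∘ some) f +
            MvPolynomial.X (some none) ^ d *
              MvPolynomial.rename (some ∘ some) (contract D f) +
            MvPolynomial.X none ^ m * MvPolynomial.X (some none) ^ (d - 1) ∧
        IsUnobstructed (apolarPresentation h) := by
  have hD2' : contract D (contract D f) = 0 := by rw [← contract_mul, ← pow_two, hD2]
  have hF0 : contract D f ≠ 0 := fun h => by
    rw [h, MvPolynomial.totalDegree_zero] at hdeg
    exact hdeg.false
  refine ⟨exists_contract_eq_one hF0, fun s hs g h hg hh => ?_⟩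
  have hle := totalDegree_contract_le D f
  have hg' := hg.trans (raySum_eq_of_sq (d := d) (hdeg.trans_le hle) hD2)
  have hh' : h = MvPolynomial.rename some (MvPolynomial.rename some f +
        MvPolynomial.X none ^ d * MvPolynomial.rename some (contract D f)) +
      MvPolynomial.X none ^ m * MvPolynomial.rename some (MvPolynomial.X none ^ (d - 1)) := by
    rw [hh, hg, raySum_raySum_eq hd hD2 hdeg hs]
  refine ⟨hg', ?_, ?_⟩
  · rw [hh']
    simp [MvPolynomial.rename_rename]
  -- Only the low order terms of `D` and `s` matter, so they may be replaced by polynomials.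
  set D₀ := MvPowerSeries.truncTotal (f.totalDegree + 1) D with hD₀
  set σ := MvPowerSeries.truncTotal (f.totalDegree + 1) s with hσ
  have hDf₀ : contract (D₀ : MvPowerSeries (Fin n) k) f = contract D f :=
    contract_truncTotal D (Nat.lt_succ_self _)
  have hD₀2 : contract (D₀ : MvPowerSeries (Fin n) k) (contract (D₀ : MvPowerSeries (Fin n) k) f)
      = 0 := by
    rw [hDf₀, hD₀, contract_truncTotal D (Nat.lt_succ_of_le hle), hD2']
  have hσ₀ : contract (σ : MvPowerSeries (Fin n) k) (contract (D₀ : MvPowerSeries (Fin n) k) f)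
      = 1 := by
    rw [hDf₀, hσ, contract_truncTotal s (Nat.lt_succ_of_le hle), hs]
  rw [← hDf₀] at hDf hdeg hh'
  have hcard : Fintype.card (Option (Option (Fin n))) = n + 2 := by simp
  have hsurj := apolarPresentation_surjective h
  have hker := ker_apolarPresentation h
  let E : (MvPolynomial (Option (Option (Fin n))) k ⧸ polyAnn h) ≃ₐ[k] Apolar h :=
    (Ideal.quotientEquivAlgOfEq k hker.symm).trans (Ideal.quotientKerAlgEquivOfSurjective hsurj)
  have hfin := finite_apolar h
  refine ⟨hsurj, hfin, ?_, ?_⟩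
  · have hlim := isLimitOfSplit_polyAnn_raySum_raySum hd hm hD₀2 hdeg hσ₀
      (isLimitOfSplit_polyAnn hf.isFreeConormal) (isLimitOfSplit_polyAnn hDf.isFreeConormal)
      (isLimitOfSplit_polyAnn (isFreeConormal_polyAnn_one n))
    rw [← hh'] at hlim
    exact (hlim.of_algEquiv E).isSmoothable
  · rw [hker, hcard, ← E.toLinearEquiv.finrank_eq]
    refine hasTangentDim_polyAnn ?_
    rw [finrank_quotient_polyAnn_mul_self hd hm hD₀2 hdeg hσ₀ hf hDf hh']
    ring
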